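/- For a lattice $\Gamma\subset\mathbb R^4$ and $R\in\mathrm O(4)$ put $\Gamma(R)=\Gamma\cap R\Gamma$ and $\Sigma_\Gamma(R)=[\Gamma:\Gamma(R)]$. Let $OC(\Gamma)$ be the set of all $R\in\mathrm O(4)$ with $\Sigma_\Gamma(R)<\infty$ (coincidence isometries), and let $SOC(\Gamma)$ be the set of those with $\det R=1$ (coincidence rotations). The lattices $\Gamma(R)$ with $R\in OC(\Gamma)$ are the coincidence site lattices (CSLs) of $\Gamma$. Let $P(\Gamma)=\{Q\in\mathrm O(4): Q\Gamma=\Gamma\}$. The symmetry class of a rotation $R$ with respect to $\Gamma$ is the set of all rotations $RQ$ with $Q\in P(\Gamma)$. Let $f^{rot}_\Gamma(n)$ be the number of symmetry classes of coincidence rotations of index $n$, let $f_\Gamma(n)$ be the number of different CSLs of index $n$ in $\Gamma$, and let $\Phi^{rot}_\Gamma(s)=\sum_{n\ge1}f^{rot}_\Gamma(n)n^{-s}$ and $\Phi_\Gamma(s)=\sum_{n\ge1}f_\Gamma(n)n^{-s}$. Let $D_4^*$ be the $\mathbb Z$-span of $(1,0,0,0),(0,1,0,0),(0,0,1,0),\tfrac12(1,1,1,1)$,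 and let $\mathbb Z^4$ be the primitive hypercubic lattice. Then the following hold. 1. $\mathbb Z^4\subset D_4^*$ with index $2$. One has $P(\mathbb Z^4)\subset P(D_4^*)$ with index $3$, and these point groups contain exactly $192$ and $576$ rotations, respectively. Moreover, $OC(\mathbb Z^4)=OC(D_4^*)$. 2. For each $R\in SOC(D_4^*)$, the index $\Sigma_{D_4^*}(R)$ is odd, and the symmetry class of $R$ with respect to $D_4^*$ is the disjoint union of exactly three symmetry classes with respect to $\mathbb Z^4$. On one of these three classes, $\Sigma_{\mathbb Z^4}$ is constantly $\Sigma_{D_4^*}(R)$; on each of the other two, it is constantly $2\Sigma_{D_4^*}(R)$. 3. For each CSL $\Lambda$ of $D_4^*$, the index $m=[D_4^*:\Lambda]$ is odd, and the set of the CSLs $\mathbb Z^4\cap R\mathbb Z^4$, where $R$ runs through all coincidence isometries with $D_4^*\cap RD_4^*=\Lambda$, consists of exactly two lattices, one of index $m$ and one of index $2m$ in $\mathbb Z^4$. Conversely, coincidence isometries with the same CSL of $\mathbb Z^4$ have the same CSL of $D_4^*$. 4. For each $n$, the number of coincidence rotations of index $n$ is finite, and it is $192f^{rot}_{\mathbb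 Z^4}(n)$ for $\mathbb Z^4$ and $576f^{rot}_{D_4^*}(n)$ for $D_4^*$. The function $f^{rot}_{\mathbb Z^4}$ is multiplicative. The Dirichlet series $\Phi^{rot}_{\mathbb Z^4}$ and $\Phi^{rot}_{D_4^*}$ converge absolutely for $\operatorname{Re}s>3$, and there $$\Phi^{rot}_{\mathbb Z^4}(s)=(1+2^{1-s})\,\Phi^{rot}_{D_4^*}(s)=(1+2^{1-s})\prod_{p\ne2}\frac{(1+p^{-s})(1+p^{1-s})}{(1-p^{1-s})(1-p^{2-s})},$$ where the product is over all odd primes. The values $f^{rot}_{\mathbb Z^4}(1),\dots,f^{rot}_{\mathbb Z^4}(17)$ are $1,2,16,0,36,32,64,0,168,72,144,0,196,128,576,0,324$. 5. For each $n$, the lattices $\mathbb Z^4$ and $D_4^*$ have only finitely many CSLs of index $n$. The Dirichlet series $\Phi_{\mathbb Z^4}$ and $\Phi_{D_4^*}$ converge absolutely for $\operatorname{Re}s>3$, and there $$\Phi_{\mathbb Z^4}(s)=(1+2^{-s})\,\Phi_{D_4^*}(s)=(1+2^{-s})\prod_{p\neq2}\frac{1+p^{-s}+2p^{1-s}+2p^{-2s}+p^{1-2s}+p^{1-3s}}{(1-p^{2-s})(1-p^{1-2s})}.$$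 The values $f_{\mathbb Z^4}(1),\dots,f_{\mathbb Z^4}(17)$ are $1,1,16,0,36,16,64,0,152,36,144,0,196,64,576,0,324$. 6. The coincidence spectrum $\{\Sigma_{\mathbb Z^4}(R):R\in OC(\mathbb Z^4)\}$ equals $\{2^\ell m:\ell\in\{0,1\},\ m\in\mathbb N\text{ odd}\}$. -/

import Mathlib

namespace CoincidenceLattice

section General

variable {V : Type*} [NormedAddCommGroup V] [InnerProductSpace ℝ V]

/-- The image `RΓ` of an additive subgroup `Γ` under a linear isometry `R`. -/
def image (R : V ≃ₗᵢ[ℝ] V) (Γ : AddSubgroup V) : AddSubgroup V :=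
  Γ.map (R.toLinearEquiv : V →ₗ[ℝ] V).toAddMonoidHom

theorem mem_image {R : V ≃ₗᵢ[ℝ] V} {Γ : AddSubgroup V} {x : V} :
    x ∈ image R Γ ↔ ∃ y ∈ Γ, R y = x := Iff.rfl

theorem image_one (Γ : AddSubgroup V) : image 1 Γ = Γ := by
  ext x; simp [mem_image]

theorem image_mul (R S : V ≃ₗᵢ[ℝ] V) (Γ : AddSubgroup V) :
    image (R * S) Γ = image R (image S Γ) := by
  ext x; simp [mem_image]

/-- A proper rotation: a linear isometry of determinant one. -/
def IsRotation (R : V ≃ₗᵢ[ℝ] V) : Prop :=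
  LinearMap.det (R.toLinearEquiv : V →ₗ[ℝ] V) = 1

/-- The point group `P(Γ)` of `Γ`: all linear isometries `Q` with `QΓ = Γ`. -/
def pointGroup (Γ : AddSubgroup V) : Subgroup (V ≃ₗᵢ[ℝ] V) where
  carrier := {Q | image Q Γ = Γ}
  one_mem' := image_one Γ
  mul_mem' {a b} ha hb := by
    change image a Γ = Γ at ha
    change image b Γ = Γ at hb
    change image (a * b) Γ = Γ
    rw [image_mul, hb, ha]
  inv_mem' {a} ha := by
    change image a Γ = Γ at ha
    change image a⁻¹ Γ = Γ
    conv_lhs => rw [← ha]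
    rw [← image_mul, inv_mul_cancel, image_one]

/-- The intersection `Γ(R) = Γ ∩ RΓ`. -/
def csl (Γ : AddSubgroup V) (R : V ≃ₗᵢ[ℝ] V) : AddSubgroup V :=
  Γ ⊓ image R Γ

/-- The coincidence index `Σ(R) = [Γ : Γ(R)]`, with value `0` if the index is infinite. -/
noncomputable def coincIndex (Γ : AddSubgroup V) (R : V ≃ₗᵢ[ℝ] V) : ℕ :=
  (csl Γ R).relIndex Γ

/-- `OC(Γ)`: the coincidence isometries, for which `Γ(R)` has finite index in `Γ`. -/
def OC (Γ : AddSubgroup V) : Set (V ≃ₗᵢ[ℝ] V) :=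
  {R | coincIndex Γ R ≠ 0}

/-- `SOC(Γ)`: the coincidence rotations of `Γ`. -/
def SOC (Γ : AddSubgroup V) : Set (V ≃ₗᵢ[ℝ] V) :=
  {R | R ∈ OC Γ ∧ IsRotation R}

/-- The rotations that are symmetry related to `R`: the rotations `RQ` with `Q ∈ P(Γ)`. -/
def symClass (Γ : AddSubgroup V) (R : V ≃ₗᵢ[ℝ] V) : Set (V ≃ₗᵢ[ℝ] V) :=
  {R' | IsRotation R' ∧ ∃ Q ∈ pointGroup Γ, R' = R * Q}

/-- The coincidence spectrum of `Γ`. -/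
def coincSpectrum (Γ : AddSubgroup V) : Set ℕ :=
  {n | ∃ R ∈ OC Γ, coincIndex Γ R = n}

/-- The coincidence rotations of index `n`. -/
def rotationsOfIndex (Γ : AddSubgroup V) (n : ℕ) : Set (V ≃ₗᵢ[ℝ] V) :=
  {R | R ∈ SOC Γ ∧ coincIndex Γ R = n}

/-- The number `f^rot(n)` of classes of symmetry related coincidence rotations of index `n`. -/
noncomputable def fRot (Γ : AddSubgroup V) (n : ℕ) : ℕ :=
  {C | ∃ R ∈ rotationsOfIndex Γ n, C = symClass Γ R}.ncard

/-- The coincidence site lattices of `Γ` (arising from arbitrary coincidence isometries). -/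
def CSLs (Γ : AddSubgroup V) : Set (AddSubgroup V) :=
  {Λ | ∃ R ∈ OC Γ, Λ = csl Γ R}

/-- The coincidence site lattices of `Γ` of index `n`. -/
def CSLsOfIndex (Γ : AddSubgroup V) (n : ℕ) : Set (AddSubgroup V) :=
  {Λ | Λ ∈ CSLs Γ ∧ Λ.relIndex Γ = n}

/-- The number `f(n)` of different coincidence site lattices of `Γ` of index `n`. -/
noncomputable def fCSL (Γ : AddSubgroup V) (n : ℕ) : ℕ :=
  (CSLsOfIndex Γ n).ncard

end General

/-- Euclidean four-space. -/
abbrev E4 : Type := EuclideanSpace ℝ (Fin 4)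

/-- The primitive hypercubic lattice `ℤ⁴`. -/
def Z4 : AddSubgroup E4 where
  carrier := {x | ∀ i, ∃ n : ℤ, x i = n}
  zero_mem' := fun _ => ⟨0, by simp⟩
  add_mem' {x y} hx hy i := by
    obtain ⟨m, hm⟩ := hx i
    obtain ⟨n, hn⟩ := hy i
    exact ⟨m + n, by simp [hm, hn]⟩
  neg_mem' {x} hx i := by
    obtain ⟨m, hm⟩ := hx i
    exact ⟨-m, by simp [hm]⟩

/-- The centred hypercubic lattice `D₄*`, i.e. the Hurwitz quaternions
`a + bi + cj + dk` as coordinate vectors `(a, b, c, d)`. -/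
noncomputable def D4s : AddSubgroup E4 :=
  AddSubgroup.closure
    {!₂[1, 0, 0, 0], !₂[0, 1, 0, 0], !₂[0, 0, 1, 0], !₂[1 / 2, 1 / 2, 1 / 2, 1 / 2]}

/-- The Dirichlet series `∑_{n ≥ 1} f(n) n^{-s}`. -/
noncomputable def dirichlet (f : ℕ → ℕ) (s : ℂ) : ℂ :=
  LSeries (fun n => (f n : ℂ)) s

/-- The odd primes. -/
abbrev OddPrime : Type := {p : ℕ // p.Prime ∧ p ≠ 2}

/-- The Euler factor for coincidence rotations. -/
noncomputable def rotFactor (s : ℂ) (p : OddPrime) : ℂ :=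
  ((1 + (p : ℂ) ^ (-s)) * (1 + (p : ℂ) ^ (1 - s))) /
    ((1 - (p : ℂ) ^ (1 - s)) * (1 - (p : ℂ) ^ (2 - s)))

/-- The Euler factor for coincidence site lattices. -/
noncomputable def cslFactor (s : ℂ) (p : OddPrime) : ℂ :=
  (1 + (p : ℂ) ^ (-s) + 2 * (p : ℂ) ^ (1 - s) + 2 * (p : ℂ) ^ (-2 * s)
      + (p : ℂ) ^ (1 - 2 * s) + (p : ℂ) ^ (1 - 3 * s)) /
    ((1 - (p : ℂ) ^ (2 - s)) * (1 - (p : ℂ) ^ (1 - 2 * s)))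

end CoincidenceLattice

open scoped Quaternion Matrix

namespace CoincidenceLattice

/-! Under ℝ⁴ = ℍ the lattice D₄* becomes the Hurwitz order H, a Euclidean ring, and coincidence
isometries become arithmetic in H. If R is one, then R⁻¹ carries H into the rational quaternions. A
norm preserving map of this kind is z ↦ q z r / c or z ↦ q z̄ r / c with q, r primitive in H and
|q|²|r|² = c² (`exists_prm_pair`). Hence RH = q H r̄ / c for suitable q, r of this sort. The prime 1
+ i normalises H and cancels from both sides (`exists_odd_pair`), so that all norms may be taken
odd.

Modulo an odd n the order is the matrix ring M₂(ℤ/n) (`exists_splitting`), and a primitive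
quaternion becomes a matrix with Smith normal form diag(1, norm). Write the norms of q and r as g x²
and g y² with x, y coprime and c = g x y. Then H ∩ q H r̄ / c consists of the z with c ∣ q̄ z r, and
diagonalising q̄ and r gives the index g x² y² (`index_cslSub`). In particular every index for D₄*
is odd.

The largest right H-module inside q H r̄ / c is a multiple of q H; therefore the image RH remembers
the right ideals qH and rH (`lat_eq_iff`). The CSL remembers less: only the primitive right ideals
of norms g x and g y that contain qH and rH (`cslSub_eq_reduced`, `cslSub_eq_iff`), and all such
ideals occur (`exists_primIdeal_lift`). Primitive right ideals of odd norm n are the points of the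
projective line over ℤ/n; let ψ(n) be their number. Both counting functions for D₄* are thus sums of
ψ(g xᵉ) ψ(g yᵉ) over the triples with g x² y² = n, where e = 2 for symmetry classes and e = 1 for
CSLs (`ncard_latsOfIndex`, `ncard_cslsOfIndex`). These sums are multiplicative and obey a linear
recursion along prime powers, which yields the Euler factors (`tsum_cnt_prime_pow`). An elementary
bound of order n^(2 + δ) gives convergence for Re s > 3 (`exists_cnt_le`).

For ℤ⁴, note that the vectors of even norm in D₄* form a sublattice whose quotient is Klein's
four-group, and ℤ⁴ is one of the three lattices strictly in between. Isometries preserve norms and a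
CSL Λ of D₄* has odd index, so R permutes these three lattices as far as Λ sees them
(`exists_perm`). Composing R with three rotations from P(D₄*) that move ℤ⁴ to each of them gives the
three classes. One has the CSL Λ ∩ ℤ⁴, of the same index as Λ; the other two share the even part of
Λ, of doubled index (`exists_perm_csl`). Two classes but only one lattice of doubled index: this is
the difference between the factors 1 + 2^(1 - s) and 1 + 2^(-s). -/

/-! ### The Hurwitz order, its conjugation and its norm -/

/-- The quaternion with coordinates `(m, b, c, d)` in the basis `(1+i+j+k)/2, i, j, k`. -/
noncomputable def hurwitzMk (m b c d : ℤ) : ℍ[ℝ] :=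
  ⟨m / 2, m / 2 + b, m / 2 + c, m / 2 + d⟩

@[simp] theorem hurwitzMk_re (m b c d : ℤ) : (hurwitzMk m b c d).re = m / 2 := rfl

@[simp] theorem hurwitzMk_imI (m b c d : ℤ) : (hurwitzMk m b c d).imI = m / 2 + b := rfl

@[simp] theorem hurwitzMk_imJ (m b c d : ℤ) : (hurwitzMk m b c d).imJ = m / 2 + c := rfl

@[simp] theorem hurwitzMk_imK (m b c d : ℤ) : (hurwitzMk m b c d).imK = m / 2 + d := rfl

/-- The ring of Hurwitz quaternions. -/
noncomputable def Hurwitz : Subring ℍ[ℝ] where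
  carrier := {x | ∃ m b c d : ℤ, x = hurwitzMk m b c d}
  zero_mem' := ⟨0, 0, 0, 0, by ext <;> simp⟩
  one_mem' := ⟨2, -1, -1, -1, by ext <;> simp⟩
  add_mem' := by
    rintro _ _ ⟨m, b, c, d, rfl⟩ ⟨m', b', c', d', rfl⟩
    refine ⟨m + m', b + b', c + c', d + d', ?_⟩
    ext <;> simp <;> ring
  neg_mem' := by
    rintro _ ⟨m, b, c, d, rfl⟩
    refine ⟨-m, -b, -c, -d, ?_⟩
    ext <;> simp <;> ring
  mul_mem' := by
    rintro _ _ ⟨m, b, c, d, rfl⟩ ⟨m', b', c', d', rfl⟩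
    refine ⟨-(m * m') - m * (b' + c' + d') - m' * (b + c + d) - 2 * (b * b' + c * c' + d * d'),
      m * m' + m * b' + b * m' + m * d' + m' * c + c * d' - d * c' + b * b' + c * c' + d * d',
      m * m' + m * c' + c * m' + m * b' + m' * d + d * b' - b * d' + b * b' + c * c' + d * d',
      m * m' + m * d' + d * m' + m * c' + m' * b + b * c' - c * b' + b * b' + c * c' + d * d', ?_⟩
    ext <;> simp <;> ring

/-- The Hurwitz quaternions as a type. -/
abbrev Hw : Type := Hurwitz

theorem star_mem_hurwitz {x : ℍ[ℝ]} (hx : x ∈ Hurwitz) : star x ∈ Hurwitz := by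
  obtain ⟨m, b, c, d, rfl⟩ := hx
  refine ⟨m, -m - b, -m - c, -m - d, ?_⟩
  ext <;> simp <;> ring

/-- Quaternionic conjugation on Hurwitz quaternions. -/
noncomputable def conj (x : Hw) : Hw := ⟨star x.1, star_mem_hurwitz x.2⟩

@[simp] theorem coe_conj (x : Hw) : (conj x : ℍ[ℝ]) = star (x : ℍ[ℝ]) := rfl

@[simp] theorem conj_conj (x : Hw) : conj (conj x) = x := Subtype.ext (by simp)

@[simp] theorem conj_mul (x y : Hw) : conj (x * y) = conj y * conj x := Subtype.ext (by simp)

@[simp] theorem conj_natCast (n : ℕ) : conj (n : Hw) = n := Subtype.ext (by simp)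

theorem exists_nat_normSq (x : Hw) : ∃ n : ℕ, Quaternion.normSq (x : ℍ[ℝ]) = n := by
  obtain ⟨x, m, b, c, d, rfl⟩ := x
  have h : Quaternion.normSq (hurwitzMk m b c d) =
      ((m * m + m * (b + c + d) + b * b + c * c + d * d : ℤ) : ℝ) := by
    rw [Quaternion.normSq_def']; simp; ring
  have h0 : (0 : ℝ) ≤ ((m * m + m * (b + c + d) + b * b + c * c + d * d : ℤ) : ℝ) :=
    h ▸ Quaternion.normSq_nonneg
  obtain ⟨n, hn⟩ := Int.eq_ofNat_of_zero_le (Int.cast_nonneg_iff.1 h0)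
  exact ⟨n, by simp only [h, hn]; simp⟩

/-- The reduced norm of a Hurwitz quaternion. -/
noncomputable def nrm (x : Hw) : ℕ := (exists_nat_normSq x).choose

theorem coe_nrm (x : Hw) : (nrm x : ℝ) = Quaternion.normSq (x : ℍ[ℝ]) :=
  (exists_nat_normSq x).choose_spec.symm

theorem nrm_eq_iff {x : Hw} {n : ℕ} : nrm x = n ↔ Quaternion.normSq (x : ℍ[ℝ]) = n := by
  rw [← coe_nrm, Nat.cast_inj]

@[simp] theorem nrm_mul (x y : Hw) : nrm (x * y) = nrm x * nrm y := by
  rw [nrm_eq_iff]; simp [coe_nrm]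

@[simp] theorem nrm_conj (x : Hw) : nrm (conj x) = nrm x := by
  rw [nrm_eq_iff]; simp [coe_nrm]

@[simp] theorem nrm_one : nrm 1 = 1 := by rw [nrm_eq_iff]; simp

@[simp] theorem nrm_natCast (n : ℕ) : nrm (n : Hw) = n ^ 2 := by
  rw [nrm_eq_iff]
  simpa using Quaternion.normSq_natCast (R := ℝ) n

@[simp] theorem nrm_eq_zero {x : Hw} : nrm x = 0 ↔ x = 0 := by
  rw [nrm_eq_iff]; simp

theorem mul_conj (x : Hw) : x * conj x = nrm x := by
  apply Subtype.ext
  have := Quaternion.self_mul_star (x : ℍ[ℝ])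
  rw [← coe_nrm, Quaternion.coe_natCast] at this
  simpa using this

theorem conj_mul_self (x : Hw) : conj x * x = nrm x := by
  simpa using mul_conj (conj x)

theorem natCast_comm (n : ℕ) (x : Hw) : (n : Hw) * x = x * n := (Nat.cast_commute n x).eq

theorem natCast_ne_zero {n : ℕ} (hn : n ≠ 0) : (n : Hw) ≠ 0 := by
  intro h
  have := nrm_natCast n
  rw [h, nrm_eq_zero.2 rfl] at this
  exact hn (pow_eq_zero_iff (two_ne_zero) |>.1 this.symm)

theorem natCast_mul_cancel {n : ℕ} (hn : n ≠ 0) {x y : Hw} (h : (n : Hw) * x = n * y) : x = y :=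
  mul_left_cancel₀ (natCast_ne_zero hn) h

theorem natCast_dvd_mul_left {n : ℕ} {x : Hw} (h : (n : Hw) ∣ x) (y : Hw) : (n : Hw) ∣ y * x := by
  obtain ⟨z, rfl⟩ := h
  exact ⟨y * z, by rw [← mul_assoc, ← natCast_comm, mul_assoc]⟩

theorem natCast_dvd_conj {n : ℕ} {x : Hw} : (n : Hw) ∣ conj x ↔ (n : Hw) ∣ x := by
  have key : ∀ x : Hw, (n : Hw) ∣ x → (n : Hw) ∣ conj x := by
    rintro _ ⟨z, rfl⟩
    exact ⟨conj z, by simp [natCast_comm]⟩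
  exact ⟨fun h => by simpa using key _ h, key x⟩

theorem natCast_mul_dvd_mul_iff {n m : ℕ} (hn : n ≠ 0) {x : Hw} :
    ((n * m : ℕ) : Hw) ∣ n * x ↔ (m : Hw) ∣ x := by
  constructor
  · rintro ⟨z, hz⟩
    exact ⟨z, natCast_mul_cancel hn (by rw [hz]; push_cast; rw [mul_assoc])⟩
  · rintro ⟨z, rfl⟩
    exact ⟨z, by push_cast; rw [mul_assoc]⟩

/-- Bézout: integers are central in H, so a relation um + vn = 1 can be multiplied into x. -/
theorem natCast_dvd_of_dvd_mul {m n : ℕ} (h : m.Coprime n) {x : Hw} (hd : (m : Hw) ∣ n * x) :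
    (m : Hw) ∣ x := by
  obtain ⟨z, hz⟩ := hd
  have h1 : ((m.gcdA n : ℤ) : Hw) * m + ((m.gcdB n : ℤ) : Hw) * n = 1 := by
    have := Nat.gcd_eq_gcd_ab m n
    rw [h] at this
    have h2 := congrArg (Int.cast : ℤ → Hw) this
    push_cast at h2
    rw [h2]
    rw [(Int.cast_commute (m.gcdA n) (m : Hw)).eq, (Int.cast_commute (m.gcdB n) (n : Hw)).eq]
  have hx : x = (((m.gcdA n : ℤ) : Hw) * m + ((m.gcdB n : ℤ) : Hw) * n) * x := by rw [h1, one_mul]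
  rw [hx, add_mul, mul_assoc _ (n : Hw), hz]
  exact dvd_add (natCast_comm m _ ▸ mul_assoc (m : Hw) _ _ ▸ dvd_mul_right _ _)
    (natCast_dvd_mul_left (dvd_mul_right _ _) _)

theorem natCast_dvd_natCast {m n : ℕ} : (m : Hw) ∣ (n : Hw) ↔ m ∣ n := by
  constructor
  · rintro ⟨z, hz⟩
    have := congrArg nrm hz
    simp only [nrm_natCast, nrm_mul] at this
    exact (Nat.pow_dvd_pow_iff two_ne_zero).1 ⟨_, this⟩
  · rintro ⟨k, rfl⟩
    exact ⟨k, by push_cast; rfl⟩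

/-! ### Euclidean division and principal right ideals -/

/-- Every real quaternion has distance less than one from some Hurwitz quaternion. -/
theorem exists_normSq_sub_lt_one (x : ℍ[ℝ]) : ∃ z : Hw, Quaternion.normSq (x - (z : ℍ[ℝ])) < 1 := by
  -- Rounding in the basis (1+i+j+k)/2, i, j, k leaves an error of at most 1/4 in the real part and
  -- 1/2 in the others: squared distance at most 1/16 + 3/4 < 1.
  let m := round (2 * x.re)
  let b := round (x.imI - m / 2)
  let c := round (x.imJ - m / 2)
  let d := round (x.imK - m / 2)
  refine ⟨⟨hurwitzMk m b c d, m, b, c, d, rfl⟩, ?_⟩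
  have hm := abs_le.1 (abs_sub_round (2 * x.re))
  have hb := abs_le.1 (abs_sub_round (x.imI - m / 2))
  have hc := abs_le.1 (abs_sub_round (x.imJ - m / 2))
  have hd := abs_le.1 (abs_sub_round (x.imK - m / 2))
  simp only [Quaternion.normSq_def', hurwitzMk_re, hurwitzMk_imI, hurwitzMk_imJ, hurwitzMk_imK, Quaternion.re_sub, Quaternion.imI_sub,
    Quaternion.imJ_sub, Quaternion.imK_sub]
  have h1 : (x.re - m / 2) ^ 2 ≤ (1 / 4) ^ 2 := sq_le_sq' (by linarith) (by linarith)
  have h2 : (x.imI - (m / 2 + b)) ^ 2 ≤ (1 / 2) ^ 2 := sq_le_sq' (by linarith) (by linarith)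
  have h3 : (x.imJ - (m / 2 + c)) ^ 2 ≤ (1 / 2) ^ 2 := sq_le_sq' (by linarith) (by linarith)
  have h4 : (x.imK - (m / 2 + d)) ^ 2 ≤ (1 / 2) ^ 2 := sq_le_sq' (by linarith) (by linarith)
  linarith

theorem exists_nrm_sub_mul_lt (a : Hw) {b : Hw} (hb : b ≠ 0) : ∃ q, nrm (a - b * q) < nrm b := by
  obtain ⟨q, hq⟩ := exists_normSq_sub_lt_one ((b : ℍ[ℝ])⁻¹ * a)
  refine ⟨q, ?_⟩
  have hb' : (b : ℍ[ℝ]) ≠ 0 := fun h => hb (Subtype.ext h)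
  have : ((a - b * q : Hw) : ℍ[ℝ]) = b * ((b : ℍ[ℝ])⁻¹ * a - q) := by
    rw [mul_sub, ← mul_assoc, mul_inv_cancel₀ hb', one_mul]; rfl
  rw [← Nat.cast_lt (α := ℝ), coe_nrm, coe_nrm, this, map_mul]
  have hpos : 0 < Quaternion.normSq (b : ℍ[ℝ]) :=
    lt_of_le_of_ne Quaternion.normSq_nonneg (Ne.symm (by simpa using hb))
  nlinarith

/-- Every right ideal of the ring of Hurwitz quaternions is principal. -/
theorem exists_generator (I : AddSubgroup Hw) (hI : ∀ x ∈ I, ∀ y, x * y ∈ I) :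
    ∃ q, ∀ x, x ∈ I ↔ ∃ y, x = q * y := by
  classical
  by_cases h0 : ∃ x ∈ I, x ≠ 0
  · have hex : ∃ n, ∃ x ∈ I, x ≠ 0 ∧ nrm x = n := by
      obtain ⟨x, hx, hx0⟩ := h0
      exact ⟨_, x, hx, hx0, rfl⟩
    obtain ⟨q, hqI, hq0, hqn⟩ := Nat.find_spec hex
    refine ⟨q, fun x => ⟨fun hx => ?_, ?_⟩⟩
    · obtain ⟨y, hy⟩ := exists_nrm_sub_mul_lt x hq0
      refine ⟨y, ?_⟩
      by_contra hne
      have hmem : x - q * y ∈ I := I.sub_mem hx (hI q hqI y)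
      exact Nat.find_min hex (hqn ▸ hy) ⟨_, hmem, sub_ne_zero.2 hne, rfl⟩
    · rintro ⟨y, rfl⟩
      exact hI q hqI y
  · push Not at h0
    refine ⟨0, fun x => ⟨fun hx => ⟨0, by simp [h0 x hx]⟩, ?_⟩⟩
    rintro ⟨y, rfl⟩
    simp

/-! ### Primitive quaternions and content -/

/-- A Hurwitz quaternion is primitive if it is not divisible by a natural number other than `1`. -/
def Prm (x : Hw) : Prop := ∀ m : ℕ, (m : Hw) ∣ x → m = 1

theorem Prm.conj {x : Hw} (hx : Prm x) : Prm (conj x) := fun m hm => hx m (natCast_dvd_conj.1 hm)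

theorem Prm.ne_zero {x : Hw} (hx : Prm x) : x ≠ 0 := by
  rintro rfl
  exact absurd (hx 0 (dvd_zero _)) (by norm_num)

theorem Prm.of_mul_left {x y : Hw} (hx : Prm (x * y)) : Prm x := fun m hm =>
  hx m (hm.mul_right y)

theorem exists_prm {x : Hw} (hx : x ≠ 0) : ∃ (m : ℕ) (y : Hw), m ≠ 0 ∧ Prm y ∧ x = m * y := by
  induction h : nrm x using Nat.strong_induction_on generalizing x with
  | _ n ih =>
    by_cases hp : Prm x
    · exact ⟨1, x, one_ne_zero, hp, by simp⟩
    · simp only [Prm, not_forall] at hp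
      obtain ⟨m, ⟨z, rfl⟩, hm⟩ := hp
      have hm0 : m ≠ 0 := by rintro rfl; simp at hx
      have hz : z ≠ 0 := by rintro rfl; simp at hx
      have hzn : 0 < nrm z := Nat.pos_of_ne_zero (by simpa using hz)
      have hlt : nrm z < n := by
        rw [← h, nrm_mul, nrm_natCast]
        have : 2 ≤ m := by omega
        nlinarith [Nat.mul_le_mul this this]
      obtain ⟨k, y, hk, hy, rfl⟩ := ih _ hlt hz rfl
      exact ⟨m * k, y, mul_ne_zero hm0 hk, hy, by push_cast; rw [mul_assoc]⟩

/-- After cancelling gcd(m, n), what is left of m is prime to what is left of n, hence divides the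
primitive y and equals 1. -/
theorem Prm.content_dvd {x y : Hw} (hy : Prm y) {m n : ℕ} (hm : m ≠ 0)
    (h : (m : Hw) * x = n * y) : m ∣ n := by
  have hg : 0 < m.gcd n := Nat.gcd_pos_of_pos_left _ (Nat.pos_of_ne_zero hm)
  obtain ⟨m', hm'⟩ := Nat.gcd_dvd_left m n
  obtain ⟨n', hn'⟩ := Nat.gcd_dvd_right m n
  have hcop : m'.Coprime n' := by
    have := Nat.coprime_div_gcd_div_gcd hg
    rwa [Nat.div_eq_of_eq_mul_right hg hm', Nat.div_eq_of_eq_mul_right hg hn'] at this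
  have h' : (m' : Hw) * x = n' * y := by
    apply natCast_mul_cancel hg.ne'
    rw [← mul_assoc, ← mul_assoc, ← Nat.cast_mul, ← Nat.cast_mul, ← hm', ← hn', h]
  have := hy m' (natCast_dvd_of_dvd_mul hcop ⟨x, h'.symm⟩)
  rw [hm', this, mul_one]
  exact Nat.gcd_dvd_right m n

theorem Prm.content_eq {x y : Hw} (hx : Prm x) (hy : Prm y) {m n : ℕ} (hm : m ≠ 0) (hn : n ≠ 0)
    (h : (m : Hw) * x = n * y) : m = n ∧ x = y := by
  have : m = n := Nat.dvd_antisymm (hy.content_dvd hm h) (hx.content_dvd hn h.symm)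
  subst this
  exact ⟨rfl, natCast_mul_cancel hm h⟩

theorem Prm.mul_unit {x u : Hw} (hx : Prm x) (hu : nrm u = 1) : Prm (x * u) := fun m hm => by
  apply hx
  have h2 := hm.mul_right (CoincidenceLattice.conj u)
  rwa [mul_assoc, CoincidenceLattice.mul_conj, hu, Nat.cast_one, mul_one] at h2

/-! ### Splitting of the order modulo odd numbers -/

/-- Hensel lifting in s with t fixed. Coprimality of 2s to p says that the derivative does not
vanish, and is carried through the induction. -/
theorem exists_int_sq_add_sq_add_one (p : ℕ) [hp : Fact p.Prime] (hp2 : p ≠ 2) (k : ℕ) :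
    ∃ s t : ℤ, IsCoprime (2 * s) (p : ℤ) ∧ (p : ℤ) ^ (k + 1) ∣ s ^ 2 + t ^ 2 + 1 := by
  have hpp : Prime (p : ℤ) := Nat.prime_iff_prime_int.1 hp.out
  induction k with
  | zero =>
    obtain ⟨a, b, hab⟩ := ZMod.sq_add_sq p (-1)
    -- The residues a and b cannot both vanish, as their squares add up to -1; the nonzero one takes
    -- the role of s.
    have key : ∀ a b : ZMod p, a ^ 2 + b ^ 2 = -1 → a ≠ 0 →
        ∃ s t : ℤ, IsCoprime (2 * s) (p : ℤ) ∧ (p : ℤ) ^ (0 + 1) ∣ s ^ 2 + t ^ 2 + 1 := by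
      intro a b hab ha
      obtain ⟨s, rfl⟩ := ZMod.intCast_surjective a
      obtain ⟨t, rfl⟩ := ZMod.intCast_surjective b
      refine ⟨s, t, ?_, ?_⟩
      · refine ((Int.isCoprime_iff_gcd_eq_one).2 ?_ : IsCoprime (2 : ℤ) p).mul_left ?_
        · exact (Nat.coprime_primes Nat.prime_two hp.out).2 hp2.symm
        · refine ((hpp.coprime_iff_not_dvd).2 fun h => ha ?_).symm
          exact (ZMod.intCast_zmod_eq_zero_iff_dvd s p).2 h
      · rw [zero_add, pow_one, ← ZMod.intCast_zmod_eq_zero_iff_dvd]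
        push_cast
        rw [hab]; ring
    by_cases ha : a = 0
    · refine key b a (by rw [add_comm, hab]) fun hb => ?_
      subst ha; subst hb
      simp at hab
    · exact key a b hab ha
  | succ k ih =>
    obtain ⟨s, t, hs, m, hm⟩ := ih
    obtain ⟨a, b, hab⟩ := id hs
    -- Newton step: a inverts 2s modulo p, so that the term of order p^(k+1) cancels modulo p^(k+2).
    refine ⟨s - p ^ (k + 1) * (m * a), t, ?_, ?_⟩
    · have : 2 * (s - (p : ℤ) ^ (k + 1) * (m * a)) = 2 * s + (p : ℤ) * (-2 * p ^ k * (m * a)) := by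
        ring
      rw [this]
      exact hs.add_mul_left_left _
    · refine ⟨m * b + p ^ k * (m * a) ^ 2, ?_⟩
      have hb : (b * p : ℤ) = 1 - a * (2 * s) := by linarith
      have : (s - (p : ℤ) ^ (k + 1) * (m * a)) ^ 2 + t ^ 2 + 1 = (s ^ 2 + t ^ 2 + 1)
          - p ^ (k + 1) * m * (a * (2 * s)) + (p ^ (k + 1)) ^ 2 * (m * a) ^ 2 := by ring
      rw [this, hm]
      linear_combination (-(p : ℤ) ^ (k + 1) * m) * hb

theorem exists_sq_add_sq_eq_neg_one {n : ℕ} (hn : Odd n) : ∃ s t : ZMod n, s ^ 2 + t ^ 2 = -1 := by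
  induction n using Nat.recOnPosPrimePosCoprime with
  | prime_pow p k hp hk =>
    have := Fact.mk hp
    have hp2 : p ≠ 2 := by
      rintro rfl
      exact absurd (hn.of_dvd_nat (dvd_pow_self 2 hk.ne')) (by decide)
    obtain ⟨s, t, -, h⟩ := exists_int_sq_add_sq_add_one p hp2 (k - 1)
    refine ⟨s, t, ?_⟩
    rw [Nat.sub_add_cancel hk, ← Nat.cast_pow, ← ZMod.intCast_zmod_eq_zero_iff_dvd] at h
    push_cast at h
    linear_combination h
  | zero => exact absurd hn (by decide)
  | one => exact ⟨0, 0, Subsingleton.elim _ _⟩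
  | coprime a b ha hb hab iha ihb =>
    obtain ⟨s, t, h⟩ := iha (hn.of_dvd_nat (dvd_mul_right _ _))
    obtain ⟨s', t', h'⟩ := ihb (hn.of_dvd_nat (dvd_mul_left _ _))
    let e := ZMod.chineseRemainder hab
    refine ⟨e.symm (s, s'), e.symm (t, t'), e.injective ?_⟩
    simp [h, h', ← Prod.mk_one_one]

/-- The basis of `M₂(ℤ/n)` defining the homomorphism from the Lipschitz quaternions. -/
def splittingBasis {n : ℕ} {s t : ZMod n} (h : s ^ 2 + t ^ 2 = -1) :
    QuaternionAlgebra.Basis (Matrix (Fin 2) (Fin 2) (ZMod n)) (-1 : ℤ) 0 (-1) where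
  i := !![0, -1; 1, 0]
  j := !![s, t; t, -s]
  k := !![-t, s; s, t]
  i_mul_i := by ext a b; fin_cases a <;> fin_cases b <;> simp [Matrix.mul_apply, Fin.sum_univ_two]
  j_mul_j := by
    ext a b
    fin_cases a <;> fin_cases b <;> simp [Matrix.mul_apply, Fin.sum_univ_two] <;>
      first | ring1 | linear_combination h
  i_mul_j := by ext a b; fin_cases a <;> fin_cases b <;> simp [Matrix.mul_apply, Fin.sum_univ_two]
  j_mul_i := by ext a b; fin_cases a <;> fin_cases b <;> simp [Matrix.mul_apply, Fin.sum_univ_two]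

/-- A splitting of the Hurwitz order modulo `n`. -/
structure Splitting (n : ℕ) where
  /-- The reduction homomorphism. -/
  toHom : Hw →+* Matrix (Fin 2) (Fin 2) (ZMod n)
  surj : Function.Surjective toHom
  ker : ∀ z, toHom z = 0 ↔ (n : Hw) ∣ z
  det : ∀ z, (toHom z).det = nrm z

/-- Twice a Hurwitz quaternion, as an integral quaternion. -/
noncomputable def dbl (x : Hw) : QuaternionAlgebra ℤ (-1) 0 (-1) :=
  ⟨⌊2 * x.1.re⌋, ⌊2 * x.1.imI⌋, ⌊2 * x.1.imJ⌋, ⌊2 * x.1.imK⌋⟩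

theorem dbl_hurwitzMk (m b c d : ℤ) :
    dbl ⟨hurwitzMk m b c d, m, b, c, d, rfl⟩ = ⟨m, m + 2 * b, m + 2 * c, m + 2 * d⟩ := by
  have h : ∀ b : ℤ, ⌊(2 : ℝ) * (m / 2 + b)⌋ = m + 2 * b := by
    intro b
    rw [show (2 : ℝ) * (m / 2 + b) = ((m + 2 * b : ℤ) : ℝ) by push_cast; ring, Int.floor_intCast]
  have h0 : ⌊(2 : ℝ) * (m / 2)⌋ = m := by simpa using h 0
  simp only [dbl, hurwitzMk_re, hurwitzMk_imI, hurwitzMk_imJ, hurwitzMk_imK, h, h0]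

theorem cast_dbl (x : Hw) : ((dbl x).re : ℝ) = 2 * x.1.re ∧ ((dbl x).imI : ℝ) = 2 * x.1.imI ∧
    ((dbl x).imJ : ℝ) = 2 * x.1.imJ ∧ ((dbl x).imK : ℝ) = 2 * x.1.imK := by
  obtain ⟨x, m, b, c, d, rfl⟩ := x
  rw [dbl_hurwitzMk]
  simp
  refine ⟨?_, ?_, ?_, ?_⟩ <;> ring

theorem dbl_add (x y : Hw) : dbl (x + y) = dbl x + dbl y := by
  obtain ⟨h1, h2, h3, h4⟩ := cast_dbl x
  obtain ⟨h1', h2', h3', h4'⟩ := cast_dbl y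
  obtain ⟨k1, k2, k3, k4⟩ := cast_dbl (x + y)
  ext <;> apply Int.cast_injective (α := ℝ) <;> simp [*] <;> ring

theorem dbl_one : dbl 1 = 1 + 1 := by
  obtain ⟨k1, k2, k3, k4⟩ := cast_dbl 1
  ext <;> apply Int.cast_injective (α := ℝ) <;> simp [*]

theorem dbl_mul (x y : Hw) : dbl (x * y) + dbl (x * y) = dbl x * dbl y := by
  obtain ⟨h1, h2, h3, h4⟩ := cast_dbl x
  obtain ⟨h1', h2', h3', h4'⟩ := cast_dbl y
  obtain ⟨k1, k2, k3, k4⟩ := cast_dbl (x * y)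
  ext <;> apply Int.cast_injective (α := ℝ) <;> simp [*] <;> ring

theorem lift_splittingBasis {n : ℕ} {s t : ZMod n} (h : s ^ 2 + t ^ 2 = -1) (z : QuaternionAlgebra ℤ (-1) 0 (-1)) :
    (splittingBasis h).lift z = !![z.re + z.imJ * s - z.imK * t, -z.imI + z.imJ * t + z.imK * s;
      z.imI + z.imJ * t + z.imK * s, z.re - z.imJ * s + z.imK * t] := by
  ext a b
  fin_cases a <;> fin_cases b <;>
    simp [QuaternionAlgebra.Basis.lift, splittingBasis, ← Matrix.diagonal_intCast] <;> ring

/-- The homomorphism of a splitting built from a solution of `s² + t² = -1`. -/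
noncomputable def splittingHom {n : ℕ} {s t h : ZMod n} (hst : s ^ 2 + t ^ 2 = -1)
    (hh : 2 * h = 1) : Hw →+* Matrix (Fin 2) (Fin 2) (ZMod n) :=
  -- The matrix basis serves integral quaternions only; so x goes to h = 1/2 times the image of 2x.
  RingHom.mk' ⟨⟨fun x => h • (splittingBasis hst).lift (dbl x), by
    rw [dbl_one, QuaternionAlgebra.Basis.lift_add,
      QuaternionAlgebra.Basis.lift_one, smul_add, ← add_smul, ← two_mul, hh, one_smul]⟩, by
    intro x y
    have h2 := congrArg (splittingBasis hst).lift (dbl_mul x y)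
    rw [QuaternionAlgebra.Basis.lift_add, ← two_smul (ZMod n),
      QuaternionAlgebra.Basis.lift_mul] at h2
    simp only [smul_mul_assoc, mul_smul_comm]
    rw [← h2, smul_smul h 2, mul_comm h, hh, one_smul]⟩ fun x y => by
    simp [dbl_add, QuaternionAlgebra.Basis.lift_add]

theorem splittingHom_apply {n : ℕ} {s t h : ZMod n} (hst : s ^ 2 + t ^ 2 = -1)
    (hh : 2 * h = 1) (x : Hw) :
    splittingHom hst hh x = h • (splittingBasis hst).lift (dbl x) := rfl

/-- Sums and differences of the matrix entries recover the coordinates: the linear system for the j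
and k parts has determinant s² + t² = -1. -/
theorem splittingHom_ker {n : ℕ} {s t h : ZMod n} (hst : s ^ 2 + t ^ 2 = -1)
    (hh : 2 * h = 1) (z : Hw) : splittingHom hst hh z = 0 ↔ (n : Hw) ∣ z := by
  constructor
  · intro h0
    obtain ⟨_, m, b, c, d, rfl⟩ := z
    rw [splittingHom_apply, lift_splittingBasis, dbl_hurwitzMk] at h0
    have e := fun i j => congrFun (congrFun h0 i) j
    have e00 := e 0 0
    have e01 := e 0 1
    have e10 := e 1 0
    have e11 := e 1 1
    simp at e00 e01 e10 e11
    have div2 : ∀ k : ℤ, (2 * k : ZMod n) = 0 → (n : ℤ) ∣ k := by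
      intro k hk
      rw [← ZMod.intCast_zmod_eq_zero_iff_dvd]
      linear_combination h * hk - k * hh
    have hm : (m : ZMod n) = 0 := by linear_combination e00 + e11 - m * hh
    have hb : (2 * b : ZMod n) = 0 := by
      linear_combination e10 - e01 - (m + 2 * b) * hh - hm
    have hP : (m + 2 * c : ZMod n) * s - (m + 2 * d) * t = 0 := by
      linear_combination e00 - e11 - ((m + 2 * c : ZMod n) * s - (m + 2 * d) * t) * hh
    have hQ : (m + 2 * c : ZMod n) * t + (m + 2 * d) * s = 0 := by
      linear_combination e01 + e10 - ((m + 2 * c : ZMod n) * t + (m + 2 * d) * s) * hh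
    have hc : (2 * c : ZMod n) = 0 := by
      linear_combination -s * hP - t * hQ + (m + 2 * c) * hst - hm
    have hd : (2 * d : ZMod n) = 0 := by
      linear_combination t * hP - s * hQ + (m + 2 * d) * hst - hm
    obtain ⟨m', rfl⟩ := (ZMod.intCast_zmod_eq_zero_iff_dvd m n).1 hm
    obtain ⟨b', rfl⟩ := div2 b hb
    obtain ⟨c', rfl⟩ := div2 c hc
    obtain ⟨d', rfl⟩ := div2 d hd
    refine ⟨⟨hurwitzMk m' b' c' d', m', b', c', d', rfl⟩, Subtype.ext ?_⟩
    have hcast : (((n : Hw) * ⟨hurwitzMk m' b' c' d', m', b', c', d', rfl⟩ : Hw) : ℍ[ℝ]) =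
        (n : ℝ) • hurwitzMk m' b' c' d' := by
      rw [← Quaternion.coe_mul_eq_smul, Quaternion.coe_natCast]; simp
    rw [hcast]
    ext <;> simp <;> ring
  · rintro ⟨y, rfl⟩
    rw [map_mul, map_natCast]
    have : ((n : ℕ) : Matrix (Fin 2) (Fin 2) (ZMod n)) = 0 := by
      ext i j
      simp
    rw [this, zero_mul]

theorem splittingHom_surjective {n : ℕ} {s t h : ZMod n} (hst : s ^ 2 + t ^ 2 = -1)
    (hh : 2 * h = 1) : Function.Surjective (splittingHom hst hh) := by
  intro M
  -- A, B, C, D lift the coordinates in 1, i, j, k that solve the linear system given by the entries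
  -- of M.
  obtain ⟨A, hA⟩ := ZMod.intCast_surjective (h * (M 0 0 + M 1 1))
  obtain ⟨B, hB⟩ := ZMod.intCast_surjective (h * (M 1 0 - M 0 1))
  obtain ⟨C, hC⟩ := ZMod.intCast_surjective
    (-(s * (h * (M 0 0 - M 1 1)) + t * (h * (M 1 0 + M 0 1))))
  obtain ⟨D, hD⟩ := ZMod.intCast_surjective
    (t * (h * (M 0 0 - M 1 1)) - s * (h * (M 1 0 + M 0 1)))
  refine ⟨⟨hurwitzMk (2 * A) (B - A) (C - A) (D - A), _, _, _, _, rfl⟩, ?_⟩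
  rw [splittingHom_apply, lift_splittingBasis, dbl_hurwitzMk]
  ext i j
  fin_cases i <;> fin_cases j <;> simp [hA, hB, hC, hD]
  · linear_combination (2 * h * h * (M 1 1 - M 0 0)) * hst +
      (h * (2 * M 0 0) + M 0 0) * hh
  · linear_combination (-2 * h * h * (M 1 0 + M 0 1)) * hst +
      (h * (2 * M 0 1) + M 0 1) * hh
  · linear_combination (-2 * h * h * (M 1 0 + M 0 1)) * hst +
      (h * (2 * M 1 0) + M 1 0) * hh
  · linear_combination (2 * h * h * (M 0 0 - M 1 1)) * hst +
      (h * (2 * M 1 1) + M 1 1) * hh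

theorem splittingHom_det {n : ℕ} {s t h : ZMod n} (hst : s ^ 2 + t ^ 2 = -1)
    (hh : 2 * h = 1) (z : Hw) : (splittingHom hst hh z).det = nrm z := by
  obtain ⟨k1, k2, k3, k4⟩ := cast_dbl z
  have h4 : (4 * nrm z : ℤ) =
      (dbl z).re ^ 2 + (dbl z).imI ^ 2 + (dbl z).imJ ^ 2 + (dbl z).imK ^ 2 := by
    apply Int.cast_injective (α := ℝ)
    push_cast
    rw [k1, k2, k3, k4, coe_nrm, Quaternion.normSq_def']
    ring
  have h5 := congrArg (Int.cast : ℤ → ZMod n) h4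
  push_cast at h5
  rw [splittingHom_apply, lift_splittingBasis, Matrix.det_fin_two]
  simp
  linear_combination (-h ^ 2 * ((dbl z).imJ ^ 2 + (dbl z).imK ^ 2)) * hst - h ^ 2 * h5 +
    (2 * h + 1) * (nrm z) * hh

theorem exists_splitting {n : ℕ} (hn : Odd n) : Nonempty (Splitting n) := by
  obtain ⟨s, t, hst⟩ := exists_sq_add_sq_eq_neg_one hn
  obtain ⟨k, hk⟩ := hn
  -- Since n = 2k + 1, the inverse of two is -k.
  have hh : (2 : ZMod n) * (-k) = 1 := by
    have := congrArg (Nat.cast : ℕ → ZMod n) hk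
    rw [ZMod.natCast_self] at this
    push_cast at this
    linear_combination this
  exact ⟨⟨splittingHom hst hh, splittingHom_surjective hst hh,
    splittingHom_ker hst hh, splittingHom_det hst hh⟩⟩

/-- Reduction of a splitting to a divisor of the modulus. -/
noncomputable def Splitting.reduce {n d : ℕ} (φ : Splitting n) (hd : d ∣ n) : Splitting d where
  toHom := (ZMod.castHom hd (ZMod d)).mapMatrix.comp φ.toHom
  surj := by
    rw [RingHom.coe_comp]
    refine Function.Surjective.comp (fun M : Matrix (Fin 2) (Fin 2) (ZMod d) => ?_) φ.surj
    choose f hf using ZMod.ringHom_surjective (ZMod.castHom hd (ZMod d))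
    refine ⟨M.map f, ?_⟩
    ext i j
    simpa using hf (M i j)
  ker z := by
    constructor
    · intro h
      have h1 : ∀ i j, ∃ y : ZMod n, φ.toHom z i j = (d : ZMod n) * y := by
        intro i j
        have h2 := congrFun (congrFun h i) j
        simp only [RingHom.comp_apply, RingHom.mapMatrix_apply, Matrix.map_apply,
          Matrix.zero_apply] at h2
        obtain ⟨k, hk⟩ := ZMod.intCast_surjective (φ.toHom z i j)
        rw [← hk, map_intCast, ZMod.intCast_zmod_eq_zero_iff_dvd] at h2
        obtain ⟨l, rfl⟩ := h2
        exact ⟨l, by rw [← hk]; push_cast; rfl⟩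
      choose Y hY using h1
      obtain ⟨y, hy⟩ := φ.surj (Matrix.of Y)
      have h3 : φ.toHom (z - d * y) = 0 := by
        rw [map_sub, map_mul, map_natCast, hy, ← nsmul_eq_mul]
        ext i j
        simp [hY]
      have h4 := ((natCast_dvd_natCast.2 hd).trans ((φ.ker _).1 h3)).add (dvd_mul_right (d : Hw) y)
      rwa [sub_add_cancel] at h4
    · rintro ⟨y, rfl⟩
      rw [map_mul, map_natCast]
      have : ((d : ℕ) : Matrix (Fin 2) (Fin 2) (ZMod d)) = 0 := by
        ext i j
        simp
      rw [this, zero_mul]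
  det z := by
    rw [RingHom.comp_apply, ← RingHom.map_det, φ.det, map_natCast]

/-- The nonunits are the residues divisible by p, and these are closed under addition. -/
theorem isLocalRing_zmod_prime_pow {p k : ℕ} (hp : p.Prime) (hk : 0 < k) :
    IsLocalRing (ZMod (p ^ k)) := by
  have := Fact.mk hp
  have : Nontrivial (ZMod (p ^ k)) :=
    ZMod.nontrivial_iff.2 (Nat.one_lt_pow hk.ne' hp.one_lt).ne'
  apply IsLocalRing.of_nonunits_add
  intro x y hx hy
  have key : ∀ x : ZMod (p ^ k), x ∈ nonunits (ZMod (p ^ k)) ↔ p ∣ x.val := by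
    intro x
    rw [mem_nonunits_iff, ← ZMod.natCast_zmod_val x, ZMod.isUnit_iff_coprime,
      Nat.coprime_pow_right_iff hk, Nat.coprime_comm, hp.coprime_iff_not_dvd, not_not,
      ZMod.natCast_zmod_val]
  rw [key] at hx hy ⊢
  rw [ZMod.val_add]
  exact (Nat.dvd_mod_iff (dvd_pow_self p hk.ne')).2 (dvd_add hx hy)

/-! ### Unimodular bilinear forms and Smith normal form -/

/-- A unimodular bilinear form in two plus two variables over `ℤ/n` represents one. -/
theorem exists_bilinear_eq_one {n : ℕ} (hn : n ≠ 0) (a b c d : ZMod n)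
    (h : ∃ α β γ δ, α * a + β * b + γ * c + δ * d = 1) :
    ∃ r r' s s', r * (a * s + b * s') + r' * (c * s + d * s') = 1 := by
  induction n using Nat.recOnPosPrimePosCoprime with
  | prime_pow p k hp hk =>
    obtain ⟨α, β, γ, δ, h⟩ := h
    have := isLocalRing_zmod_prime_pow hp hk
    -- In a local ring a sum equal to 1 has a unit among its summands. Repeating this finds a unit
    -- among a, b, c, d, and scaled coordinate vectors then suffice.
    rcases IsLocalRing.isUnit_or_isUnit_of_add_one h with h1 | h1
    · have h2 : ∃ α β γ, IsUnit (α * a + β * b + γ * c) := ⟨_, _, _, h1⟩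
      obtain ⟨u, hu⟩ := h1.exists_left_inv
      have h3 : (u * α) * a + (u * β) * b + (u * γ) * c = 1 := by rw [← hu]; ring
      rcases IsLocalRing.isUnit_or_isUnit_of_add_one h3 with h4 | h4
      · obtain ⟨u', hu'⟩ := h4.exists_left_inv
        have h5 : (u' * (u * α)) * a + (u' * (u * β)) * b = 1 := by rw [← hu']; ring
        rcases IsLocalRing.isUnit_or_isUnit_of_add_one h5 with h6 | h6
        · obtain ⟨v, hv⟩ := h6.exists_left_inv
          exact ⟨v * (u' * (u * α)), 0, 1, 0, by linear_combination hv⟩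
        · obtain ⟨v, hv⟩ := h6.exists_left_inv
          exact ⟨v * (u' * (u * β)), 0, 0, 1, by linear_combination hv⟩
      · obtain ⟨v, hv⟩ := h4.exists_left_inv
        exact ⟨0, v * (u * γ), 1, 0, by linear_combination hv⟩
    · obtain ⟨v, hv⟩ := h1.exists_left_inv
      exact ⟨0, v * δ, 0, 1, by linear_combination hv⟩
  | zero => exact absurd rfl hn
  | one => exact ⟨0, 0, 0, 0, Subsingleton.elim _ _⟩
  | coprime m k hm hk hmk ihm ihk =>
    obtain ⟨α, β, γ, δ, h⟩ := h
    let e := ZMod.chineseRemainder hmk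
    have he := congrArg e h
    simp only [map_add, map_mul, map_one] at he
    obtain ⟨r, r', s, s', h1⟩ := ihm (by omega) (e a).1 (e b).1 (e c).1 (e d).1
      ⟨(e α).1, (e β).1, (e γ).1, (e δ).1, by simpa using congrArg Prod.fst he⟩
    obtain ⟨t, t', v, v', h2⟩ := ihk (by omega) (e a).2 (e b).2 (e c).2 (e d).2
      ⟨(e α).2, (e β).2, (e γ).2, (e δ).2, by simpa using congrArg Prod.snd he⟩
    refine ⟨e.symm (r, t), e.symm (r', t'), e.symm (s, v), e.symm (s', v'), e.injective ?_⟩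
    simp only [map_add, map_mul, map_one, RingEquiv.apply_symm_apply]
    exact Prod.ext h1 h2

/-- If g generates the ideal of the four entries together with n, then (n/g)z is divisible by n, so
g divides z. Primitivity forces g = 1, which means that the entries are unimodular modulo n. -/
theorem Splitting.exists_eq_one {n : ℕ} (φ : Splitting n) (hn : n ≠ 0) {z : Hw} (hz : Prm z) :
    ∃ r r' s s', r * (φ.toHom z 0 0 * s + φ.toHom z 0 1 * s') +
      r' * (φ.toHom z 1 0 * s + φ.toHom z 1 1 * s') = 1 := by
  apply exists_bilinear_eq_one hn
  obtain ⟨a, ha⟩ := ZMod.intCast_surjective (φ.toHom z 0 0)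
  obtain ⟨b, hb⟩ := ZMod.intCast_surjective (φ.toHom z 0 1)
  obtain ⟨c, hc⟩ := ZMod.intCast_surjective (φ.toHom z 1 0)
  obtain ⟨d, hd⟩ := ZMod.intCast_surjective (φ.toHom z 1 1)
  let J : Ideal ℤ := Ideal.span {a, b, c, d, (n : ℤ)}
  have hmem : ∀ x ∈ ({a, b, c, d, (n : ℤ)} : Set ℤ),
      Submodule.IsPrincipal.generator J ∣ x := fun x hx =>
    (Submodule.IsPrincipal.mem_iff_generator_dvd J).1 (Ideal.subset_span hx)
  obtain ⟨g, hg⟩ : ∃ g : ℕ, Submodule.IsPrincipal.generator J = g ∨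
      Submodule.IsPrincipal.generator J = -g := Int.eq_nat_or_neg _
  have hdvd : ∀ x ∈ ({a, b, c, d, (n : ℤ)} : Set ℤ), (g : ℤ) ∣ x := by
    intro x hx
    rcases hg with hg | hg
    · exact hg ▸ hmem x hx
    · exact neg_dvd.1 (hg ▸ hmem x hx)
  obtain ⟨k, hk⟩ : g ∣ n := Int.natCast_dvd_natCast.1 (hdvd _ (by simp))
  have hk0 : k ≠ 0 := by rintro rfl; exact hn (by simpa using hk)
  have hzero : ∀ x : ℤ, (g : ℤ) ∣ x → (k : ZMod n) * (x : ZMod n) = 0 := by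
    rintro _ ⟨y, rfl⟩
    have : (k : ZMod n) * g = 0 := by rw [← Nat.cast_mul, mul_comm, ← hk, ZMod.natCast_self]
    push_cast
    rw [← mul_assoc, this, zero_mul]
  have hker : φ.toHom (k * z) = 0 := by
    rw [map_mul, map_natCast, ← nsmul_eq_mul]
    ext i j
    fin_cases i <;> fin_cases j <;> simp
    · rw [← ha]; exact hzero a (hdvd _ (by simp))
    · rw [← hb]; exact hzero b (hdvd _ (by simp))
    · rw [← hc]; exact hzero c (hdvd _ (by simp))
    · rw [← hd]; exact hzero d (hdvd _ (by simp))
  rw [φ.ker, hk, mul_comm, natCast_mul_dvd_mul_iff hk0] at hker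
  have hg1 := hz g hker
  have h1 : (1 : ℤ) ∈ J := by
    rw [Submodule.IsPrincipal.mem_iff_generator_dvd]
    rcases hg with hg | hg <;> rw [hg, hg1] <;> simp
  simp only [J, Ideal.mem_span_insert, Ideal.mem_span_singleton'] at h1
  obtain ⟨α, _, ⟨β, _, ⟨γ, _, ⟨δ, _, ⟨ε, rfl⟩, rfl⟩, rfl⟩, rfl⟩, h1⟩ := h1
  refine ⟨α, β, γ, δ, ?_⟩
  rw [← ha, ← hb, ← hc, ← hd]
  have := congrArg (Int.cast : ℤ → ZMod n) h1
  push_cast at this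
  rw [ZMod.natCast_self] at this
  linear_combination -this

/-- Smith normal form of a unimodular two by two matrix. -/
theorem exists_smith {R : Type*} [CommRing R] (M : Matrix (Fin 2) (Fin 2) R)
    (h : ∃ r r' s s', r * (M 0 0 * s + M 0 1 * s') + r' * (M 1 0 * s + M 1 1 * s') = 1) :
    ∃ U V : Matrix (Fin 2) (Fin 2) R, U.det = 1 ∧ V.det = 1 ∧
      U * M * V = !![1, 0; 0, M.det] := by
  obtain ⟨a, b, c, d, rfl⟩ : ∃ a b c d, M = !![a, b; c, d] := ⟨_, _, _, _, Matrix.eta_fin_two M⟩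
  obtain ⟨r, r', s, s', h⟩ := h
  simp at h
  -- The second row of U annihilates M(s, s'), and the second column of V is annihilated by (r,
  -- r')M. The relation `h` is at once the upper left entry of UMV and both determinants.
  refine ⟨!![r, r'; -(c * s + d * s'), a * s + b * s'],
    !![s, -(r * b + r' * d); s', r * a + r' * c], ?_, ?_, ?_⟩
  · rw [Matrix.det_fin_two_of]; linear_combination h
  · rw [Matrix.det_fin_two_of]; linear_combination h
  · rw [Matrix.mul_fin_two, Matrix.mul_fin_two, Matrix.det_fin_two_of]
    ext i j
    fin_cases i <;> fin_cases j <;> simp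
    · linear_combination h
    · ring
    · ring
    · linear_combination (a * d - b * c) * h

theorem diag_mul_mul_diag {R : Type*} [CommRing R] (a b : R) (X : Matrix (Fin 2) (Fin 2) R) :
    !![1, 0; 0, a] * X * !![1, 0; 0, b] = !![X 0 0, X 0 1 * b; a * X 1 0, a * X 1 1 * b] := by
  rw [Matrix.eta_fin_two X, Matrix.mul_fin_two, Matrix.mul_fin_two]
  simp

/-! ### The index of a coincidence site lattice -/

/-- The Hurwitz quaternions `z` for which `c` divides `q̄ z r`. -/
noncomputable def cslSub (c : ℕ) (q r : Hw) : AddSubgroup Hw where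
  carrier := {z | (c : Hw) ∣ conj q * z * r}
  zero_mem' := by simp
  add_mem' {a b} ha hb := by
    change (c : Hw) ∣ conj q * (a + b) * r
    rw [mul_add, add_mul]
    exact dvd_add ha hb
  neg_mem' {a} ha := by
    change (c : Hw) ∣ conj q * (-a) * r
    rw [mul_neg, neg_mul]
    exact (dvd_neg).2 ha

theorem mem_cslSub {c : ℕ} {q r z : Hw} : z ∈ cslSub c q r ↔ (c : Hw) ∣ conj q * z * r := Iff.rfl

theorem card_zmultiples_natCast {c : ℕ} (hc : c ≠ 0) (a : ℕ) :
    Nat.card (AddSubgroup.zmultiples (a : ZMod c)) = c / c.gcd a := by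
  rw [Nat.card_zmultiples, ZMod.addOrderOf_coe a hc]

/-- Modulo c = gxy, Smith normal form turns q̄ z r into diag(1, |q|²) X diag(1, |r|²), where X runs
through all matrices as z varies. The lower right entry vanishes because |q|²|r|² = c². The other
three range over ℤ/c and the ideals of ℤ/c generated by |r|² and |q|², which have c, x and y
elements since gcd(c, |r|²) = gy and gcd(c, |q|²) = gx. The quotient therefore has cxy elements. -/
theorem index_cslSub {g x y : ℕ} (hxy : x.Coprime y) (hodd : Odd (g * x * y)) {q r : Hw}
    (hq : Prm q) (hr : Prm r) (hqn : nrm q = g * x ^ 2) (hrn : nrm r = g * y ^ 2) :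
    (cslSub (g * x * y) q r).index = g * x ^ 2 * y ^ 2 := by
  obtain ⟨c, hcdef⟩ : ∃ c, c = g * x * y := ⟨_, rfl⟩
  rw [← hcdef] at hodd ⊢
  obtain ⟨φ⟩ := exists_splitting hodd
  have hc : c ≠ 0 := by rintro h; rw [h] at hodd; exact absurd hodd (by decide)
  obtain ⟨U, V, hU, hV, hM⟩ := exists_smith _ (φ.exists_eq_one hc hq.conj)
  obtain ⟨U', V', hU', hV', hM'⟩ := exists_smith _ (φ.exists_eq_one hc hr)
  rw [φ.det, nrm_conj] at hM
  rw [φ.det] at hM'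
  have inv : ∀ W : Matrix (Fin 2) (Fin 2) (ZMod c), W.det = 1 → W * W⁻¹ = 1 ∧ W⁻¹ * W = 1 :=
    fun W hW => ⟨Matrix.mul_nonsing_inv W (hW ▸ isUnit_one),
      Matrix.nonsing_inv_mul W (hW ▸ isUnit_one)⟩
  have hab : ((nrm q : ℕ) : ZMod c) * ((nrm r : ℕ) : ZMod c) = 0 := by
    rw [← Nat.cast_mul, hqn, hrn, ZMod.natCast_eq_zero_iff]
    exact ⟨c, by rw [hcdef]; ring⟩
  let T : Hw → Matrix (Fin 2) (Fin 2) (ZMod c) := fun z =>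
    U * φ.toHom (conj q * z * r) * V'
  have hT : ∀ z, T z = !![1, 0; 0, (nrm q : ZMod c)] * (V⁻¹ * φ.toHom z * U'⁻¹) *
      !![1, 0; 0, (nrm r : ZMod c)] := by
    intro z
    rw [← hM, ← hM']
    simp only [T, map_mul]
    calc _ = U * φ.toHom (conj q) * (V * V⁻¹) * φ.toHom z * (U'⁻¹ * U') * φ.toHom r * V' := by
          rw [(inv V hV).1, (inv U' hU').2]
          simp only [mul_one, mul_assoc]
      _ = _ := by simp only [mul_assoc]
  let f : Hw →+ ZMod c × ZMod c × ZMod c :=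
    { toFun := fun z => (T z 0 0, T z 0 1, T z 1 0)
      map_zero' := by simp [T]
      map_add' := fun z w => by
        simp [T, mul_add, add_mul] }
  have hker : f.ker = cslSub c q r := by
    ext z
    rw [AddMonoidHom.mem_ker, mem_cslSub, ← φ.ker]
    have h1 : φ.toHom (conj q * z * r) = 0 ↔ T z = 0 := by
      constructor
      · intro h; simp only [T, h, mul_zero, zero_mul]
      · intro h
        have : φ.toHom (conj q * z * r) = U⁻¹ * T z * V'⁻¹ := by
          simp only [T]
          calc _ = (U⁻¹ * U) * φ.toHom (conj q * z * r) * (V' * V'⁻¹) := by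
                rw [(inv U hU).2, (inv V' hV').1, one_mul, mul_one]
            _ = _ := by simp only [mul_assoc]
        rw [this, h]; simp
    rw [h1]
    have h11 : T z 1 1 = 0 := by
      rw [hT, diag_mul_mul_diag]
      simp only [Matrix.of_apply, Matrix.cons_val_one, Matrix.cons_val_fin_one]
      linear_combination (V⁻¹ * φ.toHom z * U'⁻¹) 1 1 * hab
    constructor
    · intro h
      have h' : (T z 0 0, T z 0 1, T z 1 0) = ((0 : ZMod c), (0 : ZMod c), (0 : ZMod c)) := h
      simp only [Prod.mk.injEq] at h'
      ext i j
      fin_cases i <;> fin_cases j <;> simp [h', h11]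
    · intro h
      change (T z 0 0, T z 0 1, T z 1 0) = 0
      simp [h]
  have hrange : f.range = (⊤ : AddSubgroup (ZMod c)).prod
      ((AddSubgroup.zmultiples ((nrm r : ℕ) : ZMod c)).prod
        (AddSubgroup.zmultiples ((nrm q : ℕ) : ZMod c))) := by
    ext ⟨α, β, γ⟩
    simp only [AddMonoidHom.mem_range, AddSubgroup.mem_prod, AddSubgroup.mem_top, true_and,
      AddSubgroup.mem_zmultiples_iff]
    constructor
    · rintro ⟨z, hz⟩
      have hz' : (T z 0 0, T z 0 1, T z 1 0) = (α, β, γ) := hz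
      simp only [Prod.mk.injEq, hT, diag_mul_mul_diag] at hz'
      obtain ⟨-, h01, h10⟩ := hz'
      set X := V⁻¹ * φ.toHom z * U'⁻¹
      obtain ⟨m, hm⟩ := ZMod.intCast_surjective (X 0 1)
      obtain ⟨m', hm'⟩ := ZMod.intCast_surjective (X 1 0)
      refine ⟨⟨m, ?_⟩, ⟨m', ?_⟩⟩
      · rw [← h01, zsmul_eq_mul, hm]; rfl
      · rw [← h10, zsmul_eq_mul, hm', mul_comm]; rfl
    · rintro ⟨⟨m, rfl⟩, ⟨m', rfl⟩⟩
      obtain ⟨z, hz⟩ := φ.surj (V * !![α, m; m', 0] * U')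
      refine ⟨z, ?_⟩
      change (T z 0 0, T z 0 1, T z 1 0) = _
      have : V⁻¹ * φ.toHom z * U'⁻¹ = !![α, m; m', 0] := by
        rw [hz]
        calc _ = (V⁻¹ * V) * !![α, m; m', 0] * (U' * U'⁻¹) := by simp only [mul_assoc]
          _ = _ := by rw [(inv V hV).2, (inv U' hU').1]; simp
      rw [hT, this, diag_mul_mul_diag]
      simp [mul_comm]
  have hx0 : 0 < x := Nat.pos_of_ne_zero (by rintro rfl; exact hc (by simpa using hcdef))
  have hy0 : 0 < y := Nat.pos_of_ne_zero (by rintro rfl; exact hc (by simpa using hcdef))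
  have hg0 : 0 < g := Nat.pos_of_ne_zero (by rintro rfl; exact hc (by simpa using hcdef))
  have e1 : c.gcd (nrm r) = g * y := by
    rw [hrn, hcdef, show g * x * y = g * y * x by ring,
      show g * y ^ 2 = g * y * y by ring, Nat.gcd_mul_left, hxy, mul_one]
  have e2 : c.gcd (nrm q) = g * x := by
    rw [hqn, hcdef, show g * x ^ 2 = g * x * x by ring, Nat.gcd_mul_left,
      Nat.gcd_comm, hxy, mul_one]
  have d1 : c / (g * y) = x := Nat.div_eq_of_eq_mul_right (by positivity) (by rw [hcdef]; ring)
  have d2 : c / (g * x) = y := Nat.div_eq_of_eq_mul_right (by positivity) (by rw [hcdef])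
  rw [← hker, AddSubgroup.index_ker, hrange,
    Nat.card_congr (AddSubgroup.prodEquiv _ _).toEquiv, Nat.card_prod,
    Nat.card_congr (AddSubgroup.prodEquiv _ _).toEquiv, Nat.card_prod,
    card_zmultiples_natCast hc, card_zmultiples_natCast hc, e1, e2, d1, d2,
    AddSubgroup.card_top, Nat.card_zmod, hcdef]
  ring

/-! ### Primitive right ideals and the projective line over ℤ/n -/

/-- The principal right ideal generated by a Hurwitz quaternion. -/
noncomputable def rightIdeal (q : Hw) : AddSubgroup Hw := (AddMonoidHom.mulLeft q).range

theorem mem_rightIdeal {q z : Hw} : z ∈ rightIdeal q ↔ ∃ y, q * y = z := Iff.rfl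

theorem self_mem_rightIdeal (q : Hw) : q ∈ rightIdeal q := ⟨1, mul_one q⟩

/-- Left multiplication by q̄ inverts that by q up to the norm. -/
theorem mem_rightIdeal_iff_dvd {q z : Hw} (hq : q ≠ 0) :
    z ∈ rightIdeal q ↔ (nrm q : Hw) ∣ conj q * z := by
  rw [mem_rightIdeal]
  constructor
  · rintro ⟨y, rfl⟩
    exact ⟨y, by rw [← mul_assoc, conj_mul_self]⟩
  · rintro ⟨y, hy⟩
    refine ⟨y, natCast_mul_cancel (n := nrm q) (by simpa using hq) ?_⟩
    calc (nrm q : Hw) * (q * y) = q * ((nrm q : Hw) * y) := by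
          rw [← mul_assoc, natCast_comm, mul_assoc]
      _ = (nrm q : Hw) * z := by rw [← hy, ← mul_assoc, mul_conj]

theorem rightIdeal_mul_unit {q u : Hw} (hu : nrm u = 1) : rightIdeal (q * u) = rightIdeal q := by
  ext z
  constructor
  · rintro ⟨y, rfl⟩
    exact ⟨u * y, (mul_assoc _ _ _).symm⟩
  · rintro ⟨y, rfl⟩
    refine ⟨conj u * y, ?_⟩
    change q * u * (conj u * y) = q * y
    rw [mul_assoc, ← mul_assoc u, mul_conj, hu, Nat.cast_one, one_mul]

theorem rightIdeal_eq_of_mem {q q' : Hw} (hq' : q' ≠ 0) (h : q' ∈ rightIdeal q)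
    (hn : nrm q = nrm q') : rightIdeal q = rightIdeal q' := by
  obtain ⟨u, rfl⟩ := h
  refine (rightIdeal_mul_unit ?_).symm
  change nrm q = nrm (q * u) at hn
  rw [nrm_mul] at hn
  have : nrm q ≠ 0 := fun h0 => hq' (nrm_eq_zero.1 (by
    change nrm (q * u) = 0
    rw [nrm_mul, h0, zero_mul]))
  exact (Nat.eq_of_mul_eq_mul_left (Nat.pos_of_ne_zero this) (by rw [mul_one, ← hn]))

/-- The primitive right ideals of norm `n`. -/
def primIdeals (n : ℕ) : Set (AddSubgroup Hw) :=
  {I | ∃ q, Prm q ∧ nrm q = n ∧ I = rightIdeal q}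

/-- The Hurwitz quaternions whose image under a splitting is annihilated by a row vector. -/
noncomputable def rowIdeal {n : ℕ} (φ : Splitting n) (a b : ZMod n) : AddSubgroup Hw where
  carrier := {z | a * φ.toHom z 0 0 + b * φ.toHom z 1 0 = 0 ∧
    a * φ.toHom z 0 1 + b * φ.toHom z 1 1 = 0}
  zero_mem' := by simp
  add_mem' {z w} hz hw := by
    refine ⟨?_, ?_⟩ <;> rw [map_add, Matrix.add_apply, Matrix.add_apply]
    · linear_combination hz.1 + hw.1
    · linear_combination hz.2 + hw.2
  neg_mem' {z} hz := by
    refine ⟨?_, ?_⟩ <;> rw [map_neg, Matrix.neg_apply, Matrix.neg_apply]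
    · linear_combination -hz.1
    · linear_combination -hz.2

theorem mem_rowIdeal {n : ℕ} {φ : Splitting n} {a b : ZMod n} {z : Hw} :
    z ∈ rowIdeal φ a b ↔ a * φ.toHom z 0 0 + b * φ.toHom z 1 0 = 0 ∧
      a * φ.toHom z 0 1 + b * φ.toHom z 1 1 = 0 := Iff.rfl

theorem rowIdeal_mul_mem {n : ℕ} {φ : Splitting n} {a b : ZMod n} {z : Hw}
    (hz : z ∈ rowIdeal φ a b) (y : Hw) : z * y ∈ rowIdeal φ a b := by
  rw [mem_rowIdeal] at *
  simp only [map_mul, Matrix.mul_apply, Fin.sum_univ_two]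
  constructor
  · linear_combination φ.toHom y 0 0 * hz.1 + φ.toHom y 1 0 * hz.2
  · linear_combination φ.toHom y 0 1 * hz.1 + φ.toHom y 1 1 * hz.2

theorem natCast_mem_rowIdeal {n : ℕ} (φ : Splitting n) (a b : ZMod n) :
    (n : Hw) ∈ rowIdeal φ a b := by
  have : φ.toHom n = 0 := (φ.ker _).2 dvd_rfl
  rw [mem_rowIdeal, this]
  simp

/-- The element with both columns orthogonal to the row. -/
theorem exists_mem_rowIdeal {n : ℕ} (φ : Splitting n) (a b : ZMod n) :
    ∃ z ∈ rowIdeal φ a b, φ.toHom z = !![-b, 0; a, 0] := by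
  obtain ⟨z, hz⟩ := φ.surj !![-b, 0; a, 0]
  refine ⟨z, ?_, hz⟩
  rw [mem_rowIdeal, hz]
  simp
  ring

/-- The test matrix with column (-b, a) forces a'b = b'a. Bézout coefficients then supply the
proportionality factor, a unit because the second pair is unimodular as well. -/
theorem rowIdeal_le_iff {n : ℕ} {φ : Splitting n} {a b a' b' : ZMod n} (h : IsCoprime a b)
    (h' : IsCoprime a' b') :
    rowIdeal φ a b ≤ rowIdeal φ a' b' ↔ ∃ u : (ZMod n)ˣ, a' = u * a ∧ b' = u * b := by
  constructor
  · intro hle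
    obtain ⟨z, hz, hz'⟩ := exists_mem_rowIdeal φ a b
    have h1 := (mem_rowIdeal.1 (hle hz)).1
    rw [hz'] at h1
    simp at h1
    obtain ⟨s, t, hst⟩ := h
    obtain ⟨s', t', hst'⟩ := h'
    have ha : a' = (s * a' + t * b') * a := by linear_combination (-a') * hst - t * h1
    have hb : b' = (s * a' + t * b') * b := by linear_combination (-b') * hst + s * h1
    have hu : IsUnit (s * a' + t * b') := by
      refine IsUnit.of_mul_eq_one (s' * a + t' * b) ?_
      linear_combination hst' - s' * ha - t' * hb
    exact ⟨hu.unit, ha, hb⟩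
  · rintro ⟨u, rfl, rfl⟩ z hz
    rw [mem_rowIdeal] at *
    constructor
    · linear_combination (u : ZMod n) * hz.1
    · linear_combination (u : ZMod n) * hz.2

theorem rowIdeal_eq_iff {n : ℕ} {φ : Splitting n} {a b a' b' : ZMod n} (h : IsCoprime a b)
    (h' : IsCoprime a' b') :
    rowIdeal φ a b = rowIdeal φ a' b' ↔ ∃ u : (ZMod n)ˣ, a' = u * a ∧ b' = u * b := by
  refine ⟨fun e => (rowIdeal_le_iff h h').1 e.le, fun hu => le_antisymm
    ((rowIdeal_le_iff h h').2 hu) ((rowIdeal_le_iff h' h).2 ?_)⟩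
  obtain ⟨u, rfl, rfl⟩ := hu
  exact ⟨u⁻¹, by simp, by simp⟩

/-- A matrix annihilated by a unimodular row has determinant zero. -/
theorem dvd_nrm_of_mem_rowIdeal {n : ℕ} {φ : Splitting n} {a b : ZMod n} (h : IsCoprime a b)
    {z : Hw} (hz : z ∈ rowIdeal φ a b) : n ∣ nrm z := by
  rw [← ZMod.natCast_eq_zero_iff, ← φ.det, Matrix.det_fin_two]
  obtain ⟨s, t, hst⟩ := h
  obtain ⟨h1, h2⟩ := mem_rowIdeal.1 hz
  linear_combination -(φ.toHom z 0 0 * φ.toHom z 1 1 - φ.toHom z 0 1 * φ.toHom z 1 0) * hst +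
    (s * φ.toHom z 1 1 - t * φ.toHom z 0 1) * h1 + (t * φ.toHom z 0 0 - s * φ.toHom z 1 0) * h2

/-- The ideal has a generator q; it contains n = qr, and |q|² = nm for some m. Then q̄ = mr, so m
divides q and n. A common divisor of q and n divides the test element with entries -b and a, hence
is invertible modulo n by unimodularity and equals 1. So |q|² = n. -/
theorem rowIdeal_mem_primIdeals {n : ℕ} (hn : n ≠ 0) (φ : Splitting n) {a b : ZMod n}
    (h : IsCoprime a b) : rowIdeal φ a b ∈ primIdeals n := by
  obtain ⟨q, hq⟩ := exists_generator (rowIdeal φ a b) fun x hx y => rowIdeal_mul_mem hx y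
  obtain ⟨z, hz, hz'⟩ := exists_mem_rowIdeal φ a b
  have hprim : ∀ m : ℕ, m ∣ n → (m : Hw) ∣ q → m = 1 := by
    rintro m ⟨k, rfl⟩ hm
    obtain ⟨y, rfl⟩ := (hq z).1 hz
    obtain ⟨w, hw⟩ : (m : Hw) ∣ q * y := hm.mul_right y
    rw [hw, map_mul, map_natCast, ← nsmul_eq_mul] at hz'
    have h0 := congrFun (congrFun hz' 0) 0
    have h1 := congrFun (congrFun hz' 1) 0
    simp at h0 h1
    obtain ⟨s, t, hst⟩ := h
    have hu : IsUnit ((m : ℕ) : ZMod (m * k)) := by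
      refine IsUnit.of_mul_eq_one (t * φ.toHom w 1 0 * 0 + (t * -φ.toHom w 0 0 +
        s * φ.toHom w 1 0)) ?_
      linear_combination hst - t * h0 + s * h1
    rw [ZMod.isUnit_iff_coprime] at hu
    exact Nat.Coprime.eq_one_of_dvd hu (dvd_mul_right m k)
  obtain ⟨r, hr⟩ := (hq n).1 (natCast_mem_rowIdeal φ a b)
  have hqmem : q ∈ rowIdeal φ a b := (hq q).2 ⟨1, (mul_one q).symm⟩
  obtain ⟨m, hm⟩ := dvd_nrm_of_mem_rowIdeal h hqmem
  have hq0 : q ≠ 0 := by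
    rintro rfl
    rw [zero_mul] at hr
    exact natCast_ne_zero hn hr
  have hm0 : m ≠ 0 := by
    rintro rfl
    exact hq0 (nrm_eq_zero.1 (by simpa using hm))
  have hcq : conj q = m * r := by
    have h1 : (n : Hw) * conj q = n * (m * r) := by
      calc (n : Hw) * conj q = conj q * n := natCast_comm _ _
        _ = conj q * (q * r) := by rw [hr]
        _ = (nrm q : Hw) * r := by rw [← mul_assoc, conj_mul_self]
        _ = _ := by rw [hm]; push_cast; rw [mul_assoc]
    exact natCast_mul_cancel hn h1
  have hmn : m ∣ n := by
    have h1 : nrm q = m ^ 2 * nrm r := by rw [← nrm_conj, hcq, nrm_mul, nrm_natCast]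
    refine ⟨nrm r, Nat.eq_of_mul_eq_mul_left (Nat.pos_of_ne_zero hm0) ?_⟩
    rw [← mul_assoc, ← sq, ← h1, hm, mul_comm]
  have hm1 : m = 1 := hprim m hmn (natCast_dvd_conj.1 ⟨r, hcq⟩)
  have hqn : nrm q = n := by rw [hm, hm1, mul_one]
  refine ⟨q, fun k hk => ?_, hqn, ?_⟩
  · refine hprim k ?_ hk
    obtain ⟨w, hw⟩ := hk
    have : n = k ^ 2 * nrm w := by rw [← hqn, hw, nrm_mul, nrm_natCast]
    exact ⟨k * nrm w, by rw [this]; ring⟩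
  · ext x
    rw [hq, mem_rightIdeal]
    exact ⟨fun ⟨y, hy⟩ => ⟨y, hy.symm⟩, fun ⟨y, hy⟩ => ⟨y, hy.symm⟩⟩

/-- The left annihilator modulo `d` of a primitive quaternion of norm divisible by `d`. -/
theorem exists_rowIdeal {d : ℕ} (hd : d ≠ 0) (φ : Splitting d) {q : Hw} (hq : Prm q)
    (hqd : d ∣ nrm q) : ∃ a b : ZMod d, IsCoprime a b ∧
      ∀ z, z ∈ rowIdeal φ a b ↔ (d : Hw) ∣ conj q * z := by
  obtain ⟨r, r', s, s', h⟩ := φ.exists_eq_one hd hq.conj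
  have hdet := φ.det (conj q)
  rw [nrm_conj, (ZMod.natCast_eq_zero_iff _ _).2 hqd, Matrix.det_fin_two] at hdet
  refine ⟨r * φ.toHom (conj q) 0 0 + r' * φ.toHom (conj q) 1 0,
    r * φ.toHom (conj q) 0 1 + r' * φ.toHom (conj q) 1 1, ⟨s, s', by linear_combination h⟩,
    fun z => ?_⟩
  rw [← φ.ker, map_mul, mem_rowIdeal]
  set M := φ.toHom (conj q)
  set Z := φ.toHom z
  -- Determinant zero and the bilinear relation make M the product of the column M(s, s') and the
  -- row (r, r')M. So M and this row annihilate the same elements.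
  have e00 : M 0 0 = (M 0 0 * s + M 0 1 * s') * (r * M 0 0 + r' * M 1 0) := by
    linear_combination (-M 0 0) * h + r' * s' * hdet
  have e01 : M 0 1 = (M 0 0 * s + M 0 1 * s') * (r * M 0 1 + r' * M 1 1) := by
    linear_combination (-M 0 1) * h - r' * s * hdet
  have e10 : M 1 0 = (M 1 0 * s + M 1 1 * s') * (r * M 0 0 + r' * M 1 0) := by
    linear_combination (-M 1 0) * h - r * s' * hdet
  have e11 : M 1 1 = (M 1 0 * s + M 1 1 * s') * (r * M 0 1 + r' * M 1 1) := by
    linear_combination (-M 1 1) * h + r * s * hdet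
  constructor
  · rintro ⟨h0, h1⟩
    ext i j
    fin_cases i <;> fin_cases j <;> simp [Matrix.mul_apply, Fin.sum_univ_two]
    · linear_combination Z 0 0 * e00 + Z 1 0 * e01 + (M 0 0 * s + M 0 1 * s') * h0
    · linear_combination Z 0 1 * e00 + Z 1 1 * e01 + (M 0 0 * s + M 0 1 * s') * h1
    · linear_combination Z 0 0 * e10 + Z 1 0 * e11 + (M 1 0 * s + M 1 1 * s') * h0
    · linear_combination Z 0 1 * e10 + Z 1 1 * e11 + (M 1 0 * s + M 1 1 * s') * h1
  · intro h0
    have h' := fun i j => congrFun (congrFun h0 i) j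
    simp only [Matrix.mul_apply, Fin.sum_univ_two, Matrix.zero_apply] at h'
    constructor
    · linear_combination r * h' 0 0 + r' * h' 1 0
    · linear_combination r * h' 0 1 + r' * h' 1 1

theorem exists_rowIdeal_eq {n : ℕ} (hn : n ≠ 0) (φ : Splitting n) {I : AddSubgroup Hw}
    (hI : I ∈ primIdeals n) : ∃ a b : ZMod n, IsCoprime a b ∧ I = rowIdeal φ a b := by
  obtain ⟨q, hq, rfl, rfl⟩ := hI
  obtain ⟨a, b, hab, h⟩ := exists_rowIdeal hn φ hq dvd_rfl
  refine ⟨a, b, hab, ?_⟩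
  ext z
  rw [h, mem_rightIdeal_iff_dvd hq.ne_zero]

/-- A primitive ideal of norm `n` reduces to a primitive ideal of norm `d` for `d ∣ n`. -/
theorem exists_primIdeal_of_dvd {d : ℕ} (hd : Odd d) {q : Hw} (hq : Prm q) (hqd : d ∣ nrm q) :
    ∃ q₁, Prm q₁ ∧ nrm q₁ = d ∧ ∀ z, (d : Hw) ∣ conj q * z ↔ z ∈ rightIdeal q₁ := by
  obtain ⟨φ⟩ := exists_splitting hd
  have hd0 : d ≠ 0 := by rintro rfl; exact absurd hd (by decide)
  obtain ⟨a, b, hab, h⟩ := exists_rowIdeal hd0 φ hq hqd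
  obtain ⟨q₁, h1, h2, h3⟩ := rowIdeal_mem_primIdeals hd0 φ hab
  exact ⟨q₁, h1, h2, fun z => by rw [← h3, h]⟩

/-- Every primitive ideal of norm `g x` is the reduction of one of norm `g x²`. -/
theorem exists_primIdeal_lift {g x : ℕ} (hodd : Odd (g * x)) {q₁ : Hw} (hq₁ : Prm q₁)
    (hn : nrm q₁ = g * x) : ∃ q, Prm q ∧ nrm q = g * x ^ 2 ∧
      ∀ z, ((g * x : ℕ) : Hw) ∣ conj q * z ↔ z ∈ rightIdeal q₁ := by
  have hodd' : Odd (g * x ^ 2) := by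
    rw [Nat.odd_mul] at hodd ⊢
    exact ⟨hodd.1, hodd.2.pow⟩
  obtain ⟨φ⟩ := exists_splitting hodd'
  have hd0 : g * x ≠ 0 := by intro h; rw [h] at hodd; exact absurd hodd (by decide)
  have hn0 : g * x ^ 2 ≠ 0 := by intro h; rw [h] at hodd'; exact absurd hodd' (by decide)
  have hdvd : g * x ∣ g * x ^ 2 := ⟨x, by ring⟩
  obtain ⟨a, b, hab, hI⟩ := exists_rowIdeal_eq hd0 (φ.reduce hdvd) ⟨q₁, hq₁, hn, rfl⟩
  obtain ⟨a, rfl⟩ := ZMod.intCast_surjective a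
  obtain ⟨b, rfl⟩ := ZMod.intCast_surjective b
  have hab' : IsCoprime (a : ZMod (g * x ^ 2)) (b : ZMod (g * x ^ 2)) := by
    obtain ⟨s, t, hst⟩ := hab
    obtain ⟨s, rfl⟩ := ZMod.intCast_surjective s
    obtain ⟨t, rfl⟩ := ZMod.intCast_surjective t
    obtain ⟨k, hk⟩ := (ZMod.intCast_zmod_eq_zero_iff_dvd (s * a + t * b - 1) (g * x)).1
      (by push_cast; rw [hst, sub_self])
    have hk' := congrArg (Int.cast : ℤ → ZMod (g * x ^ 2)) hk
    push_cast at hk'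
    have hz : ((g : ZMod (g * x ^ 2)) * x * k) ^ 2 = 0 := by
      have := ZMod.natCast_self (g * x ^ 2)
      push_cast at this
      linear_combination (g * k ^ 2) * this
    -- Modulo g x² the element gx has square zero, so 1 + gxk is inverted by 1 - gxk.
    refine ⟨s * (1 - g * x * k), t * (1 - g * x * k), ?_⟩
    linear_combination (1 - (g : ZMod (g * x ^ 2)) * x * k) * hk' - hz
  obtain ⟨q, hq, hqn, hq'⟩ := rowIdeal_mem_primIdeals hn0 φ hab'
  have hmem : q ∈ rightIdeal q₁ := by
    have h1 : q ∈ rowIdeal φ a b := hq' ▸ self_mem_rightIdeal q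
    rw [hI]
    rw [mem_rowIdeal] at h1 ⊢
    have h2 := congrArg (ZMod.castHom hdvd (ZMod (g * x))) h1.1
    have h3 := congrArg (ZMod.castHom hdvd (ZMod (g * x))) h1.2
    rw [map_add, map_mul, map_mul, map_intCast, map_intCast, map_zero] at h2 h3
    exact ⟨h2, h3⟩
  obtain ⟨q₂, hq₂, hn₂, h₂⟩ := exists_primIdeal_of_dvd hodd hq (hqn ▸ hdvd)
  refine ⟨q, hq, hqn, fun z => ?_⟩
  rw [h₂]
  -- As q lies in q₁H, the product q̄ q₁ is divisible by |q₁|² = gx; so q₁ lies in the reduction of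
  -- q. Equal norms make the two ideals equal.
  have : q₁ ∈ rightIdeal q₂ := by
    rw [← h₂]
    obtain ⟨k, rfl⟩ := hmem
    change _ ∣ conj (q₁ * k) * q₁
    rw [conj_mul, mul_assoc, conj_mul_self, hn]
    exact natCast_dvd_mul_left dvd_rfl _
  rw [rightIdeal_eq_of_mem hq₁.ne_zero this (by rw [hn, hn₂])]

/-! ### Counting primitive ideals -/

/-- The number of unimodular pairs modulo `n`. -/
noncomputable def unimodularCount (n : ℕ) : ℕ :=
  Nat.card {p : ZMod n × ZMod n // IsCoprime p.1 p.2}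

/-- The number of primitive right ideals of norm `n`. -/
noncomputable def psi (n : ℕ) : ℕ := (primIdeals n).ncard

/-- Units act freely on unimodular pairs, and the orbits are the primitive ideals. -/
theorem primIdeals_prod_units {n : ℕ} (hn : Odd n) : Nonempty
    (primIdeals n × (ZMod n)ˣ ≃ {p : ZMod n × ZMod n // IsCoprime p.1 p.2}) := by
  obtain ⟨φ⟩ := exists_splitting hn
  have hn0 : n ≠ 0 := by rintro rfl; exact absurd hn (by decide)
  choose a b hab hI using fun I : primIdeals n => exists_rowIdeal_eq hn0 φ I.2
  refine ⟨Equiv.ofBijective (fun x => ⟨(x.2 * a x.1, x.2 * b x.1),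
    (isCoprime_mul_unit_left x.2.isUnit _ _).2 (hab x.1)⟩) ⟨?_, ?_⟩⟩
  · rintro ⟨I, u⟩ ⟨J, v⟩ h
    simp only [Subtype.mk.injEq, Prod.mk.injEq] at h
    have hIJ : I = J := by
      apply Subtype.ext
      rw [hI I, hI J, rowIdeal_eq_iff (hab I) (hab J)]
      refine ⟨v⁻¹ * u, ?_, ?_⟩
      · rw [Units.val_mul, mul_assoc, h.1, ← mul_assoc, Units.inv_mul, one_mul]
      · rw [Units.val_mul, mul_assoc, h.2, ← mul_assoc, Units.inv_mul, one_mul]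
    subst hIJ
    obtain ⟨s, t, hst⟩ := hab I
    have : (u : ZMod n) = v := by
      linear_combination s * h.1 + t * h.2 + ((v : ZMod n) - u) * hst
    rw [Units.ext this]
  · rintro ⟨⟨α, β⟩, h⟩
    let I : primIdeals n := ⟨_, rowIdeal_mem_primIdeals hn0 φ h⟩
    obtain ⟨u, h1, h2⟩ := (rowIdeal_eq_iff (hab I) h).1 (hI I).symm
    exact ⟨(I, u), Subtype.ext (Prod.ext h1.symm h2.symm)⟩

theorem psi_mul_totient {n : ℕ} (hn : Odd n) : psi n * n.totient = unimodularCount n := by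
  have : NeZero n := ⟨by rintro rfl; exact absurd hn (by decide)⟩
  obtain ⟨e⟩ := primIdeals_prod_units hn
  rw [unimodularCount, ← Nat.card_congr e, Nat.card_prod, psi, Nat.card_coe_set_eq,
    Nat.card_eq_fintype_card, ZMod.card_units_eq_totient]

theorem finite_primIdeals {n : ℕ} (hn : Odd n) : (primIdeals n).Finite := by
  have : NeZero n := ⟨by rintro rfl; exact absurd hn (by decide)⟩
  obtain ⟨e⟩ := primIdeals_prod_units hn
  have : Finite (primIdeals n × (ZMod n)ˣ) := Finite.of_equiv _ e.symm
  exact Set.finite_coe_iff.1 (Finite.of_injective (fun I : primIdeals n => (I, (1 : (ZMod n)ˣ)))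
    fun I J h => (Prod.mk.inj h).1)

theorem unimodularCount_mul {m n : ℕ} (h : m.Coprime n) :
    unimodularCount (m * n) = unimodularCount m * unimodularCount n := by
  let e := ZMod.chineseRemainder h
  have key : ∀ a b : ZMod (m * n), IsCoprime a b ↔
      IsCoprime (e a).1 (e b).1 ∧ IsCoprime (e a).2 (e b).2 := by
    intro a b
    constructor
    · rintro ⟨s, t, hst⟩
      have h1 := congrArg e hst
      simp only [map_add, map_mul, map_one] at h1
      exact ⟨⟨_, _, congrArg Prod.fst h1⟩, ⟨_, _, congrArg Prod.snd h1⟩⟩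
    · rintro ⟨⟨s, t, h1⟩, ⟨s', t', h2⟩⟩
      refine ⟨e.symm (s, s'), e.symm (t, t'), e.injective ?_⟩
      simp only [map_add, map_mul, map_one, RingEquiv.apply_symm_apply]
      exact Prod.ext h1 h2
  rw [unimodularCount, unimodularCount, unimodularCount, ← Nat.card_prod]
  refine Nat.card_congr
    { toFun := fun p => (⟨((e p.1.1).1, (e p.1.2).1), ((key _ _).1 p.2).1⟩,
        ⟨((e p.1.1).2, (e p.1.2).2), ((key _ _).1 p.2).2⟩)
      invFun := fun p => ⟨(e.symm (p.1.1.1, p.2.1.1), e.symm (p.1.1.2, p.2.1.2)), by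
        rw [key]
        simpa using ⟨p.1.2, p.2.2⟩⟩
      left_inv := fun p => by simp
      right_inv := fun p => by simp }

/-- Over a local ring a pair fails to be unimodular exactly if both entries are nonunits, so p^(2k)
of the p^(2k+2) pairs drop out. -/
theorem unimodularCount_prime_pow {p : ℕ} (hp : p.Prime) (k : ℕ) :
    unimodularCount (p ^ (k + 1)) = p ^ (2 * k) * (p ^ 2 - 1) := by
  classical
  have := isLocalRing_zmod_prime_pow hp k.succ_pos
  have : NeZero (p ^ (k + 1)) := ⟨pow_ne_zero _ hp.ne_zero⟩
  let R := ZMod (p ^ (k + 1))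
  have hcop : ∀ q : R × R, ¬ IsCoprime q.1 q.2 ↔ ¬ IsUnit q.1 ∧ ¬ IsUnit q.2 := by
    intro q
    rw [← not_or, not_iff_not]
    constructor
    · rintro ⟨s, t, h⟩
      rcases IsLocalRing.isUnit_or_isUnit_of_add_one h with h | h
      · exact Or.inl (isUnit_of_mul_isUnit_right h)
      · exact Or.inr (isUnit_of_mul_isUnit_right h)
    · rintro (h | h)
      · obtain ⟨u, hu⟩ := h.exists_left_inv
        exact ⟨u, 0, by rw [hu, zero_mul, add_zero]⟩
      · obtain ⟨u, hu⟩ := h.exists_left_inv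
        exact ⟨0, u, by rw [hu, zero_mul, zero_add]⟩
  have hunits : Fintype.card {x : R // IsUnit x} = p ^ k * (p - 1) := by
    rw [← Nat.totient_prime_pow_succ hp, ← ZMod.card_units_eq_totient]
    exact Fintype.card_congr
      { toFun := fun x => x.2.unit
        invFun := fun u => ⟨u, u.isUnit⟩
        left_inv := fun x => rfl
        right_inv := fun u => Units.ext rfl }
  have hR : Fintype.card R = p ^ (k + 1) := ZMod.card _
  have hnon : Fintype.card {x : R // ¬ IsUnit x} = p ^ k := by
    rw [Fintype.card_subtype_compl, hunits, hR, pow_succ, ← Nat.mul_sub,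
      Nat.sub_sub_self hp.one_le, mul_one]
  have hnn : Fintype.card {q : R × R // ¬ IsCoprime q.1 q.2} = p ^ k * p ^ k := by
    rw [← hnon, ← Fintype.card_prod]
    refine Fintype.card_congr
      { toFun := fun q => (⟨q.1.1, ((hcop _).1 q.2).1⟩, ⟨q.1.2, ((hcop _).1 q.2).2⟩)
        invFun := fun q => ⟨(q.1.1, q.2.1), (hcop _).2 ⟨q.1.2, q.2.2⟩⟩
        left_inv := fun q => rfl
        right_inv := fun q => rfl }
  have htot := Fintype.card_subtype_compl (fun q : R × R => IsCoprime q.1 q.2)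
  have hle := Fintype.card_subtype_le (fun q : R × R => IsCoprime q.1 q.2)
  rw [hnn, Fintype.card_prod, hR] at htot
  rw [Fintype.card_prod, hR] at hle
  rw [unimodularCount, Nat.card_eq_fintype_card]
  have h1 : Fintype.card {q : R × R // IsCoprime q.1 q.2} + p ^ k * p ^ k =
      p ^ (k + 1) * p ^ (k + 1) := by
    rw [htot]; omega
  have h2 : p ^ (2 * k) * (p ^ 2 - 1) + p ^ k * p ^ k = p ^ (k + 1) * p ^ (k + 1) := by
    obtain ⟨l, hl⟩ := Nat.exists_eq_add_of_le (Nat.one_le_pow 2 p hp.pos)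
    have h3 : p ^ (k + 1) * p ^ (k + 1) = p ^ (2 * k) * p ^ 2 := by ring
    have h4 : p ^ k * p ^ k = p ^ (2 * k) := by ring
    rw [h3, h4, hl]
    simp
    ring
  exact Nat.add_right_cancel (h1.trans h2.symm)

theorem psi_one : psi 1 = 1 := by
  have h := psi_mul_totient odd_one
  rw [Nat.totient_one, mul_one] at h
  rw [h, unimodularCount, Nat.card_eq_one_iff_unique]
  exact ⟨⟨fun a b => Subtype.ext (Subsingleton.elim _ _)⟩, ⟨⟨(0, 0), 0, 0, Subsingleton.elim _ _⟩⟩⟩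

theorem psi_mul {m n : ℕ} (hm : Odd m) (hn : Odd n) (h : m.Coprime n) :
    psi (m * n) = psi m * psi n := by
  have h1 := psi_mul_totient (hm.mul hn)
  rw [unimodularCount_mul h, ← psi_mul_totient hm, ← psi_mul_totient hn, Nat.totient_mul h] at h1
  have hpos : 0 < m.totient * n.totient := by
    have := Nat.totient_pos.2 hm.pos
    have := Nat.totient_pos.2 hn.pos
    positivity
  apply Nat.eq_of_mul_eq_mul_right hpos
  rw [h1]; ring

theorem psi_prime_pow {p : ℕ} (hp : p.Prime) (hp2 : p ≠ 2) (k : ℕ) :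
    psi (p ^ (k + 1)) = p ^ k * (p + 1) := by
  have h1 := psi_mul_totient ((hp.odd_of_ne_two hp2).pow (n := k + 1))
  rw [unimodularCount_prime_pow hp, Nat.totient_prime_pow_succ hp] at h1
  have hp1 : 0 < p - 1 := by have := hp.two_le; omega
  have hpos : 0 < p ^ k * (p - 1) := by have := hp.pos; positivity
  apply Nat.eq_of_mul_eq_mul_right hpos
  rw [h1, show p ^ 2 - 1 = (p + 1) * (p - 1) by rw [← Nat.sq_sub_sq]]
  ring

/-! ### The lattices q H r̄ / c and the ideals they determine -/

/-- A primitive Hurwitz quaternion of odd norm generates the unit two-sided ideal. -/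
theorem Prm.exists_two_sided {r : Hw} (hr : Prm r) (hodd : Odd (nrm r)) :
    ∃ x₁ y₁ x₂ y₂ y₃, x₁ * r * y₁ + x₂ * r * y₂ + r * y₃ = 1 := by
  obtain ⟨φ⟩ := exists_splitting hodd
  have hn : nrm r ≠ 0 := by intro h; rw [h] at hodd; exact absurd hodd (by decide)
  obtain ⟨a, a', s, s', h⟩ := φ.exists_eq_one hn hr
  -- The two products realise the matrix units E₁₁ and E₂₂; the sum is 1 up to a multiple of |r|²,
  -- which is r times r̄k.
  obtain ⟨x₁, hx₁⟩ := φ.surj !![a, a'; 0, 0]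
  obtain ⟨y₁, hy₁⟩ := φ.surj !![s, 0; s', 0]
  obtain ⟨x₂, hx₂⟩ := φ.surj !![0, 0; a, a']
  obtain ⟨y₂, hy₂⟩ := φ.surj !![0, s; 0, s']
  have hker : φ.toHom (1 - (x₁ * r * y₁ + x₂ * r * y₂)) = 0 := by
    rw [map_sub, map_add, map_mul, map_mul, map_mul, map_mul, map_one, hx₁, hx₂, hy₁, hy₂]
    obtain ⟨α, β, γ, δ, hM⟩ : ∃ α β γ δ, φ.toHom r = !![α, β; γ, δ] :=
      ⟨_, _, _, _, Matrix.eta_fin_two _⟩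
    rw [hM] at h ⊢
    simp at h
    simp only [Matrix.mul_fin_two]
    ext i j
    fin_cases i <;> fin_cases j <;> simp
    · linear_combination -h
    · linear_combination -h
  obtain ⟨k, hk⟩ := (φ.ker _).1 hker
  refine ⟨x₁, y₁, x₂, y₂, CoincidenceLattice.conj r * k, ?_⟩
  rw [← mul_assoc, mul_conj, ← hk]
  abel

/-- The lattice `q H r̄ / c`. -/
noncomputable def lat (q r : Hw) (c : ℕ) : AddSubgroup ℍ[ℝ] where
  carrier := {x | ∃ z : Hw, (c : ℍ[ℝ]) * x = (q * z * conj r : Hw)}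
  zero_mem' := ⟨0, by simp⟩
  add_mem' := by
    rintro x y ⟨z, hz⟩ ⟨w, hw⟩
    exact ⟨z + w, by rw [mul_add, hz, hw]; simp [mul_add, add_mul]⟩
  neg_mem' := by
    rintro x ⟨z, hz⟩
    exact ⟨-z, by rw [mul_neg, hz]; simp⟩

theorem mem_lat {q r : Hw} {c : ℕ} {x : ℍ[ℝ]} :
    x ∈ lat q r c ↔ ∃ z : Hw, (c : ℍ[ℝ]) * x = (q * z * conj r : Hw) := Iff.rfl

theorem natCast_quaternion_cancel {c : ℕ} (hc : c ≠ 0) {x y : ℍ[ℝ]}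
    (h : (c : ℍ[ℝ]) * x = c * y) : x = y := by
  refine mul_left_cancel₀ ?_ h
  intro h0
  have : ((c : Hw) : ℍ[ℝ]) = 0 := by simpa using h0
  exact natCast_ne_zero hc (Subtype.ext this)

theorem natCast_quaternion_comm (n : ℕ) (x : ℍ[ℝ]) : (n : ℍ[ℝ]) * x = x * n :=
  (Nat.cast_commute n x).eq

/-- Because |q|²|r|² = c², the equations cz = q w r̄ and q̄ z r = cw are equivalent. -/
theorem coe_mem_lat {q r : Hw} {c : ℕ} (hc : c ≠ 0) (h : nrm q * nrm r = c ^ 2) {z : Hw} :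
    (z : ℍ[ℝ]) ∈ lat q r c ↔ z ∈ cslSub c q r := by
  rw [mem_lat, mem_cslSub]
  have hcast : ((c : ℍ[ℝ]) * z) = ((c * z : Hw) : ℍ[ℝ]) := by simp
  have hab : (nrm q : Hw) * (nrm r : Hw) = c * c := by
    rw [← Nat.cast_mul, h, sq, Nat.cast_mul]
  constructor
  · rintro ⟨w, hw⟩
    rw [hcast, Subtype.coe_inj] at hw
    refine ⟨w, natCast_mul_cancel hc ?_⟩
    calc (c : Hw) * (conj q * z * r) = conj q * (c * z) * r := by
          rw [← mul_assoc, ← mul_assoc, natCast_comm, mul_assoc (conj q)]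
      _ = (nrm q : Hw) * (w * nrm r) := by
          rw [hw, ← conj_mul_self, ← conj_mul_self]; simp only [mul_assoc]
      _ = (nrm q : Hw) * (nrm r : Hw) * w := by rw [← natCast_comm, mul_assoc]
      _ = c * (c * w) := by rw [hab, mul_assoc]
  · rintro ⟨w, hw⟩
    refine ⟨w, ?_⟩
    rw [hcast, Subtype.coe_inj]
    apply natCast_mul_cancel hc
    calc (c : Hw) * (c * z) = (nrm q : Hw) * (nrm r : Hw) * z := by rw [hab, mul_assoc]
      _ = q * (conj q * z * r) * conj r := by
          rw [mul_assoc, natCast_comm (nrm r), ← mul_conj, ← mul_conj]; simp only [mul_assoc]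
      _ = c * (q * w * conj r) := by
          rw [hw, ← mul_assoc, ← mul_assoc, ← mul_assoc, natCast_comm c q]

theorem star_mem_lat {q r : Hw} {c : ℕ} {x : ℍ[ℝ]} : star x ∈ lat r q c ↔ x ∈ lat q r c := by
  have key : ∀ {q r : Hw} {x : ℍ[ℝ]}, x ∈ lat q r c → star x ∈ lat r q c := by
    rintro q r x ⟨z, hz⟩
    refine ⟨conj z, ?_⟩
    have := congrArg star hz
    rw [star_mul, star_natCast, ← natCast_quaternion_comm] at this
    rw [this, ← coe_conj]
    simp only [conj_mul, conj_conj, mul_assoc]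
  exact ⟨fun h => by simpa using key h, key⟩

theorem lat_mul_unit {q r u v : Hw} {c : ℕ} (hu : nrm u = 1) (hv : nrm v = 1) :
    lat (q * u) (r * v) c = lat q r c := by
  ext x
  rw [mem_lat, mem_lat]
  constructor
  · rintro ⟨z, hz⟩
    exact ⟨u * z * conj v, by rw [hz]; simp only [conj_mul, mul_assoc]⟩
  · rintro ⟨z, hz⟩
    refine ⟨conj u * z * v, ?_⟩
    have h1 : q * u * (conj u * z * v) * conj (r * v) =
        q * (u * conj u) * z * (v * conj v) * conj r := by
      simp only [conj_mul, mul_assoc]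
    rw [hz, h1, mul_conj, mul_conj, hu, hv]
    simp

theorem exists_unit_of_rightIdeal_eq {q q' : Hw} (hq : q ≠ 0)
    (h : rightIdeal q = rightIdeal q') : ∃ u, nrm u = 1 ∧ q' * u = q := by
  obtain ⟨u, hu⟩ : q ∈ rightIdeal q' := h ▸ self_mem_rightIdeal q
  obtain ⟨v, hv⟩ : q' ∈ rightIdeal q := h ▸ self_mem_rightIdeal q'
  change q' * u = q at hu
  change q * v = q' at hv
  refine ⟨u, ?_, hu⟩
  have h1 : nrm q = nrm q * (nrm v * nrm u) := by
    conv_lhs => rw [← hu, ← hv]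
    rw [nrm_mul, nrm_mul, mul_assoc]
  have h0 : 0 < nrm q := Nat.pos_of_ne_zero (by simpa using hq)
  have h2 : nrm v * nrm u = 1 := Nat.eq_of_mul_eq_mul_left h0 (by rw [mul_one, ← h1])
  exact Nat.eq_one_of_mul_eq_one_left h2

theorem lat_congr {q q' r r' : Hw} {c : ℕ} (hq : q ≠ 0) (hr : r ≠ 0)
    (h : rightIdeal q = rightIdeal q') (h' : rightIdeal r = rightIdeal r') :
    lat q r c = lat q' r' c := by
  obtain ⟨u, hu, rfl⟩ := exists_unit_of_rightIdeal_eq hq h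
  obtain ⟨v, hv, rfl⟩ := exists_unit_of_rightIdeal_eq hr h'
  exact lat_mul_unit hu hv

/-- The largest right `H`-module in the lattice `q H r̄ / c`. -/
theorem core_lat {q r : Hw} {c : ℕ} (hc : c ≠ 0) (h : nrm q * nrm r = c ^ 2) (hr : Prm r)
    (hodd : Odd (nrm r)) {x : ℍ[ℝ]} :
    (∀ y : Hw, x * y ∈ lat q r c) ↔ ∃ y : Hw, (nrm q : ℍ[ℝ]) * x = c * (q * y : Hw) := by
  have hab : (nrm q : ℍ[ℝ]) * (nrm r : ℍ[ℝ]) = c * c := by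
    rw [← Nat.cast_mul, h, sq, Nat.cast_mul]
  have hq0 : nrm q ≠ 0 := by
    intro h0
    rw [h0, zero_mul] at h
    exact hc (pow_eq_zero_iff two_ne_zero |>.1 h.symm)
  have hqq : (q : ℍ[ℝ]) * star (q : ℍ[ℝ]) = (nrm q : ℍ[ℝ]) := by
    have := congrArg (Subtype.val) (mul_conj q)
    simpa using this
  have hqq' : star (q : ℍ[ℝ]) * (q : ℍ[ℝ]) = (nrm q : ℍ[ℝ]) := by
    have := congrArg (Subtype.val) (conj_mul_self q)
    simpa using this
  have hrr' : star (r : ℍ[ℝ]) * (r : ℍ[ℝ]) = (nrm r : ℍ[ℝ]) := by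
    have := congrArg (Subtype.val) (conj_mul_self r)
    simpa using this
  have hrr : (r : ℍ[ℝ]) * star (r : ℍ[ℝ]) = (nrm r : ℍ[ℝ]) := by
    have := congrArg (Subtype.val) (mul_conj r)
    simpa using this
  constructor
  · intro hx
    have key : ∀ y : Hw, ∃ w : Hw, star (q : ℍ[ℝ]) * x * y * r = c * w := by
      intro y
      obtain ⟨w, hw⟩ := hx y
      refine ⟨w, natCast_quaternion_cancel hc ?_⟩
      calc (c : ℍ[ℝ]) * (star (q : ℍ[ℝ]) * x * y * r) = star (q : ℍ[ℝ]) * (c * (x * y)) * r := by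
            simp only [← mul_assoc]; rw [natCast_quaternion_comm]
        _ = (star (q : ℍ[ℝ]) * q) * (w * (star (r : ℍ[ℝ]) * r)) := by
            rw [hw]; simp [mul_assoc]
        _ = c * (c * w) := by
            rw [hqq', hrr', ← natCast_quaternion_comm, ← mul_assoc, hab, mul_assoc]
    -- Writing 1 as a combination of two-sided multiples of r removes the factor r and leaves q̄x in
    -- cH.
    obtain ⟨x₁, y₁, x₂, y₂, y₃, h1⟩ := hr.exists_two_sided hodd
    obtain ⟨w₁, hw₁⟩ := key x₁
    obtain ⟨w₂, hw₂⟩ := key x₂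
    obtain ⟨w₃, hw₃⟩ := key 1
    refine ⟨w₁ * y₁ + w₂ * y₂ + w₃ * y₃, ?_⟩
    have h1' : (x₁ : ℍ[ℝ]) * r * y₁ + x₂ * r * y₂ + r * y₃ = 1 := by
      have := congrArg Subtype.val h1
      simpa using this
    have h2 : star (q : ℍ[ℝ]) * x = c * ((w₁ * y₁ + w₂ * y₂ + w₃ * y₃ : Hw) : ℍ[ℝ]) := by
      calc star (q : ℍ[ℝ]) * x = star (q : ℍ[ℝ]) * x *
            ((x₁ : ℍ[ℝ]) * r * y₁ + x₂ * r * y₂ + r * y₃) := by rw [h1', mul_one]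
        _ = star (q : ℍ[ℝ]) * x * x₁ * r * y₁ + star (q : ℍ[ℝ]) * x * x₂ * r * y₂ +
            star (q : ℍ[ℝ]) * x * (1 : Hw) * r * y₃ := by simp [mul_add, mul_assoc]
        _ = _ := by rw [hw₁, hw₂, hw₃]; simp [mul_add, mul_assoc]
    rw [← hqq, mul_assoc, h2, ← mul_assoc, ← natCast_quaternion_comm, mul_assoc]
    simp
  · rintro ⟨y, hy⟩ z
    refine ⟨y * z * r, natCast_quaternion_cancel hq0 ?_⟩
    calc (nrm q : ℍ[ℝ]) * (c * (x * z)) = c * ((nrm q : ℍ[ℝ]) * x) * z := by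
          simp only [← mul_assoc]
          rw [natCast_quaternion_comm (nrm q)]
      _ = (nrm q : ℍ[ℝ]) * (nrm r : ℍ[ℝ]) * (q * y * z) := by
          rw [hy, hab]; simp [mul_assoc]
      _ = _ := by
          rw [mul_assoc, natCast_quaternion_comm (nrm r), ← hrr]
          simp [mul_assoc]

/-- By `core_lat` the largest right H-modules inside the two lattices are rational multiples of qH
and q'H. They coincide, and comparing contents makes the scalar factors equal. -/
theorem rightIdeal_eq_of_lat_eq {q r q' r' : Hw} {c c' : ℕ} (hc : c ≠ 0) (hc' : c' ≠ 0)
    (h : nrm q * nrm r = c ^ 2) (h' : nrm q' * nrm r' = c' ^ 2) (hq : Prm q) (hq' : Prm q')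
    (hr : Prm r) (hr' : Prm r') (hodd : Odd (nrm r)) (hodd' : Odd (nrm r'))
    (heq : lat q r c = lat q' r' c') : rightIdeal q = rightIdeal q' := by
  have key : ∀ {q r q' r' : Hw} {c c' : ℕ}, c ≠ 0 → c' ≠ 0 → nrm q * nrm r = c ^ 2 →
      nrm q' * nrm r' = c' ^ 2 → Prm q → Prm r → Prm r' → Odd (nrm r) → Odd (nrm r') →
      lat q r c = lat q' r' c' →
      ∃ y : Hw, ((nrm q' * c : ℕ) : Hw) * q = ((nrm q * c' : ℕ) : Hw) * (q' * y) := by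
    intro q r q' r' c c' hc hc' h h' hq hr hr' hodd hodd' heq
    have hq0 : (nrm q : ℍ[ℝ]) ≠ 0 := by
      have : ((nrm q : Hw) : ℍ[ℝ]) ≠ 0 := fun h0 =>
        natCast_ne_zero (n := nrm q) (by simpa using hq.ne_zero) (Subtype.ext h0)
      simpa using this
    have h1 : (nrm q : ℍ[ℝ]) * ((nrm q : ℍ[ℝ])⁻¹ * (c * q)) = c * (q * 1 : Hw) := by
      rw [mul_one, ← mul_assoc, mul_inv_cancel₀ hq0, one_mul]
    obtain ⟨y, hy⟩ := (core_lat hc' h' hr' hodd').1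
      (heq ▸ (core_lat hc h hr hodd).2 ⟨1, h1⟩)
    refine ⟨y, Subtype.ext ?_⟩
    calc (((nrm q' * c : ℕ) : Hw) * q : Hw).1 =
          (nrm q : ℍ[ℝ]) * ((nrm q' : ℍ[ℝ]) * ((nrm q : ℍ[ℝ])⁻¹ * (c * q))) := by
          rw [← mul_assoc, natCast_quaternion_comm (nrm q), mul_assoc,
            ← mul_assoc (nrm q : ℍ[ℝ]), mul_inv_cancel₀ hq0, one_mul]
          simp [mul_assoc]
      _ = _ := by rw [hy]; simp [mul_assoc]
  obtain ⟨y, hy⟩ := key hc hc' h h' hq hr hr' hodd hodd' heq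
  obtain ⟨y', hy'⟩ := key hc' hc h' h hq' hr' hr hodd' hodd heq.symm
  have ha : nrm q' * c ≠ 0 := mul_ne_zero (by simpa using hq'.ne_zero) hc
  have ha' : nrm q * c' ≠ 0 := mul_ne_zero (by simpa using hq.ne_zero) hc'
  have hyy : y' * y = 1 := by
    have h1 : ((nrm q' * c : ℕ) : Hw) * q * 1 = ((nrm q' * c : ℕ) : Hw) * q * (y' * y) := by
      conv_lhs => rw [mul_one, hy, ← mul_assoc, hy']
      simp only [mul_assoc]
    exact (mul_left_cancel₀ (mul_ne_zero (natCast_ne_zero ha) hq.ne_zero) h1).symm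
  have hy1 : nrm y = 1 := by
    have := congrArg nrm hyy
    rw [nrm_mul, nrm_one] at this
    exact Nat.eq_one_of_mul_eq_one_left this
  obtain ⟨-, h2⟩ := hq.content_eq (hq'.mul_unit hy1) ha ha' hy
  rw [h2, rightIdeal_mul_unit hy1]

/-- Conjugation exchanges q and r, so the result for left factors gives both ideals; the norms then
fix c. -/
theorem lat_eq_iff {q r q' r' : Hw} {c c' : ℕ} (hc : c ≠ 0) (hc' : c' ≠ 0)
    (h : nrm q * nrm r = c ^ 2) (h' : nrm q' * nrm r' = c' ^ 2) (hq : Prm q) (hq' : Prm q')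
    (hr : Prm r) (hr' : Prm r') (hodd : Odd c) (hodd' : Odd c') :
    lat q r c = lat q' r' c' ↔ c = c' ∧ rightIdeal q = rightIdeal q' ∧
      rightIdeal r = rightIdeal r' := by
  have o := Nat.odd_mul.1 (h ▸ hodd.pow)
  have o' := Nat.odd_mul.1 (h' ▸ hodd'.pow)
  constructor
  · intro heq
    have h1 := rightIdeal_eq_of_lat_eq hc hc' h h' hq hq' hr hr' o.2 o'.2 heq
    have heq' : lat r q c = lat r' q' c' := by
      ext x
      rw [← star_mem_lat, heq, star_mem_lat]
    have h2 := rightIdeal_eq_of_lat_eq hc hc' ((mul_comm _ _).trans h) ((mul_comm _ _).trans h')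
      hr hr' hq hq' o.1 o'.1 heq'
    refine ⟨?_, h1, h2⟩
    obtain ⟨u, hu, rfl⟩ := exists_unit_of_rightIdeal_eq hq.ne_zero h1
    obtain ⟨v, hv, rfl⟩ := exists_unit_of_rightIdeal_eq hr.ne_zero h2
    rw [nrm_mul, nrm_mul, hu, hv, mul_one, mul_one, h'] at h
    exact (Nat.pow_left_injective two_ne_zero h).symm
  · rintro ⟨rfl, h1, h2⟩
    exact lat_congr hq.ne_zero hr.ne_zero h1 h2

/-! ### Coincidence site lattices in terms of reduced ideals -/

/-- Divisibility by `g x y` only depends on the reduction of norm `g x`. -/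
theorem dvd_conj_mul_iff {g x y : ℕ} (hxy : x.Coprime y) (h0 : g * x * y ≠ 0) {q q₁ : Hw}
    (hqn : nrm q = g * x ^ 2)
    (hred : ∀ z, ((g * x : ℕ) : Hw) ∣ conj q * z ↔ z ∈ rightIdeal q₁) (w : Hw) :
    ((g * x * y : ℕ) : Hw) ∣ conj q * w ↔ ∃ t, w = y * (q₁ * t) := by
  have hgx : g * x ≠ 0 := left_ne_zero_of_mul h0
  have hy : y ≠ 0 := right_ne_zero_of_mul h0
  constructor
  · rintro ⟨t, ht⟩
    -- Multiplying by q replaces q̄ by its norm g x²; cancelling gx leaves xw = y q t, and as x, y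
    -- are coprime, y divides w.
    have h1 : (x : Hw) * w = y * (q * t) := by
      apply natCast_mul_cancel hgx
      calc ((g * x : ℕ) : Hw) * (x * w) = (nrm q : Hw) * w := by
            rw [hqn]; push_cast; simp only [sq, mul_assoc]
        _ = q * (((g * x * y : ℕ) : Hw) * t) := by rw [← mul_conj, mul_assoc, ht]
        _ = _ := by
            rw [← mul_assoc, ← natCast_comm, mul_assoc]; push_cast; simp only [mul_assoc]
    obtain ⟨w', rfl⟩ := natCast_dvd_of_dvd_mul hxy.symm (Dvd.intro _ h1.symm)
    have h2 : ((g * x : ℕ) : Hw) ∣ conj q * w' := by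
      rw [← natCast_mul_dvd_mul_iff hy]
      refine ⟨t, ?_⟩
      rw [← mul_assoc, natCast_comm, mul_assoc, ht, mul_comm y]
    obtain ⟨t', rfl⟩ := (hred _).1 h2
    exact ⟨t', rfl⟩
  · rintro ⟨t, rfl⟩
    have h2 := (hred (q₁ * t)).2 ⟨t, rfl⟩
    rw [← natCast_mul_dvd_mul_iff hy] at h2
    rwa [← mul_assoc, ← natCast_comm, mul_assoc (y : Hw), mul_comm (g * x)]

theorem dvd_conj_mul_iff' {g x y : ℕ} (h0 : g * x * y ≠ 0) {q₁ : Hw}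
    (hqn : nrm q₁ = g * x) (w : Hw) :
    ((g * x * y : ℕ) : Hw) ∣ conj q₁ * w ↔ ∃ t, w = y * (q₁ * t) := by
  have hgx : g * x ≠ 0 := left_ne_zero_of_mul h0
  constructor
  · rintro ⟨t, ht⟩
    refine ⟨t, natCast_mul_cancel hgx ?_⟩
    calc ((g * x : ℕ) : Hw) * w = q₁ * (conj q₁ * w) := by rw [← mul_assoc, mul_conj, hqn]
      _ = _ := by
          rw [ht, ← mul_assoc, ← natCast_comm, Nat.cast_mul]; simp only [mul_assoc]
  · rintro ⟨t, rfl⟩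
    refine ⟨t, ?_⟩
    rw [← mul_assoc, ← natCast_comm, mul_assoc, ← mul_assoc (conj q₁), conj_mul_self, hqn,
      Nat.cast_mul (g * x), ← mul_assoc, natCast_comm y]

theorem conj_mem_cslSub {c : ℕ} {q r z : Hw} : conj z ∈ cslSub c r q ↔ z ∈ cslSub c q r := by
  rw [mem_cslSub, mem_cslSub, ← natCast_dvd_conj]
  simp only [conj_mul, conj_conj, mul_assoc]

/-- A coincidence site lattice in terms of the reduced ideals. -/
theorem cslSub_eq_reduced {g x y : ℕ} (hxy : x.Coprime y) (h0 : g * x * y ≠ 0)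
    {q q₁ r r₁ : Hw} (hqn : nrm q = g * x ^ 2) (hrn : nrm r = g * y ^ 2)
    (hqn₁ : nrm q₁ = g * x) (hrn₁ : nrm r₁ = g * y)
    (hq : ∀ z, ((g * x : ℕ) : Hw) ∣ conj q * z ↔ z ∈ rightIdeal q₁)
    (hr : ∀ z, ((g * y : ℕ) : Hw) ∣ conj r * z ↔ z ∈ rightIdeal r₁) :
    cslSub (g * x * y) q r = cslSub (g * x * y) q₁ r₁ := by
  have h1 : ∀ z, z ∈ cslSub (g * x * y) q r ↔ z ∈ cslSub (g * x * y) q₁ r := by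
    intro z
    rw [mem_cslSub, mem_cslSub, mul_assoc (conj q), mul_assoc (conj q₁), dvd_conj_mul_iff hxy h0 hqn hq,
      dvd_conj_mul_iff' h0 hqn₁]
  have h0' : g * y * x ≠ 0 := by rwa [mul_right_comm]
  have h2 : ∀ z, z ∈ cslSub (g * x * y) r q₁ ↔ z ∈ cslSub (g * x * y) r₁ q₁ := by
    intro z
    rw [mul_right_comm, mem_cslSub, mem_cslSub, mul_assoc (conj r), mul_assoc (conj r₁),
      dvd_conj_mul_iff hxy.symm h0' hrn hr, dvd_conj_mul_iff' h0' hrn₁]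
  ext z
  rw [h1, ← conj_mem_cslSub, h2, conj_mem_cslSub]

/-- The largest right H-module inside the CSL is y q₁H: the two-sided decomposition of 1 by r₁ again
removes the right factor. -/
theorem core_cslSub {g x y : ℕ} (h0 : g * x * y ≠ 0)
    {q₁ r₁ : Hw} (hqn₁ : nrm q₁ = g * x) (hr : Prm r₁) (hodd : Odd (nrm r₁)) (z : Hw) :
    (∀ h, z * h ∈ cslSub (g * x * y) q₁ r₁) ↔ ∃ t, z = y * (q₁ * t) := by
  rw [← dvd_conj_mul_iff' h0 hqn₁]
  constructor
  · intro h
    obtain ⟨a₁, b₁, a₂, b₂, b₃, h1⟩ := hr.exists_two_sided hodd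
    have h2 : conj q₁ * z = conj q₁ * (z * a₁) * r₁ * b₁ + conj q₁ * (z * a₂) * r₁ * b₂ +
        conj q₁ * (z * 1) * r₁ * b₃ := by
      conv_lhs => rw [← mul_one z, ← h1]
      simp only [mul_add, mul_assoc, one_mul]
    rw [h2]
    exact dvd_add (dvd_add ((h a₁).mul_right _) ((h a₂).mul_right _)) ((h 1).mul_right _)
  · intro h t
    rw [mem_cslSub, ← mul_assoc (conj q₁), mul_assoc (conj q₁ * z)]
    exact h.mul_right _

/-- Equal lattices have equal largest right H-modules y qH and y' q'H, whose contents are y and y'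
as q, q' are primitive. Conjugation yields the other half, and the norms then yield g, in
`cslSub_eq_iff`. -/
theorem cslSub_inj_aux {g x y g' x' y' : ℕ} (h0 : g * x * y ≠ 0) (h0' : g' * x' * y' ≠ 0)
    {q r q' r' : Hw} (hqn : nrm q = g * x) (hqn' : nrm q' = g' * x') (hq : Prm q) (hq' : Prm q')
    (hr : Prm r) (hr' : Prm r') (hodd : Odd (nrm r)) (hodd' : Odd (nrm r'))
    (heq : cslSub (g * x * y) q r = cslSub (g' * x' * y') q' r') :
    y = y' ∧ rightIdeal q = rightIdeal q' := by
  have hy : y ≠ 0 := right_ne_zero_of_mul h0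
  have hy' : y' ≠ 0 := right_ne_zero_of_mul h0'
  have key : ∀ z, (∃ t, z = y * (q * t)) ↔ ∃ t, z = y' * (q' * t) := by
    intro z
    rw [← core_cslSub h0 hqn hr hodd, ← core_cslSub h0' hqn' hr' hodd', heq]
  obtain ⟨t, ht⟩ := (key (y * (q * 1))).1 ⟨1, rfl⟩
  obtain ⟨t', ht'⟩ := (key (y' * (q' * 1))).2 ⟨1, rfl⟩
  rw [mul_one] at ht ht'
  have htt : t' * t = 1 := by
    have h1 : (y : Hw) * q * 1 = y * q * (t' * t) := by
      conv_lhs => rw [mul_one, ht, ← mul_assoc, ht']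
      simp only [mul_assoc]
    exact (mul_left_cancel₀ (mul_ne_zero (natCast_ne_zero hy) hq.ne_zero) h1).symm
  have ht1 : nrm t = 1 := by
    have := congrArg nrm htt
    rw [nrm_mul, nrm_one] at this
    exact Nat.eq_one_of_mul_eq_one_left this
  obtain ⟨h2, h3⟩ := hq.content_eq (hq'.mul_unit ht1) hy hy' ht
  exact ⟨h2, by rw [h3, rightIdeal_mul_unit ht1]⟩

theorem cslSub_congr {q q' r r' : Hw} {c : ℕ} (hq : q ≠ 0) (hr : r ≠ 0)
    (h : rightIdeal q = rightIdeal q') (h' : rightIdeal r = rightIdeal r') :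
    cslSub c q r = cslSub c q' r' := by
  have key : ∀ {q r u : Hw}, nrm u = 1 → ∀ z, z ∈ cslSub c (q * u) r ↔ z ∈ cslSub c q r := by
    intro q r u hu z
    rw [mem_cslSub, mem_cslSub, conj_mul]
    constructor
    · intro h
      have := natCast_dvd_mul_left h u
      rwa [← mul_assoc, ← mul_assoc, ← mul_assoc, mul_conj, hu, Nat.cast_one, one_mul] at this
    · intro h
      rw [mul_assoc, mul_assoc, ← mul_assoc (conj q)]
      exact natCast_dvd_mul_left h _
  obtain ⟨u, hu, rfl⟩ := exists_unit_of_rightIdeal_eq hq h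
  obtain ⟨v, hv, rfl⟩ := exists_unit_of_rightIdeal_eq hr h'
  ext z
  rw [key hu, ← conj_mem_cslSub, key hv, conj_mem_cslSub]

theorem cslSub_eq_iff {g x y g' x' y' : ℕ} (hodd : Odd (g * x * y)) (hodd' : Odd (g' * x' * y'))
    {q r q' r' : Hw} (hqn : nrm q = g * x) (hqn' : nrm q' = g' * x') (hrn : nrm r = g * y)
    (hrn' : nrm r' = g' * y') (hq : Prm q) (hq' : Prm q') (hr : Prm r) (hr' : Prm r') :
    cslSub (g * x * y) q r = cslSub (g' * x' * y') q' r' ↔ (g = g' ∧ x = x' ∧ y = y') ∧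
      rightIdeal q = rightIdeal q' ∧ rightIdeal r = rightIdeal r' := by
  have h0 : g * x * y ≠ 0 := by intro h; rw [h] at hodd; exact absurd hodd (by decide)
  have h0' : g' * x' * y' ≠ 0 := by intro h; rw [h] at hodd'; exact absurd hodd' (by decide)
  have o := Nat.odd_mul.1 hodd
  have o1 := Nat.odd_mul.1 o.1
  have o' := Nat.odd_mul.1 hodd'
  have o1' := Nat.odd_mul.1 o'.1
  constructor
  · intro heq
    have h1 := cslSub_inj_aux h0 h0' hqn hqn' hq hq' hr hr' (hrn ▸ o1.1.mul o.2)
      (hrn' ▸ o1'.1.mul o'.2) heq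
    have heq' : cslSub (g * y * x) r q = cslSub (g' * y' * x') r' q' := by
      ext z
      rw [← conj_mem_cslSub, mul_right_comm, heq, mul_right_comm, conj_mem_cslSub]
    have h2 := cslSub_inj_aux (by rwa [mul_right_comm]) (by rwa [mul_right_comm]) hrn hrn' hr hr'
      hq hq' (hqn ▸ o.1) (hqn' ▸ o'.1) heq'
    refine ⟨⟨?_, h2.1, h1.1⟩, h1.2, h2.2⟩
    obtain ⟨u, hu, rfl⟩ := exists_unit_of_rightIdeal_eq hq.ne_zero h1.2
    rw [nrm_mul, hu, mul_one, hqn', h2.1] at hqn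
    have : 0 < x' := Nat.pos_of_ne_zero (by rintro rfl; simp at h0')
    exact (Nat.eq_of_mul_eq_mul_right this hqn).symm
  · rintro ⟨⟨rfl, rfl, rfl⟩, h1, h2⟩
    exact cslSub_congr hq.ne_zero hr.ne_zero h1 h2

/-! ### Counting by triples and pairs of ideals -/

/-- The triples `(g, x, y)` with `g x² y² = n` and `x`, `y` coprime. -/
def triples (n : ℕ) : Finset (ℕ × ℕ × ℕ) :=
  (n.divisors ×ˢ n.divisors ×ˢ n.divisors).filter
    fun t => t.1 * t.2.1 ^ 2 * t.2.2 ^ 2 = n ∧ t.2.1.Coprime t.2.2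

theorem mem_triples {n : ℕ} (hn : n ≠ 0) {t : ℕ × ℕ × ℕ} :
    t ∈ triples n ↔ t.1 * t.2.1 ^ 2 * t.2.2 ^ 2 = n ∧ t.2.1.Coprime t.2.2 := by
  simp only [triples, Finset.mem_filter, Finset.mem_product, Nat.mem_divisors]
  refine ⟨fun h => h.2, fun h => ⟨⟨⟨?_, hn⟩, ⟨?_, hn⟩, ?_, hn⟩, h⟩⟩
  · exact ⟨t.2.1 ^ 2 * t.2.2 ^ 2, by rw [← h.1]; ring⟩
  · exact ⟨t.1 * t.2.1 * t.2.2 ^ 2, by rw [← h.1]; ring⟩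
  · exact ⟨t.1 * t.2.1 ^ 2 * t.2.2, by rw [← h.1]; ring⟩

/-- The weighted number of pairs of primitive ideals attached to the triples of `n`. -/
noncomputable def cnt (e n : ℕ) : ℕ :=
  ∑ t ∈ triples n, psi (t.1 * t.2.1 ^ e) * psi (t.1 * t.2.2 ^ e)

/-- The primitive pairs attached to a triple. -/
def IsPair (e : ℕ) (t : ℕ × ℕ × ℕ) (q r : Hw) : Prop :=
  Prm q ∧ Prm r ∧ nrm q = t.1 * t.2.1 ^ e ∧ nrm r = t.1 * t.2.2 ^ e

theorem odd_of_mem_triples {n : ℕ} (hn : Odd n) {t : ℕ × ℕ × ℕ} (ht : t ∈ triples n) :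
    Odd t.1 ∧ Odd t.2.1 ∧ Odd t.2.2 := by
  have hn0 : n ≠ 0 := by rintro rfl; exact absurd hn (by decide)
  have h := (mem_triples hn0).1 ht
  rw [← h.1, Nat.odd_mul, Nat.odd_mul, Nat.odd_pow_iff two_ne_zero,
    Nat.odd_pow_iff two_ne_zero] at hn
  exact ⟨hn.1.1, hn.1.2, hn.2⟩

/-- Common to classes and CSLs: objects that are determined by, and determine, a triple and two
primitive right ideals of the prescribed norms are counted by the weighted sum. -/
theorem ncard_of_param {X : Type*} {e n : ℕ} (hn : Odd n) (F : ℕ × ℕ × ℕ → Hw → Hw → X)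
    {S : Set X} (hS : ∀ s, s ∈ S ↔ ∃ t ∈ triples n, ∃ q r, IsPair e t q r ∧ s = F t q r)
    (hF : ∀ t ∈ triples n, ∀ t' ∈ triples n, ∀ q r q' r', IsPair e t q r → IsPair e t' q' r' →
      (F t q r = F t' q' r' ↔ t = t' ∧ rightIdeal q = rightIdeal q' ∧
        rightIdeal r = rightIdeal r')) :
    S.Finite ∧ S.ncard = cnt e n := by
  choose gen hgen using fun (m : ℕ) (I : primIdeals m) => I.2
  let T := Σ t : triples n,
    primIdeals (t.1.1 * t.1.2.1 ^ e) × primIdeals (t.1.1 * t.1.2.2 ^ e)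
  let f : T → S := fun x => ⟨F x.1.1 (gen _ x.2.1) (gen _ x.2.2), (hS _).2
    ⟨x.1.1, x.1.2, _, _, ⟨(hgen _ _).1, (hgen _ _).1, (hgen _ _).2.1, (hgen _ _).2.1⟩, rfl⟩⟩
  have hf : Function.Bijective f := by
    constructor
    · rintro ⟨t, I, J⟩ ⟨t', I', J'⟩ h
      have h1 := congrArg Subtype.val h
      obtain ⟨h2, h3, h4⟩ := (hF _ t.2 _ t'.2 _ _ _ _
        ⟨(hgen _ I).1, (hgen _ J).1, (hgen _ I).2.1, (hgen _ J).2.1⟩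
        ⟨(hgen _ I').1, (hgen _ J').1, (hgen _ I').2.1, (hgen _ J').2.1⟩).1 h1
      obtain rfl : t = t' := Subtype.ext h2
      rw [← (hgen _ I).2.2, ← (hgen _ I').2.2] at h3
      rw [← (hgen _ J).2.2, ← (hgen _ J').2.2] at h4
      rw [Subtype.ext h3, Subtype.ext h4]
    · rintro ⟨s, hs⟩
      obtain ⟨t, ht, q, r, hp, rfl⟩ := (hS _).1 hs
      let I : primIdeals (t.1 * t.2.1 ^ e) := ⟨rightIdeal q, q, hp.1, hp.2.2.1, rfl⟩
      let J : primIdeals (t.1 * t.2.2 ^ e) := ⟨rightIdeal r, r, hp.2.1, hp.2.2.2, rfl⟩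
      refine ⟨⟨⟨t, ht⟩, I, J⟩, Subtype.ext ?_⟩
      exact (hF _ ht _ ht _ _ _ _
        ⟨(hgen _ I).1, (hgen _ J).1, (hgen _ I).2.1, (hgen _ J).2.1⟩ hp).2
        ⟨rfl, (hgen _ I).2.2.symm, (hgen _ J).2.2.symm⟩
  have hfin : ∀ t : triples n, Finite (primIdeals (t.1.1 * t.1.2.1 ^ e)) ∧
      Finite (primIdeals (t.1.1 * t.1.2.2 ^ e)) := by
    intro t
    obtain ⟨h1, h2, h3⟩ := odd_of_mem_triples hn t.2
    exact ⟨(finite_primIdeals (h1.mul h2.pow)).to_subtype,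
      (finite_primIdeals (h1.mul h3.pow)).to_subtype⟩
  have : ∀ t : triples n, Finite (primIdeals (t.1.1 * t.1.2.1 ^ e) ×
      primIdeals (t.1.1 * t.1.2.2 ^ e)) := fun t => by
    have := (hfin t).1
    have := (hfin t).2
    infer_instance
  have : Finite S := Finite.of_equiv _ (Equiv.ofBijective f hf)
  refine ⟨Set.toFinite S, ?_⟩
  rw [← Nat.card_coe_set_eq, ← Nat.card_congr (Equiv.ofBijective f hf), Nat.card_sigma, cnt,
    ← Finset.sum_coe_sort (triples n) fun t => psi (t.1 * t.2.1 ^ e) * psi (t.1 * t.2.2 ^ e)]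
  refine Finset.sum_congr rfl fun t _ => ?_
  rw [Nat.card_prod, Nat.card_coe_set_eq, Nat.card_coe_set_eq]
  rfl

/-- The images of the Hurwitz order of coincidence index `n`. -/
def latsOfIndex (n : ℕ) : Set (AddSubgroup ℍ[ℝ]) :=
  {L | ∃ t ∈ triples n, ∃ q r, IsPair 2 t q r ∧ L = lat q r (t.1 * t.2.1 * t.2.2)}

/-- The coincidence site lattices of the Hurwitz order of index `n`. -/
def cslsOfIndex (n : ℕ) : Set (AddSubgroup Hw) :=
  {L | ∃ t ∈ triples n, ∃ q r, IsPair 2 t q r ∧ L = cslSub (t.1 * t.2.1 * t.2.2) q r}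

/-- The number g is the gcd of the two norms, since x and y are coprime. -/
theorem triple_eq_of_sq {g x y g' x' y' : ℕ} (hg : g ≠ 0)
    (hxy : x.Coprime y) (hxy' : x'.Coprime y')
    (ha : g * x ^ 2 = g' * x' ^ 2) (hb : g * y ^ 2 = g' * y' ^ 2) :
    g = g' ∧ x = x' ∧ y = y' := by
  have h1 : ∀ g x y : ℕ, x.Coprime y → (g * x ^ 2).gcd (g * y ^ 2) = g := by
    intro g x y h
    rw [Nat.gcd_mul_left, Nat.Coprime.pow 2 2 h, mul_one]
  have h2 : g = g' := by rw [← h1 g x y hxy, ← h1 g' x' y' hxy', ha, hb]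
  subst h2
  have hg' := Nat.pos_of_ne_zero hg
  exact ⟨rfl, Nat.pow_left_injective two_ne_zero (Nat.eq_of_mul_eq_mul_left hg' ha),
    Nat.pow_left_injective two_ne_zero (Nat.eq_of_mul_eq_mul_left hg' hb)⟩

theorem ncard_latsOfIndex {n : ℕ} (hn : Odd n) :
    (latsOfIndex n).Finite ∧ (latsOfIndex n).ncard = cnt 2 n := by
  have hn0 : n ≠ 0 := by rintro rfl; exact absurd hn (by decide)
  refine ncard_of_param hn (fun t q r => lat q r (t.1 * t.2.1 * t.2.2)) (fun s => Iff.rfl) ?_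
  rintro ⟨g, x, y⟩ ht ⟨g', x', y'⟩ ht' q r q' r' ⟨hq, hr, hqn, hrn⟩ ⟨hq', hr', hqn', hrn'⟩
  obtain ⟨o1, o2, o3⟩ := odd_of_mem_triples hn ht
  obtain ⟨o1', o2', o3'⟩ := odd_of_mem_triples hn ht'
  have h := ((mem_triples hn0).1 ht).2
  have h' := ((mem_triples hn0).1 ht').2
  dsimp only at *
  have o := (o1.mul o2).mul o3
  have o' := (o1'.mul o2').mul o3'
  rw [lat_eq_iff o.pos.ne' o'.pos.ne' (by rw [hqn, hrn]; ring) (by rw [hqn', hrn']; ring)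
    hq hq' hr hr' o o']
  constructor
  · rintro ⟨-, h1, h2⟩
    refine ⟨?_, h1, h2⟩
    obtain ⟨u, hu, rfl⟩ := exists_unit_of_rightIdeal_eq hq.ne_zero h1
    obtain ⟨v, hv, rfl⟩ := exists_unit_of_rightIdeal_eq hr.ne_zero h2
    rw [nrm_mul, hu, mul_one] at hqn
    rw [nrm_mul, hv, mul_one] at hrn
    obtain ⟨rfl, rfl, rfl⟩ := triple_eq_of_sq o1.pos.ne' h h' (hqn.symm.trans hqn')
      (hrn.symm.trans hrn')
    rfl
  · rintro ⟨h0, h1, h2⟩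
    simp only [Prod.mk.injEq] at h0
    obtain ⟨rfl, rfl, rfl⟩ := h0
    exact ⟨rfl, h1, h2⟩

/-- Passing to reduced ideals changes the exponent from 2 to 1; conversely, lifts supply ideals of
norms g x² and g y². -/
theorem mem_cslsOfIndex_iff {n : ℕ} (hn : Odd n) (L : AddSubgroup Hw) :
    L ∈ cslsOfIndex n ↔
      ∃ t ∈ triples n, ∃ q r, IsPair 1 t q r ∧ L = cslSub (t.1 * t.2.1 * t.2.2) q r := by
  have hn0 : n ≠ 0 := by rintro rfl; exact absurd hn (by decide)
  constructor
  · rintro ⟨⟨g, x, y⟩, ht, q, r, ⟨hq, hr, hqn, hrn⟩, rfl⟩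
    obtain ⟨o1, o2, o3⟩ := odd_of_mem_triples hn ht
    dsimp only at *
    obtain ⟨q₁, hq₁, hqn₁, h1⟩ := exists_primIdeal_of_dvd (o1.mul o2) hq
      ⟨x, by rw [hqn]; ring⟩
    obtain ⟨r₁, hr₁, hrn₁, h2⟩ := exists_primIdeal_of_dvd (o1.mul o3) hr
      ⟨y, by rw [hrn]; ring⟩
    exact ⟨_, ht, q₁, r₁, ⟨hq₁, hr₁, by simpa using hqn₁, by simpa using hrn₁⟩,
      cslSub_eq_reduced ((mem_triples hn0).1 ht).2 ((o1.mul o2).mul o3).pos.ne' hqn hrn hqn₁ hrn₁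
        h1 h2⟩
  · rintro ⟨⟨g, x, y⟩, ht, q₁, r₁, ⟨hq₁, hr₁, hqn₁, hrn₁⟩, rfl⟩
    obtain ⟨o1, o2, o3⟩ := odd_of_mem_triples hn ht
    dsimp only at *
    rw [pow_one] at hqn₁ hrn₁
    obtain ⟨q, hq, hqn, h1⟩ := exists_primIdeal_lift (o1.mul o2) hq₁ hqn₁
    obtain ⟨r, hr, hrn, h2⟩ := exists_primIdeal_lift (o1.mul o3) hr₁ hrn₁
    exact ⟨_, ht, q, r, ⟨hq, hr, hqn, hrn⟩,
      (cslSub_eq_reduced ((mem_triples hn0).1 ht).2 ((o1.mul o2).mul o3).pos.ne' hqn hrn hqn₁ hrn₁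
        h1 h2).symm⟩

theorem ncard_cslsOfIndex {n : ℕ} (hn : Odd n) :
    (cslsOfIndex n).Finite ∧ (cslsOfIndex n).ncard = cnt 1 n := by
  refine ncard_of_param hn (fun t q r => cslSub (t.1 * t.2.1 * t.2.2) q r)
    (mem_cslsOfIndex_iff hn) ?_
  rintro ⟨g, x, y⟩ ht ⟨g', x', y'⟩ ht' q r q' r' ⟨hq, hr, hqn, hrn⟩ ⟨hq', hr', hqn', hrn'⟩
  obtain ⟨o1, o2, o3⟩ := odd_of_mem_triples hn ht
  obtain ⟨o1', o2', o3'⟩ := odd_of_mem_triples hn ht'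
  dsimp only at *
  rw [pow_one] at hqn hqn' hrn hrn'
  rw [cslSub_eq_iff ((o1.mul o2).mul o3) ((o1'.mul o2').mul o3') hqn hqn' hrn hrn' hq hq' hr hr']
  simp only [Prod.mk.injEq]

/-! ### Rational isometries as pairs of primitive quaternions -/

/-- A quaternion is rational if some positive multiple is a Hurwitz quaternion. -/
def IsRat (x : ℍ[ℝ]) : Prop := ∃ N : ℕ, N ≠ 0 ∧ (N : ℍ[ℝ]) * x ∈ Hurwitz

theorem natCast_quaternion_ne_zero {n : ℕ} (hn : n ≠ 0) : (n : ℍ[ℝ]) ≠ 0 := fun h0 =>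
  natCast_ne_zero hn (Subtype.ext (by simpa using h0))

theorem isRat_of_mem {x : ℍ[ℝ]} (hx : x ∈ Hurwitz) : IsRat x := ⟨1, one_ne_zero, by simpa using hx⟩

theorem IsRat.mul {x y : ℍ[ℝ]} (hx : IsRat x) (hy : IsRat y) : IsRat (x * y) := by
  obtain ⟨N, hN, hx⟩ := hx
  obtain ⟨M, hM, hy⟩ := hy
  refine ⟨N * M, mul_ne_zero hN hM, ?_⟩
  have : ((N * M : ℕ) : ℍ[ℝ]) * (x * y) = (N * x) * (M * y) := by
    push_cast
    rw [mul_assoc, mul_assoc, ← mul_assoc (M : ℍ[ℝ]), natCast_quaternion_comm M x, mul_assoc]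
  rw [this]
  exact Hurwitz.mul_mem hx hy

theorem IsRat.sub {x y : ℍ[ℝ]} (hx : IsRat x) (hy : IsRat y) : IsRat (x - y) := by
  obtain ⟨N, hN, hx⟩ := hx
  obtain ⟨M, hM, hy⟩ := hy
  refine ⟨N * M, mul_ne_zero hN hM, ?_⟩
  have : ((N * M : ℕ) : ℍ[ℝ]) * (x - y) = M * (N * x) - N * (M * y) := by
    rw [mul_sub]
    congr 1
    · rw [mul_comm N, Nat.cast_mul, mul_assoc]
    · rw [Nat.cast_mul, mul_assoc]
  rw [this]
  exact Hurwitz.sub_mem (Hurwitz.mul_mem (natCast_mem _ _) hx)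
    (Hurwitz.mul_mem (natCast_mem _ _) hy)

theorem IsRat.inv {x : ℍ[ℝ]} (hx : IsRat x) : IsRat x⁻¹ := by
  by_cases h0 : x = 0
  · rw [h0, inv_zero]; exact isRat_of_mem Hurwitz.zero_mem
  obtain ⟨N, hN, hx⟩ := hx
  let h : Hw := ⟨N * x, hx⟩
  have hh : (h : ℍ[ℝ]) = N * x := rfl
  have hN' : (N : ℍ[ℝ]) ≠ 0 := natCast_quaternion_ne_zero hN
  have hne : h ≠ 0 := fun h1 => mul_ne_zero hN' h0 (congrArg Subtype.val h1)
  refine ⟨nrm h, by simpa using hne, ?_⟩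
  have h1 : (nrm h : ℍ[ℝ]) = star (h : ℍ[ℝ]) * h := by
    simpa using (congrArg Subtype.val (conj_mul_self h)).symm
  have h2 : (nrm h : ℍ[ℝ]) * x⁻¹ = star (h : ℍ[ℝ]) * N := by
    rw [h1, hh, mul_assoc, mul_assoc, mul_inv_cancel₀ h0, mul_one]
  rw [h2]
  exact Hurwitz.mul_mem (star_mem_hurwitz hx) (natCast_mem _ _)

theorem IsRat.exists_prm {x : ℍ[ℝ]} (hx : IsRat x) (h0 : x ≠ 0) :
    ∃ (q : Hw) (m n : ℕ), Prm q ∧ m ≠ 0 ∧ n ≠ 0 ∧ (n : ℍ[ℝ]) * x = m * q := by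
  obtain ⟨N, hN, hx⟩ := hx
  have hN' : (N : ℍ[ℝ]) ≠ 0 := natCast_quaternion_ne_zero hN
  obtain ⟨m, q, hm, hq, h⟩ := CoincidenceLattice.exists_prm (x := ⟨N * x, hx⟩)
    fun h1 => mul_ne_zero hN' h0 (congrArg Subtype.val h1)
  exact ⟨q, m, N, hq, hm, hN, by simpa using congrArg Subtype.val h⟩

/-- The quaternion units. -/
noncomputable def qI : ℍ[ℝ] := ⟨0, 1, 0, 0⟩

/-- The quaternion unit `j`. -/
noncomputable def qJ : ℍ[ℝ] := ⟨0, 0, 1, 0⟩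

/-- The quaternion unit `k`. -/
noncomputable def qK : ℍ[ℝ] := ⟨0, 0, 0, 1⟩

@[simp] theorem qI_re : qI.re = 0 := rfl
@[simp] theorem qI_imI : qI.imI = 1 := rfl
@[simp] theorem qI_imJ : qI.imJ = 0 := rfl
@[simp] theorem qI_imK : qI.imK = 0 := rfl
@[simp] theorem qJ_re : qJ.re = 0 := rfl
@[simp] theorem qJ_imI : qJ.imI = 0 := rfl
@[simp] theorem qJ_imJ : qJ.imJ = 1 := rfl
@[simp] theorem qJ_imK : qJ.imK = 0 := rfl
@[simp] theorem qK_re : qK.re = 0 := rfl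
@[simp] theorem qK_imI : qK.imI = 0 := rfl
@[simp] theorem qK_imJ : qK.imJ = 0 := rfl
@[simp] theorem qK_imK : qK.imK = 1 := rfl

theorem qI_mem : qI ∈ Hurwitz := ⟨0, 1, 0, 0, by ext <;> simp⟩
theorem qJ_mem : qJ ∈ Hurwitz := ⟨0, 0, 1, 0, by ext <;> simp⟩
theorem qK_mem : qK ∈ Hurwitz := ⟨0, 0, 0, 1, by ext <;> simp⟩

theorem quaternion_eq_sum (z : ℍ[ℝ]) :
    z = z.re • (1 : ℍ[ℝ]) + z.imI • qI + z.imJ • qJ + z.imK • qK := by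
  ext <;> simp

/-- A linear map preserving the norm form preserves the inner product. -/
theorem re_mul_star_of_normSq (T : ℍ[ℝ] →ₗ[ℝ] ℍ[ℝ])
    (hT : ∀ z, Quaternion.normSq (T z) = Quaternion.normSq z) (x y : ℍ[ℝ]) :
    (T x).re * (T y).re + (T x).imI * (T y).imI + (T x).imJ * (T y).imJ + (T x).imK * (T y).imK =
      x.re * y.re + x.imI * y.imI + x.imJ * y.imJ + x.imK * y.imK := by
  have h1 := hT (x + y)
  have h2 := hT x
  have h3 := hT y
  rw [map_add] at h1
  simp only [Quaternion.normSq_def', Quaternion.re_add, Quaternion.imI_add, Quaternion.imJ_add,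
    Quaternion.imK_add] at h1 h2 h3
  linarith

/-- Conjugating a pure unit quaternion into another one. -/
theorem exists_conjugator {u v w : ℍ[ℝ]} (hu : u * u = -1) (hv : v * v = -1) (hw : w ≠ 0)
    (hwu : w * u = -u * w) (hv' : IsRat v) (hu' : IsRat u) (hw' : IsRat w) :
    ∃ a : ℍ[ℝ], a ≠ 0 ∧ IsRat a ∧ a * u = v * a ∧ (a = 1 - v * u ∨ a = w) := by
  -- Both (1 - vu)u and v(1 - vu) equal u + v, and 1 - vu vanishes only for v = -u. In that case w
  -- serves, as it anticommutes with u.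
  by_cases h : v = -u
  · exact ⟨w, hw, hw', by rw [hwu, h], Or.inr rfl⟩
  · refine ⟨1 - v * u, ?_, (isRat_of_mem Hurwitz.one_mem).sub (hv'.mul hu'), ?_, Or.inl rfl⟩
    · intro h0
      apply h
      have h1 : v * u * u = u := by rw [← sub_eq_zero.1 h0, one_mul]
      rw [mul_assoc, hu, mul_neg, mul_one] at h1
      rw [← h1, neg_neg]
    · rw [sub_mul, mul_assoc v, hu, mul_sub, ← mul_assoc, hv]
      simp
      abel

/-- The map `z ↦ a⁻¹ T z a`. -/
noncomputable def conjMap (T : ℍ[ℝ] →ₗ[ℝ] ℍ[ℝ]) (a b : ℍ[ℝ]) : ℍ[ℝ] →ₗ[ℝ] ℍ[ℝ] :=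
  (LinearMap.mulLeft ℝ a).comp ((LinearMap.mulRight ℝ b).comp T)

theorem conjMap_apply (T : ℍ[ℝ] →ₗ[ℝ] ℍ[ℝ]) (a b z : ℍ[ℝ]) :
    conjMap T a b z = a * (T z * b) := rfl

theorem normSq_conjMap {T : ℍ[ℝ] →ₗ[ℝ] ℍ[ℝ]}
    (hT : ∀ z, Quaternion.normSq (T z) = Quaternion.normSq z) {a : ℍ[ℝ]} (ha : a ≠ 0) (z : ℍ[ℝ]) :
    Quaternion.normSq (conjMap T a⁻¹ a z) = Quaternion.normSq z := by
  have h : Quaternion.normSq a ≠ 0 := by simpa using ha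
  rw [conjMap_apply, map_mul, map_mul, hT, map_inv₀]
  field_simp

/-- A rational norm preserving map fixing `1` is a rational conjugation, up to a reflection. -/
theorem exists_conjugation (T : ℍ[ℝ] →ₗ[ℝ] ℍ[ℝ])
    (hT : ∀ z, Quaternion.normSq (T z) = Quaternion.normSq z) (h1 : T 1 = 1)
    (hI : IsRat (T qI)) (hJ : IsRat (T qJ)) :
    ∃ a b : ℍ[ℝ], a ≠ 0 ∧ b ≠ 0 ∧ IsRat a ∧ IsRat b ∧
      ((∀ z, T z = a * z * b) ∨ ∀ z, T z = a * star z * b) := by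
  have hsq : ∀ x : ℍ[ℝ], x.re = 0 → Quaternion.normSq x = 1 → x * x = -1 := by
    intro x h0 h
    rw [Quaternion.normSq_def', h0] at h
    ext <;> simp [h0] <;> linarith
  have hre : ∀ (T : ℍ[ℝ] →ₗ[ℝ] ℍ[ℝ]) (_ : ∀ z, Quaternion.normSq (T z) = Quaternion.normSq z)
      (_ : T 1 = 1) (z : ℍ[ℝ]), (T z).re = z.re := by
    intro T hT h1 z
    have := re_mul_star_of_normSq T hT z 1
    rw [h1] at this
    simpa using this
  have hnI : Quaternion.normSq qI = 1 := by rw [Quaternion.normSq_def']; simp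
  have hnJ : Quaternion.normSq qJ = 1 := by rw [Quaternion.normSq_def']; simp
  have hnK : Quaternion.normSq qK = 1 := by rw [Quaternion.normSq_def']; simp
  have hI0 : qI ≠ 0 := fun h => by simpa using congrArg QuaternionAlgebra.imI h
  have hJ0 : qJ ≠ 0 := fun h => by simpa using congrArg QuaternionAlgebra.imJ h
  have hK0 : qK ≠ 0 := fun h => by simpa using congrArg QuaternionAlgebra.imK h
  have hII : qI * qI = -1 := hsq _ rfl hnI
  have hJJ : qJ * qJ = -1 := hsq _ rfl hnJ
  have hJI : qJ * qI = -qI * qJ := by ext <;> simp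
  have hIJ : qI * qJ = -qJ * qI := by ext <;> simp
  obtain ⟨a, ha, har, hau, -⟩ := exists_conjugator hII
    (hsq _ (hre T hT h1 qI) (by rw [hT, hnI])) hJ0 hJI hI (isRat_of_mem qI_mem)
    (isRat_of_mem qJ_mem)
  set T₁ := conjMap T a⁻¹ a with hT₁
  have hT₁n := normSq_conjMap hT ha
  have h11 : T₁ 1 = 1 := by rw [conjMap_apply, h1, one_mul, inv_mul_cancel₀ ha]
  have h1I : T₁ qI = qI := by rw [conjMap_apply, ← hau, ← mul_assoc, inv_mul_cancel₀ ha, one_mul]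
  have h1J : IsRat (T₁ qJ) := har.inv.mul (hJ.mul har)
  have hJre := hre T₁ hT₁n h11 qJ
  have hJimI : (T₁ qJ).imI = 0 := by
    have := re_mul_star_of_normSq T₁ hT₁n qJ qI
    rw [h1I] at this
    simpa using this
  obtain ⟨c, hc, hcr, hcu, hcor⟩ := exists_conjugator hJJ
    (hsq _ hJre (by rw [hT₁n, hnJ])) hI0 hIJ h1J (isRat_of_mem qJ_mem) (isRat_of_mem qI_mem)
  -- The image of j is orthogonal to 1 and i, so its product with j lies in ℝ + ℝi. Hence c commutes
  -- with i, and conjugating by c does not disturb the fixed vector i.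
  have hcI : c * qI = qI * c := by
    rcases hcor with rfl | rfl
    · ext <;> simp [hJimI, hJre]
    · rfl
  set T₂ := conjMap T₁ c⁻¹ c with hT₂
  have hT₂n := normSq_conjMap hT₁n hc
  have h21 : T₂ 1 = 1 := by rw [conjMap_apply, h11, one_mul, inv_mul_cancel₀ hc]
  have h2I : T₂ qI = qI := by
    rw [conjMap_apply, h1I, ← hcI, ← mul_assoc, inv_mul_cancel₀ hc, one_mul]
  have h2J : T₂ qJ = qJ := by
    rw [conjMap_apply, ← hcu, ← mul_assoc, inv_mul_cancel₀ hc, one_mul]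
  -- With 1, i, j fixed, k can only go to ±k. The sign + gives the identity, the sign - gives z ↦ -k
  -- z̄ k.
  have hK : T₂ qK = qK ∨ T₂ qK = -qK := by
    have e1 := hre T₂ hT₂n h21 qK
    have e2 := re_mul_star_of_normSq T₂ hT₂n qK qI
    have e3 := re_mul_star_of_normSq T₂ hT₂n qK qJ
    have e4 := hT₂n qK
    rw [h2I] at e2
    rw [h2J] at e3
    rw [← hT₂, hnK, Quaternion.normSq_def'] at e4
    simp at e1 e2 e3
    rw [e1, e2, e3] at e4
    have e5 : ((T₂ qK).imK - 1) * ((T₂ qK).imK + 1) = 0 := by linarith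
    rcases mul_eq_zero.1 e5 with h | h
    · left; ext <;> simp [e1, e2, e3]; linarith
    · right; ext <;> simp [e1, e2, e3]; linarith
  have hTT : ∀ z, T z = a * c * T₂ z * (c⁻¹ * a⁻¹) := by
    intro z
    rw [hT₂, hT₁, conjMap_apply, conjMap_apply]
    calc T z = (a * (c * c⁻¹) * a⁻¹) * T z * (a * (c * c⁻¹) * a⁻¹) := by
          rw [mul_inv_cancel₀ hc, mul_one, mul_inv_cancel₀ ha, one_mul, mul_one]
      _ = _ := by simp only [mul_assoc]
  have hexp : ∀ z, T₂ z = z.re • 1 + z.imI • qI + z.imJ • qJ + z.imK • T₂ qK := by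
    intro z
    conv_lhs => rw [quaternion_eq_sum z]
    simp only [map_add, map_smul, h21, h2I, h2J]
  rcases hK with hK | hK
  · refine ⟨a * c, c⁻¹ * a⁻¹, mul_ne_zero ha hc, mul_ne_zero (inv_ne_zero hc) (inv_ne_zero ha),
      har.mul hcr, hcr.inv.mul har.inv, Or.inl fun z => ?_⟩
    rw [hTT, hexp, hK, ← quaternion_eq_sum]
  · have hz : ∀ z, T₂ z = qK * star z * -qK := by
      intro z
      rw [hexp, hK]
      ext <;> simp
    refine ⟨a * c * qK, -qK * (c⁻¹ * a⁻¹), mul_ne_zero (mul_ne_zero ha hc) hK0,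
      mul_ne_zero (neg_ne_zero.2 hK0) (mul_ne_zero (inv_ne_zero hc) (inv_ne_zero ha)),
      (har.mul hcr).mul (isRat_of_mem qK_mem),
      (isRat_of_mem (Hurwitz.neg_mem qK_mem)).mul (hcr.inv.mul har.inv), Or.inr fun z => ?_⟩
    rw [hTT, hz]
    simp only [mul_assoc]

/-- Parametrization of rational norm preserving maps by pairs of primitive quaternions. -/
theorem exists_prm_pair (S : ℍ[ℝ] →ₗ[ℝ] ℍ[ℝ])
    (hS : ∀ z, Quaternion.normSq (S z) = Quaternion.normSq z)
    (hrat : ∀ z ∈ Hurwitz, IsRat (S z)) :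
    ∃ (q r : Hw) (c : ℕ), Prm q ∧ Prm r ∧ c ≠ 0 ∧ nrm q * nrm r = c ^ 2 ∧
      ((∀ z, (c : ℍ[ℝ]) * S z = q * z * r) ∨ ∀ z, (c : ℍ[ℝ]) * S z = q * star z * r) := by
  have hu : S 1 ≠ 0 := by
    intro h
    have := hS 1
    rw [h] at this
    simp at this
  have hn1 : Quaternion.normSq (S 1) = 1 := by rw [hS]; simp
  set u := S 1 with hudef
  have hur := hrat 1 Hurwitz.one_mem
  rw [← hudef] at hur
  -- Right multiplication by u⁻¹ normalises the map so that it fixes 1; u is put back into the right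
  -- factor afterwards.
  obtain ⟨a, b, ha, hb, har, hbr, hT⟩ := exists_conjugation (conjMap S 1 u⁻¹)
    (fun z => by rw [conjMap_apply, one_mul, map_mul, hS, map_inv₀, hn1, inv_one, mul_one])
    (by rw [conjMap_apply, one_mul, ← hudef, mul_inv_cancel₀ hu])
    (by rw [conjMap_apply, one_mul]; exact (hrat _ qI_mem).mul hur.inv)
    (by rw [conjMap_apply, one_mul]; exact (hrat _ qJ_mem).mul hur.inv)
  obtain ⟨q, m, n, hq, hm, hn, hqa⟩ := har.exists_prm ha
  obtain ⟨r, m', n', hr, hm', hn', hrb⟩ := (hbr.mul hur).exists_prm (mul_ne_zero hb hu)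
  have key : ∀ (z w : ℍ[ℝ]), conjMap S 1 u⁻¹ z = a * w * b →
      ((n * n' : ℕ) : ℍ[ℝ]) * S z = ((m * m' : ℕ) : ℍ[ℝ]) * (q * w * r) := by
    intro z w h
    rw [conjMap_apply, one_mul] at h
    have h1 : S z = a * w * (b * u) := by
      rw [← mul_assoc, ← h, mul_assoc, inv_mul_cancel₀ hu, mul_one]
    calc ((n * n' : ℕ) : ℍ[ℝ]) * S z = (n * a) * w * (n' * (b * u)) := by
          rw [h1]
          rw [Nat.cast_mul, mul_assoc (n : ℍ[ℝ]), ← mul_assoc (n' : ℍ[ℝ]),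
            natCast_quaternion_comm n' (a * w)]
          simp only [mul_assoc]
      _ = _ := by
          rw [hqa, hrb, Nat.cast_mul m, mul_assoc (m : ℍ[ℝ]) m', ← mul_assoc (m' : ℍ[ℝ]) (q * w),
            natCast_quaternion_comm m' (q * w)]
          simp only [mul_assoc]
  have hnorm : (n * n') ^ 2 = (m * m') ^ 2 * (nrm q * nrm r) := by
    obtain ⟨w, hw, hw'⟩ : ∃ w : ℍ[ℝ], Quaternion.normSq w = 1 ∧
        conjMap S 1 u⁻¹ 1 = a * w * b := by
      rcases hT with h | h
      · exact ⟨1, by simp, h 1⟩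
      · exact ⟨star 1, by simp, h 1⟩
    have h1 := congrArg Quaternion.normSq (key 1 w hw')
    rw [map_mul, map_mul, map_mul, map_mul, hw, hn1, ← coe_nrm, ← coe_nrm,
      Quaternion.normSq_natCast, Quaternion.normSq_natCast] at h1
    apply Nat.cast_injective (R := ℝ)
    push_cast at h1 ⊢
    linarith
  have hmm : m * m' ≠ 0 := mul_ne_zero hm hm'
  -- Norms give (nn')² = (mm')²|q|²|r|², so the denominators are divisible by the contents; the
  -- quotient is c.
  obtain ⟨c, hc⟩ : m * m' ∣ n * n' := (Nat.pow_dvd_pow_iff two_ne_zero).1 ⟨_, hnorm⟩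
  have hc0 : c ≠ 0 := by
    rintro rfl
    exact mul_ne_zero hn hn' (by simpa using hc)
  have key' : ∀ (z w : ℍ[ℝ]), conjMap S 1 u⁻¹ z = a * w * b → (c : ℍ[ℝ]) * S z = q * w * r := by
    intro z w h
    have h1 := key z w h
    rw [hc, Nat.cast_mul, mul_assoc] at h1
    exact natCast_quaternion_cancel hmm h1
  refine ⟨q, r, c, hq, hr, hc0, ?_, ?_⟩
  · rw [hc, mul_pow] at hnorm
    exact (Nat.eq_of_mul_eq_mul_left (by positivity) hnorm).symm
  · rcases hT with h | h
    · exact Or.inl fun z => key' z z (h z)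
    · exact Or.inr fun z => key' z _ (h z)

/-! ### Removing the prime above two -/

/-- The Hurwitz quaternion `1 + i`. -/
noncomputable def opi : Hw := ⟨hurwitzMk 2 0 (-1) (-1), _, _, _, _, rfl⟩

theorem nrm_opi : nrm opi = 2 := by
  rw [nrm_eq_iff, Quaternion.normSq_def']
  simp [opi]
  norm_num

/-- The norm m² + m(b + c + d) + b² + c² + d² is even exactly if m and b + c + d are even, and such
elements form the ideal generated by 1 + i. -/
theorem exists_mul_opi {z : Hw} (hz : Even (nrm z)) : ∃ w, z = w * opi := by
  obtain ⟨_, m, b, c, d, rfl⟩ := z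
  have h : nrm ⟨hurwitzMk m b c d, m, b, c, d, rfl⟩ =
      m * m + m * (b + c + d) + b * b + c * c + d * d := by
    apply Int.cast_injective (α := ℝ)
    push_cast
    rw [coe_nrm, Quaternion.normSq_def']
    simp
    ring
  have h2 : Even (m * m + m * (b + c + d) + b * b + c * c + d * d) := h ▸ (Int.even_coe_nat _).2 hz
  have h3 : Even m ∧ Even (b + c + d) := by
    simp only [Int.even_add, Int.even_mul] at h2 ⊢
    tauto
  obtain ⟨⟨m', rfl⟩, ⟨s, hs⟩⟩ := h3
  refine ⟨⟨hurwitzMk (m' + m' + b) (-m') (c - m' - s) (s - b), _, _, _, _, rfl⟩, Subtype.ext ?_⟩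
  have hs' : (b + c + d : ℝ) = s + s := by exact_mod_cast hs
  have hd : (d : ℝ) = s + s - b - c := by linarith
  ext <;> simp [opi, hd] <;> ring

theorem opi_mul_conj : opi * conj opi = 2 := by
  rw [mul_conj, nrm_opi]; rfl

theorem exists_opi_mul {z : Hw} (hz : Even (nrm z)) : ∃ w, z = opi * w := by
  obtain ⟨w, hw⟩ := exists_mul_opi (z := conj z) (by rwa [nrm_conj])
  obtain ⟨v, hv⟩ : ∃ v, conj opi = opi * v :=
    ⟨⟨-qI, Hurwitz.neg_mem qI_mem⟩, Subtype.ext (by ext <;> simp [opi])⟩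
  refine ⟨v * conj w, ?_⟩
  rw [← mul_assoc, ← hv, ← conj_mul, ← hw, conj_conj]

/-- Since (1 + i)² = 2i, a second factor 1 + i would make the product divisible by 2. -/
theorem Prm.odd_of_mul_opi {q : Hw} (hq : Prm (q * opi)) : Odd (nrm q) := by
  rw [← Nat.not_even_iff_odd]
  intro h
  obtain ⟨w, rfl⟩ := exists_mul_opi h
  have h2 : ((2 : ℕ) : Hw) ∣ w * opi * opi := by
    obtain ⟨v, hv⟩ : ∃ v, opi * opi = v + v :=
      ⟨⟨qI, qI_mem⟩, Subtype.ext (by ext <;> simp [opi])⟩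
    rw [mul_assoc, hv]
    exact ⟨w * v, by rw [Nat.cast_two, two_mul, mul_add]⟩
  exact absurd (hq 2 h2) (by norm_num)

/-- H(1 + i) = (1 + i)H, hence (1 + i)H(1 - i) = 2H. -/
theorem lat_mul_opi {q r : Hw} {c : ℕ} : lat (q * opi) (r * opi) (2 * c) = lat q r c := by
  have hc : conj opi * opi = 2 := by rw [conj_mul_self, nrm_opi]; rfl
  have h2 : ∀ z : Hw, z * 2 = 2 * z := fun z => (natCast_comm 2 z).symm
  have h1 : ∀ z, q * opi * z * conj (r * opi) = q * (opi * z * conj opi) * conj r := by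
    intro z; simp only [conj_mul, mul_assoc]
  ext x
  rw [mem_lat, mem_lat]
  constructor
  · rintro ⟨z, hz⟩
    obtain ⟨w, hw⟩ := exists_mul_opi (z := opi * z) (by rw [nrm_mul, nrm_opi]; exact even_two_mul _)
    refine ⟨w, natCast_quaternion_cancel two_ne_zero ?_⟩
    rw [← mul_assoc, ← Nat.cast_mul, hz, h1, hw, mul_assoc w, opi_mul_conj, h2 w, ← mul_assoc q,
      h2 q]
    simp only [mul_assoc]
    rfl
  · rintro ⟨z, hz⟩
    obtain ⟨w, hw⟩ := exists_opi_mul (z := z * opi)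
      (by rw [nrm_mul, nrm_opi]; exact even_two.mul_left _)
    refine ⟨w, ?_⟩
    rw [h1, ← hw, mul_assoc z, opi_mul_conj, h2 z, ← mul_assoc q, h2 q, Nat.cast_mul, mul_assoc, hz]
    simp only [mul_assoc]
    rfl

/-- Lattices attached to primitive pairs are attached to primitive pairs of odd norm. -/
theorem exists_odd_pair {q r : Hw} {c : ℕ} (hq : Prm q) (hr : Prm r)
    (h : nrm q * nrm r = c ^ 2) : ∃ (q' r' : Hw) (c' : ℕ), Prm q' ∧ Prm r' ∧ Odd c' ∧
      nrm q' * nrm r' = c' ^ 2 ∧ lat q r c = lat q' r' c' := by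
  by_cases hodd : Odd c
  · exact ⟨q, r, c, hq, hr, hodd, h, rfl⟩
  rw [Nat.not_odd_iff_even] at hodd
  obtain ⟨c', hc'⟩ := hodd.two_dvd
  have key : ∀ {q r : Hw}, Prm q → nrm q * nrm r = c ^ 2 → Even (nrm r) := by
    intro q r hq h
    rw [← Nat.not_odd_iff_even]
    intro ho
    have hev : Even (nrm q) := by
      have : Even (nrm q * nrm r) := h ▸ hodd.pow_of_ne_zero two_ne_zero
      rcases Nat.even_mul.1 this with h | h
      · exact h
      · exact absurd ho (Nat.not_odd_iff_even.2 h)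
    obtain ⟨w, rfl⟩ := exists_mul_opi hev
    have hw := hq.odd_of_mul_opi
    rw [nrm_mul, nrm_opi, hc'] at h
    -- If |r|² were odd, q would carry a single factor 1 + i, and an odd product would equal 2c'².
    -- So for even c both norms are even.
    have h3 : nrm w * nrm r = 2 * c' ^ 2 := by nlinarith
    exact (Nat.not_even_iff_odd.2 (hw.mul ho)) (h3 ▸ even_two_mul _)
  obtain ⟨q', rfl⟩ := exists_mul_opi (key hr ((mul_comm _ _).trans h))
  obtain ⟨r', rfl⟩ := exists_mul_opi (key hq h)
  have h4 : nrm q' * nrm r' = c' ^ 2 := by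
    rw [nrm_mul, nrm_mul, nrm_opi, hc'] at h
    nlinarith
  refine ⟨q', r', c', hq.of_mul_left, hr.of_mul_left, ?_, h4, by rw [hc', lat_mul_opi]⟩
  have h5 := hq.odd_of_mul_opi.mul hr.odd_of_mul_opi
  rw [h4, Nat.odd_pow_iff two_ne_zero] at h5
  exact h5

/-! ### Generalities on coincidence isometries and symmetry classes -/

section Isometries

variable {V : Type*} [NormedAddCommGroup V] [InnerProductSpace ℝ V]

theorem inv_apply_self (R : V ≃ₗᵢ[ℝ] V) (x : V) : R⁻¹ (R x) = x := R.symm_apply_apply x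

theorem apply_inv_self (R : V ≃ₗᵢ[ℝ] V) (x : V) : R (R⁻¹ x) = x := R.apply_symm_apply x

theorem mem_image_iff {R : V ≃ₗᵢ[ℝ] V} {Γ : AddSubgroup V} {x : V} :
    x ∈ image R Γ ↔ R⁻¹ x ∈ Γ := by
  rw [mem_image]
  constructor
  · rintro ⟨y, hy, rfl⟩; rwa [inv_apply_self]
  · exact fun h => ⟨_, h, apply_inv_self R x⟩

theorem mem_pointGroup {Γ : AddSubgroup V} {Q : V ≃ₗᵢ[ℝ] V} :
    Q ∈ pointGroup Γ ↔ image Q Γ = Γ := Iff.rfl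

theorem image_mono {R : V ≃ₗᵢ[ℝ] V} {Γ Γ' : AddSubgroup V} (h : Γ ≤ Γ') :
    image R Γ ≤ image R Γ' := AddSubgroup.map_mono h

theorem image_injective (R : V ≃ₗᵢ[ℝ] V) : Function.Injective (image R) := by
  intro Γ Γ' h
  rw [← image_one Γ, ← image_one Γ', ← inv_mul_cancel R, image_mul, image_mul, h]

theorem relIndex_image (R : V ≃ₗᵢ[ℝ] V) (Γ Γ' : AddSubgroup V) :
    (image R Γ).relIndex (image R Γ') = Γ.relIndex Γ' :=
  AddSubgroup.relIndex_map_map_of_injective Γ Γ' R.injective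

theorem image_mul_of_mem {R Q : V ≃ₗᵢ[ℝ] V} {Γ : AddSubgroup V} (hQ : Q ∈ pointGroup Γ) :
    image (R * Q) Γ = image R Γ := by
  rw [image_mul, mem_pointGroup.1 hQ]

theorem image_eq_image_iff {R S : V ≃ₗᵢ[ℝ] V} {Γ : AddSubgroup V} :
    image R Γ = image S Γ ↔ R⁻¹ * S ∈ pointGroup Γ := by
  rw [mem_pointGroup, image_mul]
  constructor
  · intro h; rw [← h, ← image_mul, inv_mul_cancel, image_one]
  · intro h; conv_lhs => rw [← h, ← image_mul, mul_inv_cancel, image_one]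

theorem coincIndex_eq_relIndex (Γ : AddSubgroup V) (R : V ≃ₗᵢ[ℝ] V) :
    coincIndex Γ R = (image R Γ).relIndex Γ := AddSubgroup.inf_relIndex_left _ _

theorem mem_OC {Γ : AddSubgroup V} {R : V ≃ₗᵢ[ℝ] V} : R ∈ OC Γ ↔ coincIndex Γ R ≠ 0 := Iff.rfl

theorem csl_congr {Γ : AddSubgroup V} {R S : V ≃ₗᵢ[ℝ] V} (h : image R Γ = image S Γ) :
    csl Γ R = csl Γ S := by rw [csl, csl, h]

theorem coincIndex_congr {Γ : AddSubgroup V} {R S : V ≃ₗᵢ[ℝ] V} (h : image R Γ = image S Γ) :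
    coincIndex Γ R = coincIndex Γ S := by rw [coincIndex, coincIndex, csl_congr h]

theorem coincIndex_mul {Γ : AddSubgroup V} {R Q : V ≃ₗᵢ[ℝ] V} (hQ : Q ∈ pointGroup Γ) :
    coincIndex Γ (R * Q) = coincIndex Γ R := coincIndex_congr (image_mul_of_mem hQ)

theorem coincIndex_eq_one {Γ : AddSubgroup V} {Q : V ≃ₗᵢ[ℝ] V} (hQ : Q ∈ pointGroup Γ) :
    coincIndex Γ Q = 1 := by
  rw [coincIndex_eq_relIndex, mem_pointGroup.1 hQ, AddSubgroup.relIndex_self]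

theorem mem_OC_of_mem_rotationsOfIndex {Γ : AddSubgroup V} {n : ℕ} {R : V ≃ₗᵢ[ℝ] V} :
    R ∈ rotationsOfIndex Γ n ↔ n ≠ 0 ∧ IsRotation R ∧ coincIndex Γ R = n := by
  constructor
  · rintro ⟨⟨h1, h2⟩, rfl⟩; exact ⟨h1, h2, rfl⟩
  · rintro ⟨h1, h2, rfl⟩; exact ⟨⟨h1, h2⟩, rfl⟩

/-- Sublattices of finite index have the same coincidence isometries. -/
theorem OC_eq_of_relIndex_ne_zero {Γ Γ' : AddSubgroup V} (hle : Γ ≤ Γ') (h : Γ.relIndex Γ' ≠ 0) :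
    OC Γ = OC Γ' := by
  ext R
  rw [mem_OC, mem_OC, coincIndex_eq_relIndex, coincIndex_eq_relIndex]
  constructor
  · intro h1 h0
    exact AddSubgroup.relIndex_ne_zero_trans h1 h
      (AddSubgroup.relIndex_eq_zero_of_le_left (image_mono hle) h0)
  · intro h1 h0
    rw [← relIndex_image R] at h
    exact AddSubgroup.relIndex_ne_zero_trans h h1
      (AddSubgroup.relIndex_eq_zero_of_le_right hle h0)

theorem IsRotation.mul {R S : V ≃ₗᵢ[ℝ] V} (hR : IsRotation R) (hS : IsRotation S) :
    IsRotation (R * S) := by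
  have : ((R * S).toLinearEquiv : V →ₗ[ℝ] V) =
      (R.toLinearEquiv : V →ₗ[ℝ] V) * (S.toLinearEquiv : V →ₗ[ℝ] V) := rfl
  rw [IsRotation, this, map_mul, hR, hS, one_mul]

theorem isRotation_one : IsRotation (1 : V ≃ₗᵢ[ℝ] V) := by
  have : ((1 : V ≃ₗᵢ[ℝ] V).toLinearEquiv : V →ₗ[ℝ] V) = 1 := rfl
  rw [IsRotation, this, map_one]

/-- The determinant as a homomorphism on linear isometries. -/
noncomputable def isoDet : (V ≃ₗᵢ[ℝ] V) →* ℝ where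
  toFun R := LinearMap.det (R.toLinearEquiv : V →ₗ[ℝ] V)
  map_one' := isRotation_one
  map_mul' R S := map_mul LinearMap.det (R.toLinearEquiv : V →ₗ[ℝ] V)
    (S.toLinearEquiv : V →ₗ[ℝ] V)

theorem isRotation_iff {R : V ≃ₗᵢ[ℝ] V} : IsRotation R ↔ isoDet R = 1 := Iff.rfl

theorem isoDet_inv (R : V ≃ₗᵢ[ℝ] V) : isoDet R⁻¹ = (isoDet R)⁻¹ :=
  eq_inv_of_mul_eq_one_left (by rw [← map_mul, inv_mul_cancel, map_one])

theorem IsRotation.inv {R : V ≃ₗᵢ[ℝ] V} (hR : IsRotation R) : IsRotation R⁻¹ := by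
  rw [isRotation_iff] at *
  rw [isoDet_inv, hR, inv_one]

/-- A class is recorded by the image lattice RΓ, which right multiplication by the point group
leaves unchanged. All counts of classes become counts of lattices. -/
theorem symClass_eq_iff {Γ : AddSubgroup V} {R S : V ≃ₗᵢ[ℝ] V}
    (hS : IsRotation S) : symClass Γ R = symClass Γ S ↔ image R Γ = image S Γ := by
  constructor
  · intro h
    have h1 : S ∈ symClass Γ R := h ▸ ⟨hS, 1, one_mem _, (mul_one S).symm⟩
    obtain ⟨-, Q, hQ, rfl⟩ := h1
    exact (image_mul_of_mem hQ).symm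
  · intro h
    ext T
    simp only [symClass, Set.mem_ofPred_eq]
    have key : ∀ {R S : V ≃ₗᵢ[ℝ] V}, image R Γ = image S Γ → (∃ Q ∈ pointGroup Γ, T = R * Q) →
        ∃ Q ∈ pointGroup Γ, T = S * Q := by
      rintro R S h ⟨Q, hQ, rfl⟩
      exact ⟨S⁻¹ * R * Q, mul_mem (image_eq_image_iff.1 h.symm) hQ, by group⟩
    exact ⟨fun ⟨h1, h2⟩ => ⟨h1, key h h2⟩, fun ⟨h1, h2⟩ => ⟨h1, key h.symm h2⟩⟩

theorem mem_symClass_iff {Γ : AddSubgroup V} {R S : V ≃ₗᵢ[ℝ] V} :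
    S ∈ symClass Γ R ↔ IsRotation S ∧ image S Γ = image R Γ := by
  constructor
  · rintro ⟨h1, Q, hQ, rfl⟩
    exact ⟨h1, image_mul_of_mem hQ⟩
  · rintro ⟨h1, h2⟩
    exact ⟨h1, _, image_eq_image_iff.1 h2.symm, by group⟩

/-- The images of `Γ` under the coincidence rotations of index `n`. -/
def rotationImages (Γ : AddSubgroup V) (n : ℕ) : Set (AddSubgroup V) :=
  (fun R => image R Γ) '' rotationsOfIndex Γ n

theorem fRot_eq_ncard (Γ : AddSubgroup V) (n : ℕ) : fRot Γ n = (rotationImages Γ n).ncard := by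
  choose! g hg using fun (L : AddSubgroup V) (hL : L ∈ rotationImages Γ n) => hL
  have : {C | ∃ R ∈ rotationsOfIndex Γ n, C = symClass Γ R} =
      (fun L => symClass Γ (g L)) '' rotationImages Γ n := by
    ext C
    constructor
    · rintro ⟨R, hR, rfl⟩
      have h := hg _ (Set.mem_image_of_mem _ hR)
      exact ⟨_, Set.mem_image_of_mem _ hR, (symClass_eq_iff hR.1.2).2 h.2⟩
    · rintro ⟨L, hL, rfl⟩
      exact ⟨_, (hg L hL).1, rfl⟩
  rw [fRot, this, Set.InjOn.ncard_image]
  intro L hL L' hL' h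
  have h1 := hg _ hL
  have h2 := hg _ hL'
  have := (symClass_eq_iff h2.1.1.2).1 h
  exact (h1.2.symm.trans this).trans h2.2

/-- The rotations in P(Γ) act freely from the right, with one orbit for each image lattice; a chosen
rotation in each orbit gives a bijection with a product. -/
theorem ncard_rotationsOfIndex {Γ : AddSubgroup V} {n k : ℕ} (hk : k ≠ 0)
    (hP : {Q | Q ∈ pointGroup Γ ∧ IsRotation Q}.ncard = k) (hfin : (rotationImages Γ n).Finite) :
    (rotationsOfIndex Γ n).Finite ∧ (rotationsOfIndex Γ n).ncard = k * fRot Γ n := by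
  have hPfin : {Q | Q ∈ pointGroup Γ ∧ IsRotation Q}.Finite :=
    Set.finite_of_ncard_ne_zero (hP ▸ hk)
  choose! g hg using fun (L : AddSubgroup V) (hL : L ∈ rotationImages Γ n) => hL
  have himg : rotationsOfIndex Γ n = (fun x : (V ≃ₗᵢ[ℝ] V) × AddSubgroup V => g x.2 * x.1) ''
      ({Q | Q ∈ pointGroup Γ ∧ IsRotation Q} ×ˢ rotationImages Γ n) := by
    ext R
    constructor
    · intro hR
      have h := hg _ (Set.mem_image_of_mem _ hR)
      refine ⟨((g (image R Γ))⁻¹ * R, image R Γ), ⟨⟨image_eq_image_iff.1 h.2, ?_⟩,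
        Set.mem_image_of_mem _ hR⟩, by simp⟩
      exact h.1.1.2.inv.mul hR.1.2
    · rintro ⟨⟨Q, L⟩, ⟨⟨hQ, hQ'⟩, hL⟩, rfl⟩
      obtain ⟨h1, h2, h3⟩ := mem_OC_of_mem_rotationsOfIndex.1 (hg _ hL).1
      exact mem_OC_of_mem_rotationsOfIndex.2 ⟨h1, h2.mul hQ', by rw [coincIndex_mul hQ, h3]⟩
  rw [himg]
  refine ⟨(hPfin.prod hfin).image _, ?_⟩
  rw [Set.InjOn.ncard_image, Set.ncard_prod, hP, fRot_eq_ncard]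
  rintro ⟨Q, L⟩ ⟨⟨hQ, hQ'⟩, hL⟩ ⟨Q', L'⟩ ⟨⟨hP, hP'⟩, hL'⟩ h
  dsimp only at *
  have : L = L' := by
    have h1 := (hg _ hL).2
    have h2 := (hg _ hL').2
    rw [← h1, ← h2, ← image_mul_of_mem hQ, h, image_mul_of_mem hP]
  subst this
  rw [mul_left_cancel h]

variable [FiniteDimensional ℝ V]

theorem isoDet_mul_self (R : V ≃ₗᵢ[ℝ] V) : isoDet R * isoDet R = 1 := by
  let b := stdOrthonormalBasis ℝ V
  have h := b.det_to_matrix_orthonormalBasis_real (b.map R)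
  have h2 := b.toBasis.det_comp (R.toLinearEquiv : V →ₗ[ℝ] V) b.toBasis
  rw [b.toBasis.det_self, mul_one] at h2
  have h3 : (⇑(b.map R) : Fin (Module.finrank ℝ V) → V) =
      ⇑(R.toLinearEquiv : V →ₗ[ℝ] V) ∘ ⇑b.toBasis := by ext; simp
  rw [h3, h2] at h
  exact mul_self_eq_one_iff.2 h

/-- An orientation reversing symmetry Q of Γ turns any isometry into a rotation with the same image,
so the restriction to determinant one costs nothing. -/
theorem rotationImages_eq {Γ : AddSubgroup V} {Q : V ≃ₗᵢ[ℝ] V} (hQ : Q ∈ pointGroup Γ)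
    (hdet : isoDet Q = -1) (n : ℕ) :
    rotationImages Γ n = {L | n ≠ 0 ∧ ∃ R, coincIndex Γ R = n ∧ L = image R Γ} := by
  ext L
  constructor
  · rintro ⟨R, hR, rfl⟩
    obtain ⟨h1, h2, h3⟩ := mem_OC_of_mem_rotationsOfIndex.1 hR
    exact ⟨h1, R, h3, rfl⟩
  · rintro ⟨h1, R, h2, rfl⟩
    rcases mul_self_eq_one_iff.1 (isoDet_mul_self R) with h | h
    · exact ⟨R, mem_OC_of_mem_rotationsOfIndex.2 ⟨h1, h, h2⟩, rfl⟩
    · refine ⟨R * Q, mem_OC_of_mem_rotationsOfIndex.2 ⟨h1, ?_, ?_⟩, image_mul_of_mem hQ⟩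
      · rw [isRotation_iff, map_mul, h, hdet]; norm_num
      · rw [coincIndex_mul hQ, h2]

theorem ncard_rotations_pointGroup {G : Subgroup (V ≃ₗᵢ[ℝ] V)} {Q : V ≃ₗᵢ[ℝ] V} (hQ : Q ∈ G)
    (hdet : isoDet Q = -1) {k : ℕ} (hk : Nat.card G = 2 * k) (hk0 : k ≠ 0) :
    {Q | Q ∈ G ∧ IsRotation Q}.ncard = k := by
  have hG : (G : Set (V ≃ₗᵢ[ℝ] V)).Finite := by
    have : Finite G := Nat.finite_of_card_ne_zero (by omega)
    exact Set.toFinite _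
  have hsplit : (G : Set (V ≃ₗᵢ[ℝ] V)) = {Q | Q ∈ G ∧ IsRotation Q} ∪
      (Q * ·) '' {Q | Q ∈ G ∧ IsRotation Q} := by
    ext R
    constructor
    · intro hR
      rcases mul_self_eq_one_iff.1 (isoDet_mul_self R) with h | h
      · exact Or.inl ⟨hR, h⟩
      · refine Or.inr ⟨Q⁻¹ * R, ⟨mul_mem (inv_mem hQ) hR, ?_⟩, by simp⟩
        rw [isRotation_iff, map_mul, isoDet_inv, h, hdet]; norm_num
    · rintro (h | ⟨S, h, rfl⟩)
      · exact h.1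
      · exact mul_mem hQ h.1
  have hdisj : Disjoint {Q | Q ∈ G ∧ IsRotation Q} ((Q * ·) '' {Q | Q ∈ G ∧ IsRotation Q}) := by
    rw [Set.disjoint_left]
    rintro R ⟨-, h⟩ ⟨S, ⟨-, hS⟩, rfl⟩
    rw [isRotation_iff] at h hS
    rw [map_mul, hS, hdet] at h
    norm_num at h
  have hsub : {Q | Q ∈ G ∧ IsRotation Q}.Finite := hG.subset fun R h => h.1
  have := congrArg Set.ncard hsplit
  rw [Set.ncard_union_eq hdisj hsub (hsub.image _),
    Set.ncard_image_of_injective _ (mul_right_injective Q)] at this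
  have h2 : (G : Set (V ≃ₗᵢ[ℝ] V)).ncard = 2 * k := hk
  omega

end Isometries

/-! ### Transport to ℝ⁴ and normal form of the images of D₄* -/

/-- The additive subgroup of `E4` corresponding to an additive subgroup of the quaternions. -/
noncomputable def toE4 (A : AddSubgroup ℍ[ℝ]) : AddSubgroup E4 :=
  A.map (Quaternion.linearIsometryEquivTuple.toLinearEquiv : ℍ[ℝ] →ₗ[ℝ] E4).toAddMonoidHom

/-- The coordinate isometry. -/
noncomputable abbrev eQ : ℍ[ℝ] ≃ₗᵢ[ℝ] E4 := Quaternion.linearIsometryEquivTuple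

theorem mem_toE4 {A : AddSubgroup ℍ[ℝ]} {x : E4} : x ∈ toE4 A ↔ eQ.symm x ∈ A := by
  constructor
  · rintro ⟨y, hy, rfl⟩
    have : eQ.symm (eQ y) = y := eQ.symm_apply_apply y
    exact this.symm ▸ hy
  · exact fun h => ⟨_, h, eQ.apply_symm_apply x⟩

theorem eQ_mem_toE4 {A : AddSubgroup ℍ[ℝ]} {x : ℍ[ℝ]} : eQ x ∈ toE4 A ↔ x ∈ A := by
  rw [mem_toE4, eQ.symm_apply_apply]

theorem toE4_injective : Function.Injective toE4 := by
  intro A B h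
  ext x
  rw [← eQ_mem_toE4, h, eQ_mem_toE4]

theorem relIndex_toE4 (A B : AddSubgroup ℍ[ℝ]) : (toE4 A).relIndex (toE4 B) = A.relIndex B :=
  AddSubgroup.relIndex_map_map_of_injective A B eQ.injective

theorem eQ_apply (x : ℍ[ℝ]) : eQ x = !₂[x.re, x.imI, x.imJ, x.imK] := rfl

theorem D4s_eq : D4s = toE4 Hurwitz.toAddSubgroup := by
  apply le_antisymm
  · rw [D4s, AddSubgroup.closure_le]
    rintro x (rfl | rfl | rfl | rfl)
    · exact ⟨hurwitzMk 2 (-1) (-1) (-1), ⟨_, _, _, _, rfl⟩, by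
        refine (eQ_apply _).trans ?_; ext i; fin_cases i <;> simp⟩
    · exact ⟨hurwitzMk 0 1 0 0, ⟨_, _, _, _, rfl⟩, by
        refine (eQ_apply _).trans ?_; ext i; fin_cases i <;> simp⟩
    · exact ⟨hurwitzMk 0 0 1 0, ⟨_, _, _, _, rfl⟩, by
        refine (eQ_apply _).trans ?_; ext i; fin_cases i <;> simp⟩
    · exact ⟨hurwitzMk 1 0 0 0, ⟨_, _, _, _, rfl⟩, by
        refine (eQ_apply _).trans ?_; ext i; fin_cases i <;> simp⟩
  · rintro _ ⟨_, ⟨m, b, c, d, rfl⟩, rfl⟩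
    have : eQ (hurwitzMk m b c d) =
        (m + 2 * d) • !₂[1 / 2, 1 / 2, 1 / 2, 1 / 2] - d • !₂[1, 0, 0, 0] +
          (b - d) • !₂[0, 1, 0, 0] + (c - d) • !₂[0, 0, 1, 0] := by
      rw [eQ_apply]
      ext i
      fin_cases i <;> simp <;> ring
    change eQ (hurwitzMk m b c d) ∈ D4s
    rw [this]
    refine add_mem (add_mem (sub_mem (zsmul_mem ?_ _) (zsmul_mem ?_ _)) (zsmul_mem ?_ _))
      (zsmul_mem ?_ _) <;> exact AddSubgroup.subset_closure (by simp)

theorem mem_D4s {x : E4} : x ∈ D4s ↔ eQ.symm x ∈ Hurwitz := by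
  rw [D4s_eq, mem_toE4]; rfl

theorem eQ_mem_D4s {x : ℍ[ℝ]} : eQ x ∈ D4s ↔ x ∈ Hurwitz := by
  rw [mem_D4s, eQ.symm_apply_apply]

/-- The isometry `x ↦ q x r`. -/
noncomputable def mulIso (q r : ℍ[ℝ]) (h : Quaternion.normSq q * Quaternion.normSq r = 1) :
    E4 ≃ₗᵢ[ℝ] E4 :=
  LinearIsometry.toLinearIsometryEquiv
    { toLinearMap := (eQ.toLinearEquiv : ℍ[ℝ] →ₗ[ℝ] E4) ∘ₗ LinearMap.mulLeft ℝ q ∘ₗ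
        LinearMap.mulRight ℝ r ∘ₗ (eQ.symm.toLinearEquiv : E4 →ₗ[ℝ] ℍ[ℝ])
      norm_map' := fun x => by
        change ‖eQ (q * (eQ.symm x * r))‖ = ‖x‖
        have h1 : ‖q‖ * ‖r‖ = 1 := by
          rw [Quaternion.normSq_eq_norm_mul_self, Quaternion.normSq_eq_norm_mul_self] at h
          have h2 : (‖q‖ * ‖r‖) * (‖q‖ * ‖r‖) = 1 := by linear_combination h
          rcases mul_self_eq_one_iff.1 h2 with h3 | h3
          · exact h3
          · have := mul_nonneg (norm_nonneg q) (norm_nonneg r)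
            linarith
        rw [eQ.norm_map, norm_mul, norm_mul, eQ.symm.norm_map]
        linear_combination ‖x‖ * h1 } rfl

theorem mulIso_apply (q r : ℍ[ℝ]) (h : Quaternion.normSq q * Quaternion.normSq r = 1) (x : E4) :
    mulIso q r h x = eQ (q * eQ.symm x * r) := by rw [mul_assoc]; rfl

/-- The intersection of the Hurwitz order with `lat q r c`. -/
theorem inf_lat {q r : Hw} {c : ℕ} (hc : c ≠ 0) (h : nrm q * nrm r = c ^ 2) :
    Hurwitz.toAddSubgroup ⊓ lat q r c =
      (cslSub c q r).map (Hurwitz.subtype : Hw →+ ℍ[ℝ]) := by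
  ext x
  simp only [AddSubgroup.mem_inf, AddSubgroup.mem_map]
  constructor
  · rintro ⟨h1, h2⟩
    exact ⟨⟨x, h1⟩, (coe_mem_lat hc h).1 h2, rfl⟩
  · rintro ⟨z, hz, rfl⟩
    exact ⟨z.2, (coe_mem_lat hc h).2 hz⟩

/-- The additive subgroup of `E4` corresponding to an additive subgroup of the Hurwitz order. -/
noncomputable def subE4 (A : AddSubgroup Hw) : AddSubgroup E4 :=
  toE4 (A.map (Hurwitz.subtype : Hw →+ ℍ[ℝ]))

theorem subE4_injective : Function.Injective subE4 := fun _ _ h =>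
  AddSubgroup.map_injective Subtype.val_injective (toE4_injective h)

theorem relIndex_subE4 (A : AddSubgroup Hw) : (subE4 A).relIndex D4s = A.index := by
  rw [subE4, D4s_eq, relIndex_toE4]
  have : Hurwitz.toAddSubgroup = (⊤ : AddSubgroup Hw).map (Hurwitz.subtype : Hw →+ ℍ[ℝ]) := by
    ext x
    simp only [AddSubgroup.mem_map]
    exact ⟨fun h => ⟨⟨x, h⟩, trivial, rfl⟩, by rintro ⟨y, -, rfl⟩; exact y.2⟩
  rw [this, AddSubgroup.relIndex_map_map_of_injective _ _ Subtype.val_injective,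
    AddSubgroup.relIndex_top_right]

theorem csl_of_image {R : E4 ≃ₗᵢ[ℝ] E4} {q r : Hw} {c : ℕ} (hc : c ≠ 0)
    (h : nrm q * nrm r = c ^ 2) (hR : image R D4s = toE4 (lat q r c)) :
    csl D4s R = subE4 (cslSub c q r) := by
  rw [csl, hR, D4s_eq, subE4, ← inf_lat hc h]
  ext x
  simp only [AddSubgroup.mem_inf, mem_toE4]

/-- Two numbers whose product is a square. -/
theorem exists_square_factors {a b c : ℕ} (hc : c ≠ 0) (h : a * b = c ^ 2) :
    ∃ g x y, x.Coprime y ∧ a = g * x ^ 2 ∧ b = g * y ^ 2 ∧ c = g * x * y := by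
  have ha : a ≠ 0 := by rintro rfl; exact hc (pow_eq_zero_iff two_ne_zero |>.1 (by rw [← h, zero_mul]))
  obtain ⟨g, hg⟩ : ∃ g, g = a.gcd b := ⟨_, rfl⟩
  have hg0 : 0 < g := hg ▸ Nat.gcd_pos_of_pos_left _ (Nat.pos_of_ne_zero ha)
  obtain ⟨a', ha'⟩ : g ∣ a := hg ▸ Nat.gcd_dvd_left a b
  obtain ⟨b', hb'⟩ : g ∣ b := hg ▸ Nat.gcd_dvd_right a b
  have hcop : a'.Coprime b' := by
    have := Nat.coprime_div_gcd_div_gcd (m := a) (n := b) (hg ▸ hg0)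
    rwa [← hg, ha', hb', Nat.mul_div_cancel_left _ hg0, Nat.mul_div_cancel_left _ hg0] at this
  obtain ⟨c', rfl⟩ : g ∣ c := (Nat.pow_dvd_pow_iff two_ne_zero).1
    ⟨a' * b', by rw [← h, ha', hb']; ring⟩
  have h2 : a' * b' = c' ^ 2 := by
    have : (g ^ 2) * (a' * b') = g ^ 2 * c' ^ 2 := by rw [ha', hb'] at h; linarith
    exact Nat.eq_of_mul_eq_mul_left (pow_pos hg0 2) this
  obtain ⟨x, hx⟩ := exists_eq_pow_of_mul_eq_pow (Nat.isUnit_iff.2 hcop) h2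
  obtain ⟨y, hy⟩ := exists_eq_pow_of_mul_eq_pow (Nat.isUnit_iff.2 hcop.symm)
    ((mul_comm _ _).trans h2)
  subst hx hy
  refine ⟨g, x, y, (Nat.coprime_pow_left_iff two_pos _ _).1
    ((Nat.coprime_pow_right_iff two_pos _ _).1 hcop), ha', hb', ?_⟩
  rw [mul_assoc]
  congr 1
  rw [← mul_pow] at h2
  exact (Nat.pow_left_injective two_ne_zero h2).symm

/-- Finite index makes R⁻¹ rational on H, so `exists_prm_pair` applies to it. Solving c R⁻¹x = q x r
for x replaces q and r by their conjugates; for the type with x̄ the two sides are moreover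
exchanged. -/
theorem exists_lat_of_mem_OC {R : E4 ≃ₗᵢ[ℝ] E4} (hR : R ∈ OC D4s) :
    ∃ (q r : Hw) (c : ℕ), Prm q ∧ Prm r ∧ c ≠ 0 ∧ nrm q * nrm r = c ^ 2 ∧
      image R D4s = toE4 (lat q r c) := by
  let S : ℍ[ℝ] →ₗ[ℝ] ℍ[ℝ] := (eQ.symm.toLinearEquiv : E4 →ₗ[ℝ] ℍ[ℝ]) ∘ₗ
    (R.symm.toLinearEquiv : E4 →ₗ[ℝ] E4) ∘ₗ (eQ.toLinearEquiv : ℍ[ℝ] →ₗ[ℝ] E4)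
  have hSapp : ∀ z, S z = eQ.symm (R⁻¹ (eQ z)) := fun z => rfl
  have hS : ∀ z, Quaternion.normSq (S z) = Quaternion.normSq z := by
    intro z
    rw [Quaternion.normSq_eq_norm_mul_self, Quaternion.normSq_eq_norm_mul_self, hSapp,
      eQ.symm.norm_map, (R⁻¹).norm_map, eQ.norm_map]
  have hrat : ∀ z ∈ Hurwitz, IsRat (S z) := by
    intro z hz
    rw [mem_OC, coincIndex_eq_relIndex] at hR
    obtain ⟨n, hn, -, h⟩ := AddSubgroup.exists_nsmul_mem_of_relIndex_ne_zero hR (eQ_mem_D4s.2 hz)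
    refine ⟨n, hn.ne', ?_⟩
    rw [← map_nsmul] at h
    replace h := mem_image_iff.1 h.1
    have h2 := mem_D4s.1 h
    rw [← hSapp, map_nsmul, nsmul_eq_mul] at h2
    exact h2
  obtain ⟨q, r, c, hq, hr, hc, hn, h⟩ := exists_prm_pair S hS hrat
  have hmem : ∀ x, eQ x ∈ image R D4s ↔ S x ∈ Hurwitz := by
    intro x
    rw [mem_image_iff, mem_D4s, hSapp]
  have hmulq : ∀ q : Hw, (q : ℍ[ℝ]) * star (q : ℍ[ℝ]) = (nrm q : ℍ[ℝ]) := fun q => by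
    have := congrArg Subtype.val (mul_conj q); simpa using this
  have hmulq' : ∀ q : Hw, star (q : ℍ[ℝ]) * (q : ℍ[ℝ]) = (nrm q : ℍ[ℝ]) := fun q => by
    have := congrArg Subtype.val (conj_mul_self q); simpa using this
  have hab' : (nrm q : ℍ[ℝ]) * (nrm r : ℍ[ℝ]) = c * c := by
    rw [← Nat.cast_mul, hn, sq, Nat.cast_mul]
  have key : ∀ x w : ℍ[ℝ], (c : ℍ[ℝ]) * w = q * x * r ↔
      (c : ℍ[ℝ]) * x = star (q : ℍ[ℝ]) * w * star (r : ℍ[ℝ]) := by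
    intro x w
    constructor
    · intro h
      apply natCast_quaternion_cancel hc
      calc (c : ℍ[ℝ]) * (c * x) = (nrm q : ℍ[ℝ]) * (nrm r : ℍ[ℝ]) * x := by rw [hab', mul_assoc]
        _ = star (q : ℍ[ℝ]) * (q * x * r) * star (r : ℍ[ℝ]) := by
          rw [mul_assoc, natCast_quaternion_comm (nrm r), ← hmulq r, ← hmulq' q]
          simp only [mul_assoc]
        _ = _ := by
          rw [← h, ← mul_assoc _ (c : ℍ[ℝ]), ← natCast_quaternion_comm]; simp only [mul_assoc]
    · intro h
      apply natCast_quaternion_cancel hc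
      calc (c : ℍ[ℝ]) * (c * w) = (nrm q : ℍ[ℝ]) * (nrm r : ℍ[ℝ]) * w := by rw [hab', mul_assoc]
        _ = q * (star (q : ℍ[ℝ]) * w * star (r : ℍ[ℝ])) * r := by
          rw [mul_assoc, natCast_quaternion_comm (nrm r), ← hmulq' r, ← hmulq q]
          simp only [mul_assoc]
        _ = _ := by
          rw [← h, ← mul_assoc _ (c : ℍ[ℝ]), ← natCast_quaternion_comm]; simp only [mul_assoc]
  rcases h with h | h
  · refine ⟨conj q, r, c, hq.conj, hr, hc, by rwa [nrm_conj], ?_⟩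
    ext x
    obtain ⟨x, rfl⟩ := eQ.surjective x
    rw [hmem, eQ_mem_toE4, mem_lat]
    have h1 := (key x (S x)).1 (h x)
    constructor
    · exact fun hx => ⟨⟨S x, hx⟩, by simpa using h1⟩
    · rintro ⟨z, hz⟩
      have h2 : (c : ℍ[ℝ]) * z = q * x * r := (key x z).2 (by simpa using hz)
      rw [← h x] at h2
      rw [← natCast_quaternion_cancel hc h2]
      exact z.2
  · refine ⟨r, conj q, c, hr, hq.conj, hc, by rwa [nrm_conj, mul_comm], ?_⟩
    ext x
    obtain ⟨x, rfl⟩ := eQ.surjective x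
    rw [hmem, eQ_mem_toE4, ← star_star x, star_mem_lat, mem_lat, star_star]
    have h1 := (key (star x) (S x)).1 (h x)
    constructor
    · exact fun hx => ⟨⟨S x, hx⟩, by simpa using h1⟩
    · rintro ⟨z, hz⟩
      have h2 : (c : ℍ[ℝ]) * z = q * star x * r := (key _ z).2 (by simpa using hz)
      rw [← h x] at h2
      rw [← natCast_quaternion_cancel hc h2]
      exact z.2

theorem exists_iso_of_prm {q r : Hw} {c : ℕ} (hc : c ≠ 0) (h : nrm q * nrm r = c ^ 2) :
    ∃ R : E4 ≃ₗᵢ[ℝ] E4, image R D4s = toE4 (lat q r c) := by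
  have hcr : (c : ℝ) ≠ 0 := by exact_mod_cast hc
  have hn : Quaternion.normSq ((c : ℝ)⁻¹ • (q : ℍ[ℝ])) *
      Quaternion.normSq (star (r : ℍ[ℝ])) = 1 := by
    have h1 : (nrm q : ℝ) * nrm r = c ^ 2 := by exact_mod_cast h
    rw [Quaternion.normSq_smul, Quaternion.normSq_star, ← coe_nrm, ← coe_nrm, mul_assoc, h1]
    field_simp
  have hcc : ∀ x : ℍ[ℝ], (c : ℍ[ℝ]) * x = (c : ℝ) • x := fun x => by
    rw [← Quaternion.coe_mul_eq_smul, Quaternion.coe_natCast]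
  refine ⟨mulIso _ _ hn, ?_⟩
  ext x
  obtain ⟨x, rfl⟩ := eQ.surjective x
  rw [eQ_mem_toE4, mem_lat, mem_image]
  constructor
  · rintro ⟨y, hy, hyx⟩
    refine ⟨⟨_, mem_D4s.1 hy⟩, ?_⟩
    rw [mulIso_apply] at hyx
    rw [← eQ.injective hyx, hcc]
    rw [smul_mul_assoc, smul_mul_assoc, smul_smul, mul_inv_cancel₀ hcr, one_smul]
    rfl
  · rintro ⟨z, hz⟩
    refine ⟨eQ z, eQ_mem_D4s.2 z.2, ?_⟩
    rw [mulIso_apply, eQ.symm_apply_apply]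
    congr 1
    rw [hcc] at hz
    have : x = (c : ℝ)⁻¹ • ((q * z * conj r : Hw) : ℍ[ℝ]) := by
      rw [← hz, smul_smul, inv_mul_cancel₀ hcr, one_smul]
    rw [this]
    simp

/-- The normal form of the image of `D4s` under a coincidence isometry. -/
theorem exists_triple_of_mem_OC {R : E4 ≃ₗᵢ[ℝ] E4} (hR : R ∈ OC D4s) :
    Odd (coincIndex D4s R) ∧ ∃ t ∈ triples (coincIndex D4s R), ∃ q r, IsPair 2 t q r ∧
      image R D4s = toE4 (lat q r (t.1 * t.2.1 * t.2.2)) ∧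
      csl D4s R = subE4 (cslSub (t.1 * t.2.1 * t.2.2) q r) := by
  obtain ⟨q₀, r₀, c₀, hq₀, hr₀, hc₀, hn₀, him₀⟩ := exists_lat_of_mem_OC hR
  obtain ⟨q, r, c, hq, hr, hc, hn, hlat⟩ := exists_odd_pair hq₀ hr₀ hn₀
  rw [hlat] at him₀
  obtain ⟨g, x, y, hxy, hqn, hrn, rfl⟩ := exists_square_factors hc.pos.ne' hn
  have hcsl := csl_of_image hc.pos.ne' hn him₀
  have hidx : coincIndex D4s R = g * x ^ 2 * y ^ 2 := by
    rw [coincIndex, hcsl, relIndex_subE4, index_cslSub hxy hc hq hr hqn hrn]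
  have hodd : Odd (g * x ^ 2 * y ^ 2) := by
    rw [Nat.odd_mul, Nat.odd_mul] at hc
    exact (hc.1.1.mul hc.1.2.pow).mul hc.2.pow
  rw [hidx]
  exact ⟨hodd, (g, x, y), (mem_triples hodd.pos.ne').2 ⟨rfl, hxy⟩, q, r, ⟨hq, hr, hqn, hrn⟩, him₀,
    hcsl⟩

theorem exists_iso_of_triple {n : ℕ} (hn : Odd n) {t : ℕ × ℕ × ℕ} (ht : t ∈ triples n) {q r : Hw}
    (h : IsPair 2 t q r) : ∃ R : E4 ≃ₗᵢ[ℝ] E4, coincIndex D4s R = n ∧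
      image R D4s = toE4 (lat q r (t.1 * t.2.1 * t.2.2)) ∧
      csl D4s R = subE4 (cslSub (t.1 * t.2.1 * t.2.2) q r) := by
  obtain ⟨g, x, y⟩ := t
  obtain ⟨hq, hr, hqn, hrn⟩ := h
  obtain ⟨o1, o2, o3⟩ := odd_of_mem_triples hn ht
  have h1 := (mem_triples hn.pos.ne').1 ht
  dsimp only at *
  have hc := (o1.mul o2).mul o3
  have hnn : nrm q * nrm r = (g * x * y) ^ 2 := by rw [hqn, hrn]; ring
  obtain ⟨R, hR⟩ := exists_iso_of_prm hc.pos.ne' hnn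
  have hcsl := csl_of_image hc.pos.ne' hnn hR
  refine ⟨R, ?_, hR, hcsl⟩
  rw [coincIndex, hcsl, relIndex_subE4, index_cslSub h1.2 hc hq hr hqn hrn, h1.1]

theorem odd_coincIndex {R : E4 ≃ₗᵢ[ℝ] E4} (hR : R ∈ OC D4s) : Odd (coincIndex D4s R) :=
  (exists_triple_of_mem_OC hR).1

theorem images_eq {n : ℕ} (hn : Odd n) :
    {L | n ≠ 0 ∧ ∃ R, coincIndex D4s R = n ∧ L = image R D4s} = toE4 '' latsOfIndex n := by
  ext L
  constructor
  · rintro ⟨h0, R, rfl, rfl⟩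
    obtain ⟨-, t, ht, q, r, hp, him, -⟩ := exists_triple_of_mem_OC (R := R) h0
    exact ⟨_, ⟨t, ht, q, r, hp, rfl⟩, him.symm⟩
  · rintro ⟨_, ⟨t, ht, q, r, hp, rfl⟩, rfl⟩
    obtain ⟨R, h1, h2, -⟩ := exists_iso_of_triple hn ht hp
    exact ⟨hn.pos.ne', R, h1, h2.symm⟩

theorem CSLsOfIndex_D4s {n : ℕ} (hn : Odd n) : CSLsOfIndex D4s n = subE4 '' cslsOfIndex n := by
  ext L
  constructor
  · rintro ⟨⟨R, hR, rfl⟩, rfl⟩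
    obtain ⟨-, t, ht, q, r, hp, -, h⟩ := exists_triple_of_mem_OC hR
    exact ⟨_, ⟨t, ht, q, r, hp, rfl⟩, h.symm⟩
  · rintro ⟨_, ⟨t, ht, q, r, hp, rfl⟩, rfl⟩
    obtain ⟨R, h1, -, h2⟩ := exists_iso_of_triple hn ht hp
    rw [← h2]
    exact ⟨⟨R, by rw [mem_OC, h1]; exact hn.pos.ne', rfl⟩, h1⟩

theorem CSLsOfIndex_D4s_of_not_odd {n : ℕ} (hn : ¬Odd n) : CSLsOfIndex D4s n = ∅ := by
  rw [Set.eq_empty_iff_forall_notMem]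
  rintro L ⟨⟨R, hR, rfl⟩, rfl⟩
  exact hn (odd_coincIndex hR)

theorem finite_CSLsOfIndex_D4s (n : ℕ) : (CSLsOfIndex D4s n).Finite := by
  by_cases hn : Odd n
  · rw [CSLsOfIndex_D4s hn]; exact (ncard_cslsOfIndex hn).1.image _
  · rw [CSLsOfIndex_D4s_of_not_odd hn]; exact Set.finite_empty

theorem fCSL_D4s {n : ℕ} (hn : Odd n) : fCSL D4s n = cnt 1 n := by
  rw [fCSL, CSLsOfIndex_D4s hn, Set.ncard_image_of_injective _ subE4_injective,
    (ncard_cslsOfIndex hn).2]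

theorem fCSL_D4s_of_not_odd {n : ℕ} (hn : ¬Odd n) : fCSL D4s n = 0 := by
  rw [fCSL, CSLsOfIndex_D4s_of_not_odd hn, Set.ncard_empty]

theorem rotationImages_D4s_of_not_odd {n : ℕ} (hn : ¬Odd n) : rotationImages D4s n = ∅ := by
  rw [rotationImages, Set.image_eq_empty, Set.eq_empty_iff_forall_notMem]
  rintro R ⟨hR, rfl⟩
  exact hn (odd_coincIndex hR.1)

theorem fRot_D4s_of_not_odd {n : ℕ} (hn : ¬Odd n) : fRot D4s n = 0 := by
  rw [fRot_eq_ncard, rotationImages_D4s_of_not_odd hn, Set.ncard_empty]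

/-! ### The three cubic sublattices of D₄* -/

/-- The right multiplication by the unit `(1 + i + j + k) / 2`. -/
noncomputable def omegaIso : E4 ≃ₗᵢ[ℝ] E4 :=
  mulIso 1 (hurwitzMk 1 0 0 0) (by
    rw [Quaternion.normSq_def', Quaternion.normSq_def']; simp; norm_num)

/-- Representatives of the classes of `P(D4s)` modulo `P(Z4)`. -/
noncomputable def cubicIso (j : Fin 3) : E4 ≃ₗᵢ[ℝ] E4 :=
  ![1, omegaIso * omegaIso, omegaIso * omegaIso * (omegaIso * omegaIso)] j

theorem isRotation_cubicIso (j : Fin 3) : IsRotation (cubicIso j) := by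
  -- The square of an isometry has determinant one; the representatives are powers of ω² so that
  -- they are visibly rotations.
  have h : IsRotation (omegaIso * omegaIso) := by
    rw [isRotation_iff, map_mul, isoDet_mul_self]
  fin_cases j
  · exact isRotation_one
  · exact h
  · exact h.mul h

/-- The three hypercubic sublattices of index two of `D4s`. -/
noncomputable def cubic (j : Fin 3) : AddSubgroup E4 := image (cubicIso j) Z4

theorem cubic_zero : cubic 0 = Z4 := image_one Z4

theorem eQ_mem_Z4 {x : ℍ[ℝ]} : eQ x ∈ Z4 ↔
    (∃ n : ℤ, x.re = n) ∧ (∃ n : ℤ, x.imI = n) ∧ (∃ n : ℤ, x.imJ = n) ∧ ∃ n : ℤ, x.imK = n := by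
  rw [eQ_apply]
  change (∀ i, _) ↔ _
  rw [Fin.forall_fin_succ, Fin.forall_fin_succ, Fin.forall_fin_succ, Fin.forall_fin_succ]
  simp

theorem even_iff_half {m : ℤ} : Even m ↔ ∃ n : ℤ, (m : ℝ) / 2 = n := by
  constructor
  · rintro ⟨k, rfl⟩; exact ⟨k, by push_cast; ring⟩
  · rintro ⟨n, hn⟩
    refine ⟨n, ?_⟩
    have : (m : ℝ) = (n + n : ℤ) := by push_cast; linarith
    exact_mod_cast this

theorem hurwitzMk_mem_Z4 {m b c d : ℤ} : eQ (hurwitzMk m b c d) ∈ Z4 ↔ Even m := by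
  rw [eQ_mem_Z4, even_iff_half]
  constructor
  · exact fun h => h.1
  · rintro ⟨n, hn⟩
    refine ⟨⟨n, hn⟩, ⟨n + b, ?_⟩, ⟨n + c, ?_⟩, ⟨n + d, ?_⟩⟩ <;> simp [hn]

theorem omegaIso_hurwitzMk (m b c d : ℤ) : omegaIso (eQ (hurwitzMk m b c d)) =
    eQ (hurwitzMk (-m - b - c - d) (m + b + c) (m + c + d) (m + b + d)) := by
  rw [omegaIso, mulIso_apply, eQ.symm_apply_apply]
  congr 1
  ext <;> simp <;> ring

theorem omegaIso_inv_hurwitzMk (m b c d : ℤ) : omegaIso⁻¹ (eQ (hurwitzMk m b c d)) =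
    eQ (hurwitzMk (2 * m + b + c + d) (-m - c) (-m - d) (-m - b)) := by
  apply omegaIso.injective
  rw [apply_inv_self, omegaIso_hurwitzMk]
  congr 2 <;> ring

theorem exists_hurwitzMk {x : E4} (hx : x ∈ D4s) : ∃ m b c d : ℤ, x = eQ (hurwitzMk m b c d) := by
  obtain ⟨m, b, c, d, h⟩ := mem_D4s.1 hx
  exact ⟨m, b, c, d, by rw [← h, eQ.apply_symm_apply]⟩

theorem hurwitzMk_mem_D4s (m b c d : ℤ) : eQ (hurwitzMk m b c d) ∈ D4s :=
  eQ_mem_D4s.2 ⟨m, b, c, d, rfl⟩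

/-- With s = b + c + d, the three cubic lattices are the kernels of the three nonzero functionals m,
m + s and s on the pair of parities (m, s). -/
theorem hurwitzMk_mem_cubic_one {m b c d : ℤ} :
    eQ (hurwitzMk m b c d) ∈ cubic 1 ↔ Even (m + (b + c + d)) := by
  have : eQ (hurwitzMk m b c d) ∈ cubic 1 ↔
      omegaIso⁻¹ (omegaIso⁻¹ (eQ (hurwitzMk m b c d))) ∈ Z4 := mem_image_iff
  rw [this, omegaIso_inv_hurwitzMk, omegaIso_inv_hurwitzMk, hurwitzMk_mem_Z4]
  grind

theorem hurwitzMk_mem_cubic_two {m b c d : ℤ} :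
    eQ (hurwitzMk m b c d) ∈ cubic 2 ↔ Even (b + c + d) := by
  have : eQ (hurwitzMk m b c d) ∈ cubic 2 ↔
      omegaIso⁻¹ (omegaIso⁻¹ (omegaIso⁻¹ (omegaIso⁻¹ (eQ (hurwitzMk m b c d))))) ∈ Z4 :=
    mem_image_iff
  rw [this, omegaIso_inv_hurwitzMk, omegaIso_inv_hurwitzMk, omegaIso_inv_hurwitzMk,
    omegaIso_inv_hurwitzMk, hurwitzMk_mem_Z4]
  grind

theorem hurwitzMk_mem_cubic_zero {m b c d : ℤ} : eQ (hurwitzMk m b c d) ∈ cubic 0 ↔ Even m := by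
  rw [cubic_zero, hurwitzMk_mem_Z4]

theorem omegaIso_mem_pointGroup : omegaIso ∈ pointGroup D4s := by
  rw [mem_pointGroup]
  ext x
  rw [mem_image_iff]
  constructor
  · intro h
    obtain ⟨m, b, c, d, h⟩ := exists_hurwitzMk h
    rw [← apply_inv_self omegaIso x, h, omegaIso_hurwitzMk]
    exact hurwitzMk_mem_D4s _ _ _ _
  · intro h
    obtain ⟨m, b, c, d, rfl⟩ := exists_hurwitzMk h
    rw [omegaIso_inv_hurwitzMk]
    exact hurwitzMk_mem_D4s _ _ _ _

theorem cubicIso_mem_pointGroup (j : Fin 3) : cubicIso j ∈ pointGroup D4s := by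
  have h := mul_mem omegaIso_mem_pointGroup omegaIso_mem_pointGroup
  fin_cases j
  · exact one_mem _
  · exact h
  · exact mul_mem h h

theorem Z4_le_D4s : Z4 ≤ D4s := by
  intro x hx
  obtain ⟨x, rfl⟩ := eQ.surjective x
  obtain ⟨⟨a, ha⟩, ⟨b, hb⟩, ⟨c, hc⟩, d, hd⟩ := eQ_mem_Z4.1 hx
  refine eQ_mem_D4s.2 ⟨2 * a, b - a, c - a, d - a, ?_⟩
  ext <;> simp [*]

theorem cubic_le (j : Fin 3) : cubic j ≤ D4s := by
  conv_rhs => rw [← mem_pointGroup.1 (cubicIso_mem_pointGroup j)]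
  exact image_mono Z4_le_D4s

/-- The sublattice of the vectors of even squared length. -/
noncomputable def evenSub : AddSubgroup E4 := cubic 0 ⊓ cubic 1

theorem hurwitzMk_mem_evenSub {m b c d : ℤ} :
    eQ (hurwitzMk m b c d) ∈ evenSub ↔ Even m ∧ Even (b + c + d) := by
  rw [evenSub, AddSubgroup.mem_inf, hurwitzMk_mem_cubic_zero, hurwitzMk_mem_cubic_one]
  grind

theorem evenSub_le_D4s : evenSub ≤ D4s := inf_le_left.trans (cubic_le 0)

theorem evenSub_le (j : Fin 3) : evenSub ≤ cubic j := by
  intro x hx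
  obtain ⟨m, b, c, d, rfl⟩ := exists_hurwitzMk (evenSub_le_D4s hx)
  rw [hurwitzMk_mem_evenSub] at hx
  fin_cases j
  · exact hurwitzMk_mem_cubic_zero.2 hx.1
  · exact hurwitzMk_mem_cubic_one.2 (hx.1.add hx.2)
  · exact hurwitzMk_mem_cubic_two.2 hx.2

theorem cubic_inf_le {i j : Fin 3} (hij : i ≠ j) {x : E4} (hi : x ∈ cubic i) (hj : x ∈ cubic j) :
    x ∈ evenSub := by
  obtain ⟨m, b, c, d, rfl⟩ := exists_hurwitzMk (cubic_le i hi)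
  rw [hurwitzMk_mem_evenSub]
  fin_cases i <;> fin_cases j <;>
    simp only [Fin.zero_eta, Fin.mk_one, Fin.reduceFinMk, hurwitzMk_mem_cubic_zero,
      hurwitzMk_mem_cubic_one, hurwitzMk_mem_cubic_two] at hi hj hij <;> grind

theorem exists_mem_cubic {x : E4} (hx : x ∈ D4s) : ∃ j, x ∈ cubic j := by
  obtain ⟨m, b, c, d, rfl⟩ := exists_hurwitzMk hx
  by_cases h : Even m
  · exact ⟨0, hurwitzMk_mem_cubic_zero.2 h⟩
  · by_cases h' : Even (b + c + d)
    · exact ⟨2, hurwitzMk_mem_cubic_two.2 h'⟩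
    · exact ⟨1, hurwitzMk_mem_cubic_one.2 (by grind)⟩

theorem sub_mem_evenSub {j : Fin 3} {x y : E4} (hx : x ∈ cubic j) (hy : y ∈ cubic j)
    (hx' : x ∉ evenSub) (hy' : y ∉ evenSub) : x - y ∈ evenSub := by
  obtain ⟨m, b, c, d, rfl⟩ := exists_hurwitzMk (cubic_le j hx)
  obtain ⟨m', b', c', d', rfl⟩ := exists_hurwitzMk (cubic_le j hy)
  have : hurwitzMk m b c d - hurwitzMk m' b' c' d' =
      hurwitzMk (m - m') (b - b') (c - c') (d - d') := by
    ext <;> simp <;> ring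
  rw [← map_sub, this, hurwitzMk_mem_evenSub]
  rw [hurwitzMk_mem_evenSub] at hx' hy'
  fin_cases j <;>
    simp only [Fin.zero_eta, Fin.mk_one, Fin.reduceFinMk, hurwitzMk_mem_cubic_zero,
      hurwitzMk_mem_cubic_one, hurwitzMk_mem_cubic_two] at hx hy <;> grind

theorem exists_mem_cubic_notMem (j : Fin 3) : ∃ x ∈ cubic j, x ∉ evenSub := by
  fin_cases j
  · exact ⟨eQ (hurwitzMk 0 1 0 0), hurwitzMk_mem_cubic_zero.2 (by decide), by
      rw [hurwitzMk_mem_evenSub]; decide⟩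
  · exact ⟨eQ (hurwitzMk 1 1 0 0), hurwitzMk_mem_cubic_one.2 (by decide), by
      rw [hurwitzMk_mem_evenSub]; decide⟩
  · exact ⟨eQ (hurwitzMk 1 0 0 0), hurwitzMk_mem_cubic_two.2 (by decide), by
      rw [hurwitzMk_mem_evenSub]; decide⟩

theorem two_nsmul_mem_evenSub {x : E4} (hx : x ∈ D4s) : 2 • x ∈ evenSub := by
  obtain ⟨m, b, c, d, rfl⟩ := exists_hurwitzMk hx
  have : 2 • hurwitzMk m b c d = hurwitzMk (2 * m) (2 * b) (2 * c) (2 * d) := by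
    rw [two_nsmul]
    ext <;> simp <;> ring
  rw [← map_nsmul, this, hurwitzMk_mem_evenSub]
  grind

theorem norm_sq_hurwitzMk (m b c d : ℤ) : ‖eQ (hurwitzMk m b c d)‖ ^ 2 =
    (m ^ 2 + m * (b + c + d) + b ^ 2 + c ^ 2 + d ^ 2 : ℤ) := by
  rw [eQ.norm_map, sq, ← Quaternion.normSq_eq_norm_mul_self, Quaternion.normSq_def']
  push_cast
  simp only [hurwitzMk_re, hurwitzMk_imI, hurwitzMk_imJ, hurwitzMk_imK]
  ring

/-- This description uses the norm alone, and is what makes the even sublattice visible to every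
isometry. -/
theorem mem_evenSub_iff {x : E4} (hx : x ∈ D4s) :
    x ∈ evenSub ↔ ∃ n : ℤ, ‖x‖ ^ 2 = (2 * n : ℤ) := by
  obtain ⟨m, b, c, d, rfl⟩ := exists_hurwitzMk hx
  rw [hurwitzMk_mem_evenSub, norm_sq_hurwitzMk]
  have h1 : (∃ n : ℤ, ((m ^ 2 + m * (b + c + d) + b ^ 2 + c ^ 2 + d ^ 2 : ℤ) : ℝ) = (2 * n : ℤ)) ↔
      Even (m ^ 2 + m * (b + c + d) + b ^ 2 + c ^ 2 + d ^ 2) := by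
    rw [even_iff_two_dvd]
    exact exists_congr fun n => Int.cast_inj
  rw [h1]
  simp only [Int.even_add, Int.even_mul, Int.even_pow, ne_eq, OfNat.ofNat_ne_zero,
    not_false_eq_true, and_true]
  tauto

theorem relIndex_eq_two {G : Type*} [AddCommGroup G] {A B : AddSubgroup G} {u : G} (hu : u ∈ B)
    (hu' : u ∉ A) (h : ∀ x ∈ B, x ∉ A → x - u ∈ A) : A.relIndex B = 2 := by
  rw [AddSubgroup.relIndex_eq_two_iff]
  refine ⟨-u, neg_mem hu, fun x hx => ?_⟩
  by_cases hxA : x ∈ A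
  · exact Or.inr ⟨hxA, fun h2 => hu' (neg_mem_iff.1 ((add_mem_cancel_left hxA).1 h2))⟩
  · exact Or.inl ⟨by rw [← sub_eq_add_neg]; exact h x hx hxA, hxA⟩

theorem Z4_sub_mem {x y : E4} (hx : x ∈ D4s) (hy : y ∈ D4s) (hx' : x ∉ Z4) (hy' : y ∉ Z4) :
    x - y ∈ Z4 := by
  obtain ⟨m, b, c, d, rfl⟩ := exists_hurwitzMk hx
  obtain ⟨m', b', c', d', rfl⟩ := exists_hurwitzMk hy
  have : hurwitzMk m b c d - hurwitzMk m' b' c' d' =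
      hurwitzMk (m - m') (b - b') (c - c') (d - d') := by
    ext <;> simp <;> ring
  rw [hurwitzMk_mem_Z4] at hx' hy'
  rw [← map_sub, this, hurwitzMk_mem_Z4]
  grind

theorem notMem_Z4 {j : Fin 3} (hj : j ≠ 0) {x : E4} (hx : x ∈ cubic j) (hx' : x ∉ evenSub) :
    x ∉ Z4 := fun h => hx' (cubic_inf_le hj hx (cubic_zero.symm ▸ h))

theorem relIndex_Z4_D4s : Z4.relIndex D4s = 2 := by
  obtain ⟨u, hu, hu'⟩ := exists_mem_cubic_notMem 1
  have h := notMem_Z4 (by decide) hu hu'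
  exact relIndex_eq_two (cubic_le 1 hu) h fun x hx hx' => Z4_sub_mem hx (cubic_le 1 hu) hx' h

theorem cubic_injective : Function.Injective cubic := by
  intro i j h
  by_contra hij
  obtain ⟨u, hu, hu'⟩ := exists_mem_cubic_notMem i
  exact hu' (cubic_inf_le hij hu (h ▸ hu))

theorem nsmul_relIndex_mem {G : Type*} [AddCommGroup G] {A B : AddSubgroup G} {x : G}
    (hx : x ∈ B) : A.relIndex B • x ∈ A := by
  have := (A.addSubgroupOf B).nsmul_index_mem ⟨x, hx⟩
  exact this

theorem odd_nsmul_mem_evenSub_iff {m : ℕ} (hm : Odd m) {x : E4} (hx : x ∈ D4s) :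
    m • x ∈ evenSub ↔ x ∈ evenSub := by
  obtain ⟨k, rfl⟩ := hm
  rw [add_nsmul, one_nsmul, mul_comm, mul_nsmul, add_mem_cancel_left]
  rw [smul_comm]
  exact nsmul_mem (two_nsmul_mem_evenSub hx) k

/-- A sublattice of odd index meets all classes modulo `evenSub`. -/
theorem exists_mem_inf_cubic {Λ : AddSubgroup E4} (hodd : Odd (Λ.relIndex D4s)) (j : Fin 3) :
    ∃ x ∈ Λ, x ∈ cubic j ∧ x ∉ evenSub := by
  obtain ⟨u, hu, hu'⟩ := exists_mem_cubic_notMem j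
  -- The index times u lies in Λ. The index is odd and 2u is even, so this multiple stays in the
  -- class of u.
  exact ⟨_, nsmul_relIndex_mem (cubic_le j hu), nsmul_mem hu _,
    fun h => hu' ((odd_nsmul_mem_evenSub_iff hodd (cubic_le j hu)).1 h)⟩

/-- Λ has vectors outside ℤ⁴, so Λ ∩ ℤ⁴ has index two in Λ, just as ℤ⁴ has in D₄*; compare the two
chains up to D₄*. -/
theorem relIndex_inf_Z4 {Λ : AddSubgroup E4} (hΛ : Λ ≤ D4s) (hodd : Odd (Λ.relIndex D4s)) :
    (Λ ⊓ Z4).relIndex Z4 = Λ.relIndex D4s := by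
  obtain ⟨u, hu, hu1, hu2⟩ := exists_mem_inf_cubic hodd 1
  have hu3 := notMem_Z4 (by decide) hu1 hu2
  have h2 : (Λ ⊓ Z4).relIndex Λ = 2 := relIndex_eq_two hu (fun h => hu3 h.2)
    fun x hx hx' => ⟨Λ.sub_mem hx hu, Z4_sub_mem (hΛ hx) (hΛ hu) (fun h => hx' ⟨hx, h⟩) hu3⟩
  have h3 := AddSubgroup.relIndex_mul_relIndex _ _ _ (inf_le_left : Λ ⊓ Z4 ≤ Λ) hΛ
  have h4 := AddSubgroup.relIndex_mul_relIndex _ _ _ (inf_le_right : Λ ⊓ Z4 ≤ Z4) Z4_le_D4s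
  rw [h2] at h3
  rw [relIndex_Z4_D4s] at h4
  omega

theorem relIndex_inf_evenSub {Λ : AddSubgroup E4} (hΛ : Λ ≤ D4s) (hodd : Odd (Λ.relIndex D4s)) :
    (Λ ⊓ evenSub).relIndex Z4 = 2 * Λ.relIndex D4s := by
  obtain ⟨u, hu, hu1, hu2⟩ := exists_mem_inf_cubic hodd 0
  have hE : evenSub ≤ Z4 := cubic_zero ▸ evenSub_le 0
  have h2 : (Λ ⊓ evenSub).relIndex (Λ ⊓ Z4) = 2 := by
    rw [cubic_zero] at hu1
    refine relIndex_eq_two ⟨hu, hu1⟩ (fun h => hu2 h.2) fun x hx hx' => ⟨Λ.sub_mem hx.1 hu, ?_⟩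
    have hx2 := hx.2
    rw [← cubic_zero] at hx2 hu1
    exact sub_mem_evenSub hx2 hu1 (fun h => hx' ⟨hx.1, h⟩) hu2
  rw [← AddSubgroup.relIndex_mul_relIndex _ _ _ (inf_le_inf_left Λ hE) inf_le_right, h2,
    relIndex_inf_Z4 hΛ hodd]

/-! ### Coincidence site lattices of ℤ⁴ against those of D₄* -/

theorem csl_le (Γ : AddSubgroup E4) (R : E4 ≃ₗᵢ[ℝ] E4) : csl Γ R ≤ Γ := inf_le_left

theorem inv_apply_mem {Γ : AddSubgroup E4} {R : E4 ≃ₗᵢ[ℝ] E4} {x : E4} (hx : x ∈ csl Γ R) :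
    R⁻¹ x ∈ Γ := mem_image_iff.1 hx.2

theorem inv_apply_mem_evenSub {R : E4 ≃ₗᵢ[ℝ] E4} {x : E4} (hx : x ∈ csl D4s R) :
    R⁻¹ x ∈ evenSub ↔ x ∈ evenSub := by
  rw [mem_evenSub_iff (inv_apply_mem hx), mem_evenSub_iff hx.1, (R⁻¹).norm_map]

/-- A coincidence isometry permutes the three classes modulo `evenSub`. -/
theorem exists_perm {R : E4 ≃ₗᵢ[ℝ] E4} (hR : R ∈ OC D4s) : ∃ τ : Equiv.Perm (Fin 3),
    ∀ i, ∀ x ∈ csl D4s R, R⁻¹ x ∈ cubic (τ i) ↔ x ∈ cubic i := by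
  have hodd : Odd ((csl D4s R).relIndex D4s) := odd_coincIndex hR
  choose v hv hv1 hv2 using exists_mem_inf_cubic hodd
  choose τ hτ using fun i => exists_mem_cubic (inv_apply_mem (hv i))
  have hRv : ∀ i, R⁻¹ (v i) ∉ evenSub := fun i h => hv2 i ((inv_apply_mem_evenSub (hv i)).1 h)
  -- If v i and v j were sent to one class, their difference would become even under R⁻¹, hence be
  -- even already, and they would lie in one class from the start.
  have hinj : Function.Injective τ := by
    intro i j h
    by_contra hij
    have h1 := sub_mem_evenSub (hτ i) (h ▸ hτ j) (hRv i) (hRv j)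
    rw [← map_sub, inv_apply_mem_evenSub (sub_mem (hv i) (hv j))] at h1
    have h2 : v j ∈ cubic i := by
      have := sub_mem (hv1 i) (evenSub_le i h1)
      rwa [sub_sub_cancel] at this
    exact hv2 j (cubic_inf_le hij h2 (hv1 j))
  refine ⟨Equiv.ofBijective τ (Finite.injective_iff_bijective.1 hinj), fun i x hx => ?_⟩
  change R⁻¹ x ∈ cubic (τ i) ↔ x ∈ cubic i
  by_cases hxE : x ∈ evenSub
  · exact iff_of_true (evenSub_le _ ((inv_apply_mem_evenSub hx).2 hxE)) (evenSub_le _ hxE)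
  have hRx : R⁻¹ x ∉ evenSub := fun h => hxE ((inv_apply_mem_evenSub hx).1 h)
  have h3 := inv_apply_mem_evenSub (sub_mem hx (hv i))
  rw [map_sub] at h3
  constructor
  · intro h
    have := add_mem (evenSub_le i (h3.1 (sub_mem_evenSub h (hτ i) hRx (hRv i)))) (hv1 i)
    rwa [sub_add_cancel] at this
  · intro h
    have := add_mem (evenSub_le (τ i) (h3.2 (sub_mem_evenSub h (hv1 i) hxE (hv2 i)))) (hτ i)
    rwa [sub_add_cancel] at this

theorem mul_cubicIso_mem_OC {R : E4 ≃ₗᵢ[ℝ] E4} (hR : R ∈ OC D4s) (j : Fin 3) :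
    R * cubicIso j ∈ OC D4s := by
  rwa [mem_OC, coincIndex_mul (cubicIso_mem_pointGroup j)]

theorem mem_csl_Z4 {R : E4 ≃ₗᵢ[ℝ] E4} {j : Fin 3} {x : E4} : x ∈ csl Z4 (R * cubicIso j) ↔
    x ∈ csl D4s R ∧ x ∈ cubic 0 ∧ R⁻¹ x ∈ cubic j := by
  rw [csl, csl, image_mul, cubic_zero, AddSubgroup.mem_inf, AddSubgroup.mem_inf]
  change x ∈ Z4 ∧ x ∈ image R (cubic j) ↔ _
  rw [mem_image_iff, mem_image_iff]
  constructor
  · exact fun h => ⟨⟨Z4_le_D4s h.1, cubic_le j h.2⟩, h⟩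
  · exact fun h => h.2

/-- The coincidence site lattices of `Z4` inside a symmetry class of `D4s`. -/
theorem exists_perm_csl {R : E4 ≃ₗᵢ[ℝ] E4} (hR : R ∈ OC D4s) : ∃ τ : Equiv.Perm (Fin 3),
    csl Z4 (R * cubicIso (τ 0)) = csl D4s R ⊓ Z4 ∧
    ∀ i, i ≠ 0 → csl Z4 (R * cubicIso (τ i)) = csl D4s R ⊓ evenSub := by
  obtain ⟨τ, hτ⟩ := exists_perm hR
  refine ⟨τ, ?_, fun i hi => ?_⟩
  -- By the permutation property, R⁻¹x lies in `cubic (τ i)` exactly if x lies in `cubic i`. So the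
  -- CSL of ℤ⁴ is the part of the CSL of D₄* inside `cubic 0 ⊓ cubic i`.
  · ext x
    rw [mem_csl_Z4, AddSubgroup.mem_inf, ← cubic_zero]
    constructor
    · exact fun h => ⟨h.1, h.2.1⟩
    · exact fun h => ⟨h.1, h.2, (hτ 0 x h.1).2 h.2⟩
  · ext x
    rw [mem_csl_Z4, AddSubgroup.mem_inf]
    constructor
    · exact fun h => ⟨h.1, cubic_inf_le hi ((hτ i x h.1).1 h.2.2) h.2.1⟩
    · exact fun h => ⟨h.1, evenSub_le 0 h.2, (hτ i x h.1).2 (evenSub_le i h.2)⟩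

theorem cubicIso_zero : cubicIso 0 = 1 := rfl

theorem csl_Z4_eq_or {R : E4 ≃ₗᵢ[ℝ] E4} (hR : R ∈ OC D4s) :
    csl Z4 R = csl D4s R ⊓ Z4 ∨ csl Z4 R = csl D4s R ⊓ evenSub := by
  obtain ⟨τ, h0, h⟩ := exists_perm_csl hR
  have h1 : R = R * cubicIso (τ (τ.symm 0)) := by
    rw [τ.apply_symm_apply, cubicIso_zero, mul_one]
  by_cases hi : τ.symm 0 = 0
  · left; rw [hi] at h1; rw [← h0, ← h1]
  · right; rw [← h _ hi, ← h1]

/-- Doubling moves D₄* into the even sublattice, and a sublattice of odd index contains x once it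
contains 2x. Hence the CSL of ℤ⁴ determines that of D₄*. -/
theorem mem_csl_D4s_iff {R : E4 ≃ₗᵢ[ℝ] E4} (hR : R ∈ OC D4s) {x : E4} :
    x ∈ csl D4s R ↔ x ∈ D4s ∧ 2 • x ∈ csl Z4 R := by
  constructor
  · intro hx
    have h2 := two_nsmul_mem_evenSub hx.1
    refine ⟨hx.1, ?_⟩
    rcases csl_Z4_eq_or hR with h | h <;> rw [h]
    · exact ⟨nsmul_mem hx 2, cubic_zero ▸ evenSub_le 0 h2⟩
    · exact ⟨nsmul_mem hx 2, h2⟩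
  · rintro ⟨hx, h2⟩
    have h3 : 2 • x ∈ csl D4s R := by
      rcases csl_Z4_eq_or hR with h | h <;> rw [h] at h2 <;> exact h2.1
    obtain ⟨k, hk⟩ := odd_coincIndex hR
    have h4 := nsmul_relIndex_mem (A := csl D4s R) hx
    change coincIndex D4s R • x ∈ _ at h4
    rw [hk, add_nsmul, one_nsmul, mul_comm, mul_nsmul, smul_comm,
      add_mem_cancel_left (nsmul_mem h3 k)] at h4
    exact h4

theorem csl_D4s_eq_of_csl_Z4_eq {R R' : E4 ≃ₗᵢ[ℝ] E4} (hR : R ∈ OC D4s) (hR' : R' ∈ OC D4s)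
    (h : csl Z4 R = csl Z4 R') : csl D4s R = csl D4s R' := by
  ext x
  rw [mem_csl_D4s_iff hR, mem_csl_D4s_iff hR', h]

theorem csl_D4s_mul_cubicIso (R : E4 ≃ₗᵢ[ℝ] E4) (j : Fin 3) :
    csl D4s (R * cubicIso j) = csl D4s R := csl_congr (image_mul_of_mem (cubicIso_mem_pointGroup j))

/-- For Q in the point group the CSL is all of D₄*, so that Q permutes the cubic lattices
themselves. -/
theorem exists_cubic_of_mem_pointGroup {Q : E4 ≃ₗᵢ[ℝ] E4} (hQ : Q ∈ pointGroup D4s) :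
    ∃ j, image Q Z4 = cubic j := by
  have hcsl : csl D4s Q = D4s := by rw [csl, mem_pointGroup.1 hQ, inf_idem]
  obtain ⟨τ, hτ⟩ := exists_perm (R := Q) (by rw [mem_OC, coincIndex_eq_one hQ]; exact one_ne_zero)
  refine ⟨τ.symm 0, ?_⟩
  ext x
  rw [mem_image_iff]
  constructor
  · intro h
    have hx : x ∈ csl D4s Q := by
      rw [hcsl, ← mem_pointGroup.1 hQ, mem_image_iff]; exact Z4_le_D4s h
    rw [← hτ _ x hx, τ.apply_symm_apply, cubic_zero]
    exact h
  · intro h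
    have := (hτ _ x (hcsl.symm ▸ cubic_le _ h)).2 h
    rwa [τ.apply_symm_apply, cubic_zero] at this

theorem OC_Z4_eq : OC Z4 = OC D4s :=
  OC_eq_of_relIndex_ne_zero Z4_le_D4s (by rw [relIndex_Z4_D4s]; norm_num)

/-! ### The point groups -/

/-- The isometry `x ↦ (ε i * x (σ i))ᵢ`. -/
noncomputable def signedPerm (σ : Equiv.Perm (Fin 4)) (ε : Fin 4 → ℤˣ) : E4 ≃ₗᵢ[ℝ] E4 :=
  LinearIsometry.toLinearIsometryEquiv
    { toFun := fun x => WithLp.toLp 2 fun i => ((ε i : ℤ) : ℝ) * x (σ i)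
      map_add' := fun x y => by ext i; simp [mul_add]
      map_smul' := fun a x => by ext i; simp; ring
      norm_map' := fun x => by
        change ‖WithLp.toLp 2 fun i => ((ε i : ℤ) : ℝ) * x (σ i)‖ = ‖x‖
        rw [EuclideanSpace.norm_eq, EuclideanSpace.norm_eq, ← Equiv.sum_comp σ fun i => ‖x i‖ ^ 2]
        congr 1
        refine Finset.sum_congr rfl fun i _ => ?_
        rcases Int.units_eq_one_or (ε i) with h | h <;> simp [h] } rfl

theorem signedPerm_apply (σ : Equiv.Perm (Fin 4)) (ε : Fin 4 → ℤˣ) (x : E4) (i : Fin 4) :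
    signedPerm σ ε x i = ((ε i : ℤ) : ℝ) * x (σ i) := rfl

theorem signedPerm_mem (σ : Equiv.Perm (Fin 4)) (ε : Fin 4 → ℤˣ) :
    signedPerm σ ε ∈ pointGroup Z4 := by
  rw [mem_pointGroup]
  have hsq : ∀ i, ((ε i : ℤ) : ℝ) * ((ε i : ℤ) : ℝ) = 1 := fun i => by
    rcases Int.units_eq_one_or (ε i) with h | h <;> simp [h]
  ext x
  constructor
  · rintro ⟨y, hy, rfl⟩ i
    obtain ⟨n, hn⟩ := hy (σ i)
    exact ⟨ε i * n, by
      change signedPerm σ ε y i = _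
      rw [signedPerm_apply, hn]; push_cast; rfl⟩
  · intro hx
    refine ⟨WithLp.toLp 2 fun i => ((ε (σ.symm i) : ℤ) : ℝ) * x (σ.symm i), fun i => ?_, ?_⟩
    · obtain ⟨n, hn⟩ := hx (σ.symm i)
      exact ⟨ε (σ.symm i) * n, by simp [hn]⟩
    · ext i
      change signedPerm σ ε _ i = _
      rw [signedPerm_apply]
      simp only [σ.symm_apply_apply, ← mul_assoc, hsq, one_mul]

theorem inv_mem_pointGroup_apply {Q : E4 ≃ₗᵢ[ℝ] E4} {Γ : AddSubgroup E4} (hQ : Q ∈ pointGroup Γ)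
    {x : E4} (hx : x ∈ Γ) : Q⁻¹ x ∈ Γ := by
  rwa [← mem_image_iff, mem_pointGroup.1 hQ]

theorem mem_pointGroup_apply {Q : E4 ≃ₗᵢ[ℝ] E4} {Γ : AddSubgroup E4} (hQ : Q ∈ pointGroup Γ)
    {x : E4} (hx : x ∈ Γ) : Q x ∈ Γ := by
  rw [← mem_pointGroup.1 hQ]; exact ⟨x, hx, rfl⟩

theorem single_mem_Z4 (i : Fin 4) : EuclideanSpace.single i (1 : ℝ) ∈ Z4 := fun j =>
  ⟨if j = i then 1 else 0, by simp⟩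

theorem exists_single_of_norm {v : E4} (hv : v ∈ Z4) (hn : ‖v‖ = 1) :
    ∃ (j : Fin 4) (ε : ℤˣ), v = EuclideanSpace.single j ((ε : ℤ) : ℝ) := by
  choose n hn' using hv
  have hsum : ∑ i, n i ^ 2 = 1 := by
    have h := EuclideanSpace.norm_sq_eq v
    rw [hn, one_pow] at h
    have : ((∑ i, n i ^ 2 : ℤ) : ℝ) = 1 := by
      push_cast
      rw [h]
      exact Finset.sum_congr rfl fun i _ => by rw [hn' i, Real.norm_eq_abs, sq_abs]
    exact_mod_cast this
  obtain ⟨j, hj⟩ : ∃ j, n j ≠ 0 := by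
    by_contra! h
    simp [h] at hsum
  have hj1 : 1 ≤ n j ^ 2 := Int.add_one_le_iff.2 (sq_pos_of_ne_zero hj)
  rw [← Finset.add_sum_erase _ _ (Finset.mem_univ j)] at hsum
  have hnn : ∀ i ∈ Finset.univ.erase j, 0 ≤ n i ^ 2 := fun i _ => sq_nonneg _
  have hs0 : ∑ i ∈ Finset.univ.erase j, n i ^ 2 = 0 := by
    have := Finset.sum_nonneg hnn
    linarith
  have h0 := (Finset.sum_eq_zero_iff_of_nonneg hnn).1 hs0
  have hj2 : n j * n j = 1 := by nlinarith
  refine ⟨j, ⟨n j, n j, hj2, hj2⟩, ?_⟩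
  ext i
  by_cases hij : i = j
  · subst hij; simp [hn']
  · have : n i = 0 := by
      have := h0 i (Finset.mem_erase.2 ⟨hij, Finset.mem_univ i⟩)
      exact pow_eq_zero_iff two_ne_zero |>.1 this
    rw [hn', this]
    simp [hij]

/-- Q⁻¹ sends basis vectors to integral vectors of length one, that is, to signed basis vectors;
orthogonality keeps their positions distinct. -/
theorem exists_signedPerm {Q : E4 ≃ₗᵢ[ℝ] E4} (hQ : Q ∈ pointGroup Z4) :
    ∃ σ ε, signedPerm σ ε = Q := by
  choose σ ε h using fun i => exists_single_of_norm
    (inv_mem_pointGroup_apply hQ (single_mem_Z4 i)) (by rw [(Q⁻¹).norm_map]; simp)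
  have hinj : Function.Injective σ := by
    intro i j hij
    by_contra hne
    have h1 : inner ℝ (Q⁻¹ (EuclideanSpace.single i (1 : ℝ)))
        (Q⁻¹ (EuclideanSpace.single j (1 : ℝ))) = (0 : ℝ) := by
      rw [(Q⁻¹).inner_map_map]
      simp [EuclideanSpace.inner_single_left, hne]
    rw [h, h, hij, EuclideanSpace.inner_single_left] at h1
    simp at h1
  refine ⟨Equiv.ofBijective σ (Finite.injective_iff_bijective.1 hinj), ε, ?_⟩
  ext x i
  rw [signedPerm_apply]
  change ((ε i : ℤ) : ℝ) * x (σ i) = Q x i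
  have h1 : inner ℝ (EuclideanSpace.single i (1 : ℝ)) (Q x) = Q x i := by
    simp [EuclideanSpace.inner_single_left]
  rw [← h1, ← (Q⁻¹).inner_map_map, h, inv_apply_self, EuclideanSpace.inner_single_left]
  simp

theorem signedPerm_injective {σ σ' : Equiv.Perm (Fin 4)} {ε ε' : Fin 4 → ℤˣ}
    (h : signedPerm σ ε = signedPerm σ' ε') : σ = σ' ∧ ε = ε' := by
  have key : ∀ i, σ i = σ' i ∧ ε i = ε' i := by
    intro i
    have h1 : signedPerm σ ε (EuclideanSpace.single (σ i) 1) i =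
      signedPerm σ' ε' (EuclideanSpace.single (σ i) 1) i := by rw [h]
    rw [signedPerm_apply, signedPerm_apply] at h1
    by_cases hi : σ i = σ' i
    · refine ⟨hi, ?_⟩
      rw [hi] at h1
      simp only [PiLp.single_apply, if_true, mul_one] at h1
      exact Units.ext (by exact_mod_cast h1)
    · have hi' : ¬ σ' i = σ i := fun h => hi h.symm
      simp [hi'] at h1
  exact ⟨Equiv.ext fun i => (key i).1, funext fun i => (key i).2⟩

theorem card_pointGroup_Z4 : Nat.card (pointGroup Z4) = 384 := by
  let f : Equiv.Perm (Fin 4) × (Fin 4 → ℤˣ) → pointGroup Z4 :=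
    fun x => ⟨signedPerm x.1 x.2, signedPerm_mem _ _⟩
  have hf : Function.Bijective f := by
    constructor
    · rintro ⟨σ, ε⟩ ⟨σ', ε'⟩ h
      obtain ⟨rfl, rfl⟩ := signedPerm_injective (Subtype.ext_iff.1 h)
      rfl
    · rintro ⟨Q, hQ⟩
      obtain ⟨σ, ε, h⟩ := exists_signedPerm hQ
      exact ⟨(σ, ε), Subtype.ext h⟩
  rw [← Nat.card_congr (Equiv.ofBijective f hf), Nat.card_eq_fintype_card, Fintype.card_prod,
    Fintype.card_perm, Fintype.card_fun]
  decide

theorem pointGroup_Z4_le : pointGroup Z4 ≤ pointGroup D4s := by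
  have key : ∀ {Q : E4 ≃ₗᵢ[ℝ] E4}, Q ∈ pointGroup Z4 → ∀ x ∈ D4s, Q x ∈ D4s := by
    intro Q hQ x hx
    have hZ : ∀ x ∈ Z4, Q x ∈ D4s := fun x hx => Z4_le_D4s (mem_pointGroup_apply hQ hx)
    refine AddSubgroup.closure_induction (p := fun x _ => Q x ∈ D4s) ?_ (by simp)
      (fun x y _ _ hx hy => by rw [map_add]; exact add_mem hx hy)
      (fun x _ hx => by rw [map_neg]; exact neg_mem hx) hx
    rintro x (rfl | rfl | rfl | rfl)
    · exact hZ _ fun i => by fin_cases i <;> first | (refine ⟨0, ?_⟩; simp; done) | (refine ⟨1, ?_⟩; simp)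
    · exact hZ _ fun i => by fin_cases i <;> first | (refine ⟨0, ?_⟩; simp; done) | (refine ⟨1, ?_⟩; simp)
    · exact hZ _ fun i => by fin_cases i <;> first | (refine ⟨0, ?_⟩; simp; done) | (refine ⟨1, ?_⟩; simp)
    · obtain ⟨σ, ε, rfl⟩ := exists_signedPerm hQ
      have h1 : !₂[1 / 2, 1 / 2, 1 / 2, (1 / 2 : ℝ)] ∈ D4s :=
        AddSubgroup.subset_closure (by simp)
      have hc : ∀ i, !₂[1 / 2, 1 / 2, 1 / 2, (1 / 2 : ℝ)] i = 1 / 2 := fun i => by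
        fin_cases i <;> rfl
      -- Permutations fix the vector with all entries 1/2, and a sign change alters an entry by the
      -- integer -1.
      rw [← sub_add_cancel (signedPerm σ ε _) !₂[1 / 2, 1 / 2, 1 / 2, (1 / 2 : ℝ)]]
      refine add_mem (Z4_le_D4s fun i => ?_) h1
      rw [PiLp.sub_apply, signedPerm_apply, hc, hc]
      rcases Int.units_eq_one_or (ε i) with h | h
      · exact ⟨0, by simp [h]⟩
      · exact ⟨-1, by simp [h]; norm_num⟩
  intro Q hQ
  rw [mem_pointGroup]
  ext x
  constructor
  · rintro ⟨y, hy, rfl⟩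
    exact key hQ y hy
  · intro hx
    exact mem_image_iff.2 (key (inv_mem hQ) x hx)

/-- Orbit and stabiliser: P(D₄*) permutes the three cubic lattices, transitively by the maps
`cubicIso`, and P(ℤ⁴) is the stabiliser of ℤ⁴. -/
theorem relIndex_pointGroup : (pointGroup Z4).relIndex (pointGroup D4s) = 3 := by
  let f : Fin 3 → pointGroup D4s ⧸ (pointGroup Z4).subgroupOf (pointGroup D4s) :=
    fun j => QuotientGroup.mk ⟨cubicIso j, cubicIso_mem_pointGroup j⟩
  have hf : Function.Bijective f := by
    constructor
    · intro i j h
      have h1 := QuotientGroup.eq.1 h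
      rw [Subgroup.mem_subgroupOf] at h1
      exact cubic_injective (image_eq_image_iff.2 h1)
    · intro q
      induction q using QuotientGroup.induction_on with
      | H Q =>
        obtain ⟨j, hj⟩ := exists_cubic_of_mem_pointGroup Q.2
        refine ⟨j, QuotientGroup.eq.2 ?_⟩
        rw [Subgroup.mem_subgroupOf]
        exact image_eq_image_iff.1 hj.symm
  rw [Subgroup.relIndex, Subgroup.index, ← Nat.card_congr (Equiv.ofBijective f hf), Nat.card_fin]

theorem card_pointGroup_D4s : Nat.card (pointGroup D4s) = 2 * 576 := by
  have h1 := ((pointGroup Z4).subgroupOf (pointGroup D4s)).card_mul_index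
  have h2 := Nat.card_congr (Subgroup.subgroupOfEquivOfLe pointGroup_Z4_le).toEquiv
  rw [h2, card_pointGroup_Z4] at h1
  change 384 * (pointGroup Z4).relIndex (pointGroup D4s) = _ at h1
  rw [relIndex_pointGroup] at h1
  exact h1.symm

/-- The reflection in the hyperplane orthogonal to a coordinate axis. -/
theorem exists_reflection : ∃ Q ∈ pointGroup Z4, isoDet Q = -1 := by
  let v : E4 := EuclideanSpace.single 0 1
  refine ⟨(ℝ ∙ v)ᗮ.reflection, ?_, ?_⟩
  · have key : ∀ x ∈ Z4, (ℝ ∙ v)ᗮ.reflection x ∈ Z4 := by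
      intro x hx
      rw [Submodule.reflection_orthogonal_apply, Submodule.reflection_singleton_apply]
      obtain ⟨n, hn⟩ := hx 0
      have h1 : inner ℝ v x = n := by
        rw [← hn]; simp [v, EuclideanSpace.inner_single_left]
      rw [h1, show ‖v‖ = 1 by simp [v]]
      refine neg_mem (sub_mem (nsmul_mem ?_ 2) hx)
      have h2 := zsmul_mem (single_mem_Z4 0) n
      rw [← Int.cast_smul_eq_zsmul ℝ] at h2
      simpa using h2
    rw [mem_pointGroup]
    ext x
    constructor
    · rintro ⟨y, hy, rfl⟩
      exact key y hy
    · exact fun hx => mem_image_iff.2 (key x hx)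
  · have := Submodule.det_reflection (𝕜 := ℝ) (ℝ ∙ v)ᗮ
    rw [Submodule.orthogonal_orthogonal, finrank_span_singleton, pow_one] at this
    · exact this
    · simp [v]

theorem ncard_rotations_Z4 : {Q | Q ∈ pointGroup Z4 ∧ IsRotation Q}.ncard = 192 := by
  obtain ⟨Q, hQ, hd⟩ := exists_reflection
  exact ncard_rotations_pointGroup hQ hd card_pointGroup_Z4 (by norm_num)

theorem ncard_rotations_D4s : {Q | Q ∈ pointGroup D4s ∧ IsRotation Q}.ncard = 576 := by
  obtain ⟨Q, hQ, hd⟩ := exists_reflection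
  exact ncard_rotations_pointGroup (pointGroup_Z4_le hQ) hd card_pointGroup_D4s (by norm_num)

theorem rotationImages_D4s {n : ℕ} (hn : Odd n) : rotationImages D4s n = toE4 '' latsOfIndex n := by
  obtain ⟨Q, hQ, hd⟩ := exists_reflection
  rw [rotationImages_eq (pointGroup_Z4_le hQ) hd, images_eq hn]

theorem finite_rotationImages_D4s (n : ℕ) : (rotationImages D4s n).Finite := by
  by_cases hn : Odd n
  · rw [rotationImages_D4s hn]; exact (ncard_latsOfIndex hn).1.image _
  · rw [rotationImages_D4s_of_not_odd hn]; exact Set.finite_empty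

theorem fRot_D4s {n : ℕ} (hn : Odd n) : fRot D4s n = cnt 2 n := by
  rw [fRot_eq_ncard, rotationImages_D4s hn, Set.ncard_image_of_injective _ toE4_injective,
    (ncard_latsOfIndex hn).2]

/-! ### Indices, classes and counts for ℤ⁴ -/

theorem coincIndex_Z4_eq {R : E4 ≃ₗᵢ[ℝ] E4} (hR : R ∈ OC D4s) (h : csl Z4 R = csl D4s R ⊓ Z4) :
    coincIndex Z4 R = coincIndex D4s R := by
  rw [coincIndex, h, relIndex_inf_Z4 (csl_le _ _) (odd_coincIndex hR), coincIndex]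

theorem coincIndex_Z4_eq_two_mul {R : E4 ≃ₗᵢ[ℝ] E4} (hR : R ∈ OC D4s)
    (h : csl Z4 R = csl D4s R ⊓ evenSub) : coincIndex Z4 R = 2 * coincIndex D4s R := by
  rw [coincIndex, h, relIndex_inf_evenSub (csl_le _ _) (odd_coincIndex hR), coincIndex]

theorem coincIndex_Z4_eq_or {R : E4 ≃ₗᵢ[ℝ] E4} (hR : R ∈ OC D4s) :
    coincIndex Z4 R = coincIndex D4s R ∨ coincIndex Z4 R = 2 * coincIndex D4s R :=
  (csl_Z4_eq_or hR).imp (coincIndex_Z4_eq hR) (coincIndex_Z4_eq_two_mul hR)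

theorem coincIndex_mul_cubicIso (R : E4 ≃ₗᵢ[ℝ] E4) (j : Fin 3) :
    coincIndex D4s (R * cubicIso j) = coincIndex D4s R :=
  coincIndex_mul (cubicIso_mem_pointGroup j)

theorem exists_perm_coincIndex {R : E4 ≃ₗᵢ[ℝ] E4} (hR : R ∈ OC D4s) : ∃ τ : Equiv.Perm (Fin 3),
    coincIndex Z4 (R * cubicIso (τ 0)) = coincIndex D4s R ∧
    ∀ i, i ≠ 0 → coincIndex Z4 (R * cubicIso (τ i)) = 2 * coincIndex D4s R := by
  obtain ⟨τ, h0, h⟩ := exists_perm_csl hR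
  refine ⟨τ, ?_, fun i hi => ?_⟩
  · rw [coincIndex_Z4_eq (mul_cubicIso_mem_OC hR _) (by rw [h0, csl_D4s_mul_cubicIso]),
      coincIndex_mul_cubicIso]
  · rw [coincIndex_Z4_eq_two_mul (mul_cubicIso_mem_OC hR _)
      (by rw [h i hi, csl_D4s_mul_cubicIso]), coincIndex_mul_cubicIso]

theorem image_D4s_eq_of_image_Z4_eq {R S : E4 ≃ₗᵢ[ℝ] E4} (h : image R Z4 = image S Z4) :
    image R D4s = image S D4s :=
  image_eq_image_iff.2 (pointGroup_Z4_le (image_eq_image_iff.1 h))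

theorem image_D4s_eq_iff {R S : E4 ≃ₗᵢ[ℝ] E4} :
    image S D4s = image R D4s ↔ ∃ j, image S Z4 = image (R * cubicIso j) Z4 := by
  constructor
  · intro h
    obtain ⟨j, hj⟩ := exists_cubic_of_mem_pointGroup (image_eq_image_iff.1 h.symm)
    refine ⟨j, ?_⟩
    rw [image_mul] at hj ⊢
    change _ = image R (cubic j)
    rw [← hj, ← image_mul, mul_inv_cancel, image_one]
  · rintro ⟨j, hj⟩
    rw [image_D4s_eq_of_image_Z4_eq hj, image_mul_of_mem (cubicIso_mem_pointGroup j)]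

theorem image_mul_cubicIso_injective (R : E4 ≃ₗᵢ[ℝ] E4) {i j : Fin 3}
    (h : image (R * cubicIso i) Z4 = image (R * cubicIso j) Z4) : i = j := by
  rw [image_mul, image_mul] at h
  exact cubic_injective (image_injective R h)

theorem symClass_D4s {R : E4 ≃ₗᵢ[ℝ] E4} (τ : Equiv.Perm (Fin 3)) :
    symClass D4s R = symClass Z4 (R * cubicIso (τ 0)) ∪ symClass Z4 (R * cubicIso (τ 1)) ∪
      symClass Z4 (R * cubicIso (τ 2)) := by
  ext S
  simp only [Set.mem_union, mem_symClass_iff, image_D4s_eq_iff]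
  rw [← τ.exists_congr_right, Fin.exists_fin_succ, Fin.exists_fin_succ, Fin.exists_fin_succ]
  simp only [Fin.succ_zero_eq_one, Fin.succ_one_eq_two, IsEmpty.exists_iff, or_false]
  tauto

theorem disjoint_symClass (R : E4 ≃ₗᵢ[ℝ] E4) {i j : Fin 3} (hij : i ≠ j) :
    Disjoint (symClass Z4 (R * cubicIso i)) (symClass Z4 (R * cubicIso j)) := by
  rw [Set.disjoint_left]
  intro S h h'
  exact hij (image_mul_cubicIso_injective R
    ((mem_symClass_iff.1 h).2.symm.trans (mem_symClass_iff.1 h').2))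

theorem splitting_symClass {R : E4 ≃ₗᵢ[ℝ] E4} (hR : R ∈ SOC D4s) : Odd (coincIndex D4s R) ∧
    ∃ R₁ ∈ symClass D4s R, ∃ R₂ ∈ symClass D4s R, ∃ R₃ ∈ symClass D4s R,
      symClass D4s R = symClass Z4 R₁ ∪ symClass Z4 R₂ ∪ symClass Z4 R₃ ∧
      Disjoint (symClass Z4 R₁) (symClass Z4 R₂) ∧
      Disjoint (symClass Z4 R₁) (symClass Z4 R₃) ∧
      Disjoint (symClass Z4 R₂) (symClass Z4 R₃) ∧
      (∀ R' ∈ symClass Z4 R₁, coincIndex Z4 R' = coincIndex D4s R) ∧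
      (∀ R' ∈ symClass Z4 R₂, coincIndex Z4 R' = 2 * coincIndex D4s R) ∧
      (∀ R' ∈ symClass Z4 R₃, coincIndex Z4 R' = 2 * coincIndex D4s R) := by
  obtain ⟨τ, h0, h⟩ := exists_perm_coincIndex hR.1
  have hmem : ∀ j, R * cubicIso j ∈ symClass D4s R := fun j =>
    ⟨hR.2.mul (isRotation_cubicIso j), _, cubicIso_mem_pointGroup j, rfl⟩
  have hidx : ∀ j, ∀ R' ∈ symClass Z4 (R * cubicIso j),
      coincIndex Z4 R' = coincIndex Z4 (R * cubicIso j) := fun j R' h =>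
    coincIndex_congr (mem_symClass_iff.1 h).2
  exact ⟨odd_coincIndex hR.1, _, hmem (τ 0), _, hmem (τ 1), _, hmem (τ 2), symClass_D4s τ,
    disjoint_symClass R (by simp), disjoint_symClass R (by simp), disjoint_symClass R (by simp),
    fun R' h' => (hidx _ R' h').trans h0,
    fun R' h' => (hidx _ R' h').trans (h 1 (by decide)),
    fun R' h' => (hidx _ R' h').trans (h 2 (by decide))⟩

theorem splitting_csl {Λ : AddSubgroup E4} (hΛ : Λ ∈ CSLs D4s) : Odd (Λ.relIndex D4s) ∧
    ∃ Λ₁ Λ₂ : AddSubgroup E4,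
      {Λ' | ∃ R ∈ OC D4s, csl D4s R = Λ ∧ csl Z4 R = Λ'} = {Λ₁, Λ₂} ∧
      Λ₁.relIndex Z4 = Λ.relIndex D4s ∧ Λ₂.relIndex Z4 = 2 * Λ.relIndex D4s := by
  obtain ⟨R, hR, rfl⟩ := hΛ
  have hodd := odd_coincIndex hR
  refine ⟨hodd, csl D4s R ⊓ Z4, csl D4s R ⊓ evenSub, ?_, relIndex_inf_Z4 (csl_le _ _) hodd,
    relIndex_inf_evenSub (csl_le _ _) hodd⟩
  obtain ⟨τ, h0, h⟩ := exists_perm_csl hR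
  ext Λ'
  constructor
  · rintro ⟨S, hS, h1, rfl⟩
    rw [← h1]
    exact csl_Z4_eq_or hS
  · rintro (rfl | rfl)
    · exact ⟨_, mul_cubicIso_mem_OC hR _, csl_D4s_mul_cubicIso R _, h0⟩
    · exact ⟨_, mul_cubicIso_mem_OC hR _, csl_D4s_mul_cubicIso R _, h 1 (by decide)⟩

/-- An image of ℤ⁴ amounts to an image L of D₄* with one of three labels, numbered by τ so that
label 0 has index m and labels 1, 2 have index 2m. As indices for D₄* are odd, parity tells the two
cases apart. -/
theorem fRot_Z4_aux {m : ℕ} (hm : Odd m) :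
    ((rotationImages Z4 m).Finite ∧ fRot Z4 m = fRot D4s m) ∧
    ((rotationImages Z4 (2 * m)).Finite ∧ fRot Z4 (2 * m) = 2 * fRot D4s m) := by
  have hm0 := hm.pos.ne'
  choose! g hg using fun (L : AddSubgroup E4) (hL : L ∈ rotationImages D4s m) => hL
  have hgOC : ∀ L ∈ rotationImages D4s m, g L ∈ OC D4s := fun L hL => (hg L hL).1.1.1
  choose! τ hτ using fun (L : AddSubgroup E4) (hL : L ∈ rotationImages D4s m) =>
    exists_perm_coincIndex (hgOC L hL)
  let F : AddSubgroup E4 × Fin 3 → AddSubgroup E4 :=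
    fun x => image (g x.1 * cubicIso (τ x.1 x.2)) Z4
  have hgL : ∀ L ∈ rotationImages D4s m, image (g L) D4s = L := fun L hL => (hg L hL).2
  have hF : Set.InjOn F (rotationImages D4s m ×ˢ Set.univ) := by
    rintro ⟨L, i⟩ ⟨hL, -⟩ ⟨L', i'⟩ ⟨hL', -⟩ h
    have h1 := image_D4s_eq_of_image_Z4_eq h
    rw [image_mul_of_mem (cubicIso_mem_pointGroup _),
      image_mul_of_mem (cubicIso_mem_pointGroup _), hgL L hL, hgL L' hL'] at h1
    subst h1
    exact congrArg (Prod.mk L) ((τ L).injective (image_mul_cubicIso_injective _ h))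
  have hgm : ∀ L ∈ rotationImages D4s m, coincIndex D4s (g L) = m := fun L hL => (hg L hL).1.2
  have himg : ∀ (n : ℕ) (T : Set (Fin 3)), n ≠ 0 →
      (∀ R, coincIndex Z4 R = n → R ∈ OC D4s → coincIndex D4s R = m) →
      (∀ L ∈ rotationImages D4s m, ∀ i,
        coincIndex Z4 (g L * cubicIso (τ L i)) = n ↔ i ∈ T) →
      rotationImages Z4 n = F '' (rotationImages D4s m ×ˢ T) := by
    intro n T hn0 hn hT
    ext Λ
    constructor
    · rintro ⟨R, hR, rfl⟩
      have hROC : R ∈ OC D4s := OC_Z4_eq ▸ hR.1.1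
      have hL : image R D4s ∈ rotationImages D4s m :=
        ⟨R, ⟨⟨hROC, hR.1.2⟩, hn R hR.2 hROC⟩, rfl⟩
      obtain ⟨j, hj⟩ := image_D4s_eq_iff.1 (hgL _ hL).symm
      refine ⟨(image R D4s, (τ (image R D4s)).symm j), ⟨hL, ?_⟩, ?_⟩
      · rw [← hT _ hL, Equiv.apply_symm_apply, ← coincIndex_congr hj, hR.2]
      · change image (g _ * cubicIso (τ _ ((τ _).symm j))) Z4 = _
        rw [Equiv.apply_symm_apply]
        exact hj.symm
    · rintro ⟨⟨L, i⟩, ⟨hL, hi⟩, rfl⟩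
      refine ⟨_, mem_OC_of_mem_rotationsOfIndex.2 ⟨hn0, ?_, (hT L hL i).2 hi⟩, rfl⟩
      exact (hg L hL).1.1.2.mul (isRotation_cubicIso _)
  have h1 := himg m {0} hm0 (fun R h1 h2 => by
      obtain ⟨k, hk⟩ := hm
      rcases coincIndex_Z4_eq_or h2 with h | h <;> omega) (fun L hL i => by
      have hτL := hτ L hL
      rw [hgm L hL] at hτL
      by_cases hi : i = 0
      · subst hi; simp [hτL.1]
      · simp [hi, hτL.2 i hi, hm0])
  have h2 := himg (2 * m) {1, 2} (by omega) (fun R h1 h2 => by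
      obtain ⟨k, hk⟩ := odd_coincIndex h2
      rcases coincIndex_Z4_eq_or h2 with h | h <;> omega) (fun L hL i => by
      have hτL := hτ L hL
      rw [hgm L hL] at hτL
      by_cases hi : i = 0
      · subst hi; simp [hτL.1]; omega
      · rw [hτL.2 i hi]
        have : i = 1 ∨ i = 2 := by omega
        simpa using this)
  have hfin := finite_rotationImages_D4s m
  rw [fRot_eq_ncard, fRot_eq_ncard, fRot_eq_ncard, h1, h2,
    (hF.mono (Set.prod_mono_right (Set.subset_univ _))).ncard_image,
    (hF.mono (Set.prod_mono_right (Set.subset_univ _))).ncard_image, Set.ncard_prod,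
    Set.ncard_prod, Set.ncard_singleton, Set.ncard_pair (by decide), mul_one, mul_comm]
  exact ⟨⟨(hfin.prod (Set.toFinite _)).image _, rfl⟩, (hfin.prod (Set.toFinite _)).image _, rfl⟩

theorem rotationImages_Z4_of_four_dvd {n : ℕ} (hn : 4 ∣ n) : rotationImages Z4 n = ∅ := by
  rw [rotationImages, Set.image_eq_empty, Set.eq_empty_iff_forall_notMem]
  rintro R ⟨⟨hR, -⟩, h⟩
  rw [OC_Z4_eq] at hR
  obtain ⟨k, hk⟩ := odd_coincIndex hR
  rcases coincIndex_Z4_eq_or hR with h' | h' <;> omega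

theorem odd_or_two_mul_odd_or_four_dvd (n : ℕ) : Odd n ∨ (∃ m, Odd m ∧ n = 2 * m) ∨ 4 ∣ n := by
  rcases Nat.even_or_odd' n with ⟨k, rfl | rfl⟩
  · rcases Nat.even_or_odd' k with ⟨l, rfl | rfl⟩
    · exact Or.inr (Or.inr ⟨l, by ring⟩)
    · exact Or.inr (Or.inl ⟨_, ⟨l, rfl⟩, rfl⟩)
  · exact Or.inl ⟨k, rfl⟩

theorem finite_rotationImages_Z4 (n : ℕ) : (rotationImages Z4 n).Finite := by
  rcases odd_or_two_mul_odd_or_four_dvd n with h | ⟨m, h, rfl⟩ | h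
  · exact (fRot_Z4_aux h).1.1
  · exact (fRot_Z4_aux h).2.1
  · rw [rotationImages_Z4_of_four_dvd h]; exact Set.finite_empty

theorem fRot_Z4_of_odd {n : ℕ} (hn : Odd n) : fRot Z4 n = cnt 2 n := by
  rw [(fRot_Z4_aux hn).1.2, fRot_D4s hn]

theorem fRot_Z4_two_mul {n : ℕ} (hn : Odd n) : fRot Z4 (2 * n) = 2 * cnt 2 n := by
  rw [(fRot_Z4_aux hn).2.2, fRot_D4s hn]

theorem fRot_Z4_of_four_dvd {n : ℕ} (hn : 4 ∣ n) : fRot Z4 n = 0 := by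
  rw [fRot_eq_ncard, rotationImages_Z4_of_four_dvd hn, Set.ncard_empty]

theorem CSLsOfIndex_Z4_of_four_dvd {n : ℕ} (hn : 4 ∣ n) : CSLsOfIndex Z4 n = ∅ := by
  rw [Set.eq_empty_iff_forall_notMem]
  rintro _ ⟨⟨R, hR, rfl⟩, h⟩
  rw [OC_Z4_eq] at hR
  change coincIndex Z4 R = n at h
  obtain ⟨k, hk⟩ := odd_coincIndex hR
  rcases coincIndex_Z4_eq_or hR with h' | h' <;> omega

theorem CSLsOfIndex_Z4 {m : ℕ} (hm : Odd m) :
    CSLsOfIndex Z4 m = (· ⊓ Z4) '' CSLsOfIndex D4s m ∧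
    CSLsOfIndex Z4 (2 * m) = (· ⊓ evenSub) '' CSLsOfIndex D4s m := by
  constructor
  · ext Λ
    constructor
    · rintro ⟨⟨R, hR, rfl⟩, h⟩
      rw [OC_Z4_eq] at hR
      change coincIndex Z4 R = m at h
      rcases csl_Z4_eq_or hR with h' | h'
      · exact ⟨csl D4s R, ⟨⟨R, hR, rfl⟩, (coincIndex_Z4_eq hR h').symm.trans h⟩, h'.symm⟩
      · obtain ⟨k, hk⟩ := hm
        have := coincIndex_Z4_eq_two_mul hR h'
        omega
    · rintro ⟨_, ⟨⟨R, hR, rfl⟩, h⟩, rfl⟩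
      obtain ⟨τ, h0, -⟩ := exists_perm_csl hR
      refine ⟨⟨_, OC_Z4_eq ▸ mul_cubicIso_mem_OC hR (τ 0), h0.symm⟩, ?_⟩
      rw [← h]
      exact relIndex_inf_Z4 (csl_le _ _) (odd_coincIndex hR)
  · ext Λ
    constructor
    · rintro ⟨⟨R, hR, rfl⟩, h⟩
      rw [OC_Z4_eq] at hR
      change coincIndex Z4 R = 2 * m at h
      rcases csl_Z4_eq_or hR with h' | h'
      · obtain ⟨k, hk⟩ := odd_coincIndex hR
        have := coincIndex_Z4_eq hR h'
        omega
      · have h3 := coincIndex_Z4_eq_two_mul hR h'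
        exact ⟨csl D4s R, ⟨⟨R, hR, rfl⟩, by
          change coincIndex D4s R = m
          omega⟩, h'.symm⟩
    · rintro ⟨_, ⟨⟨R, hR, rfl⟩, h⟩, rfl⟩
      obtain ⟨τ, -, h0⟩ := exists_perm_csl hR
      refine ⟨⟨_, OC_Z4_eq ▸ mul_cubicIso_mem_OC hR (τ 1), (h0 1 (by decide)).symm⟩, ?_⟩
      rw [← h]
      exact relIndex_inf_evenSub (csl_le _ _) (odd_coincIndex hR)

/-- Both intersections are CSLs of ℤ⁴, and these determine the CSL of D₄*. -/
theorem csl_inf_injOn (m : ℕ) : Set.InjOn (· ⊓ Z4) (CSLsOfIndex D4s m) ∧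
    Set.InjOn (· ⊓ evenSub) (CSLsOfIndex D4s m) := by
  constructor
  · rintro _ ⟨⟨R, hR, rfl⟩, -⟩ _ ⟨⟨S, hS, rfl⟩, -⟩ h
    obtain ⟨τ, h0, -⟩ := exists_perm_csl hR
    obtain ⟨σ, h0', -⟩ := exists_perm_csl hS
    have := csl_D4s_eq_of_csl_Z4_eq (mul_cubicIso_mem_OC hR _) (mul_cubicIso_mem_OC hS _)
      ((h0.trans h).trans h0'.symm)
    rwa [csl_D4s_mul_cubicIso, csl_D4s_mul_cubicIso] at this
  · rintro _ ⟨⟨R, hR, rfl⟩, -⟩ _ ⟨⟨S, hS, rfl⟩, -⟩ h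
    obtain ⟨τ, -, h0⟩ := exists_perm_csl hR
    obtain ⟨σ, -, h0'⟩ := exists_perm_csl hS
    have := csl_D4s_eq_of_csl_Z4_eq (mul_cubicIso_mem_OC hR _) (mul_cubicIso_mem_OC hS _)
      (((h0 1 (by decide)).trans h).trans (h0' 1 (by decide)).symm)
    rwa [csl_D4s_mul_cubicIso, csl_D4s_mul_cubicIso] at this

theorem finite_CSLsOfIndex_Z4 (n : ℕ) : (CSLsOfIndex Z4 n).Finite := by
  rcases odd_or_two_mul_odd_or_four_dvd n with h | ⟨m, h, rfl⟩ | h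
  · rw [(CSLsOfIndex_Z4 h).1]; exact (finite_CSLsOfIndex_D4s n).image _
  · rw [(CSLsOfIndex_Z4 h).2]; exact (finite_CSLsOfIndex_D4s m).image _
  · rw [CSLsOfIndex_Z4_of_four_dvd h]; exact Set.finite_empty

theorem fCSL_Z4_of_odd {n : ℕ} (hn : Odd n) : fCSL Z4 n = cnt 1 n := by
  rw [fCSL, (CSLsOfIndex_Z4 hn).1, (csl_inf_injOn n).1.ncard_image, ← fCSL_D4s hn, fCSL]

theorem fCSL_Z4_two_mul {n : ℕ} (hn : Odd n) : fCSL Z4 (2 * n) = cnt 1 n := by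
  rw [fCSL, (CSLsOfIndex_Z4 hn).2, (csl_inf_injOn n).2.ncard_image, ← fCSL_D4s hn, fCSL]

theorem fCSL_Z4_of_four_dvd {n : ℕ} (hn : 4 ∣ n) : fCSL Z4 n = 0 := by
  rw [fCSL, CSLsOfIndex_Z4_of_four_dvd hn, Set.ncard_empty]

/-! ### The coincidence spectrum -/

theorem psi_pos {n : ℕ} (hn : Odd n) : 0 < psi n := by
  induction n using Nat.recOnPosPrimePosCoprime with
  | zero => exact absurd hn (by decide)
  | one => rw [psi_one]; exact one_pos
  | prime_pow p k hp hk =>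
    obtain ⟨k, rfl⟩ := Nat.exists_eq_succ_of_ne_zero hk.ne'
    have hp2 : p ≠ 2 := by
      rintro rfl
      rw [Nat.odd_pow_iff (by omega)] at hn
      exact absurd hn (by decide)
    rw [Nat.succ_eq_add_one, psi_prime_pow hp hp2]
    have := hp.pos
    positivity
  | coprime a b ha hb hab iha ihb =>
    rw [Nat.odd_mul] at hn
    rw [psi_mul hn.1 hn.2 hab]
    exact Nat.mul_pos (iha hn.1) (ihb hn.2)

theorem exists_coincIndex_eq {m : ℕ} (hm : Odd m) : ∃ R ∈ OC D4s, coincIndex D4s R = m := by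
  have h1 : (primIdeals m).Nonempty := by
    rw [Set.nonempty_iff_ne_empty]
    intro h
    have := psi_pos hm
    rw [psi, h, Set.ncard_empty] at this
    exact lt_irrefl _ this
  obtain ⟨_, q, hq, hqn, -⟩ := h1
  -- Taking x = y = 1 and r = q, that is, conjugation by a primitive q of norm m, realises the index
  -- m.
  obtain ⟨R, hR, -⟩ := exists_iso_of_triple hm (t := (m, 1, 1))
    ((mem_triples hm.pos.ne').2 ⟨by simp, by simp⟩) (q := q) (r := q)
    ⟨hq, hq, by simpa using hqn, by simpa using hqn⟩
  exact ⟨R, by rw [mem_OC, hR]; exact hm.pos.ne', hR⟩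

theorem coincSpectrum_Z4 :
    coincSpectrum Z4 = {n | ∃ l m : ℕ, (l = 0 ∨ l = 1) ∧ Odd m ∧ n = 2 ^ l * m} := by
  ext n
  constructor
  · rintro ⟨R, hR, rfl⟩
    rw [OC_Z4_eq] at hR
    rcases coincIndex_Z4_eq_or hR with h | h
    · exact ⟨0, _, Or.inl rfl, odd_coincIndex hR, by rw [h, pow_zero, one_mul]⟩
    · exact ⟨1, _, Or.inr rfl, odd_coincIndex hR, by rw [h, pow_one]⟩
  · rintro ⟨l, m, hl, hm, rfl⟩
    obtain ⟨R, hR, rfl⟩ := exists_coincIndex_eq hm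
    obtain ⟨τ, h0, h1⟩ := exists_perm_coincIndex hR
    rcases hl with rfl | rfl
    · exact ⟨_, OC_Z4_eq ▸ mul_cubicIso_mem_OC hR (τ 0), by rw [h0, pow_zero, one_mul]⟩
    · exact ⟨_, OC_Z4_eq ▸ mul_cubicIso_mem_OC hR (τ 1), by rw [h1 1 (by decide), pow_one]⟩

/-! ### Arithmetic of the counting sums -/

/-- Divisors of mn are uniquely products of divisors of m and of n, recovered by taking gcds; this
splits triples entry by entry, and ψ is multiplicative. -/
theorem cnt_mul {e m n : ℕ} (hm : Odd m) (hn : Odd n) (h : m.Coprime n) :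
    cnt e (m * n) = cnt e m * cnt e n := by
  have hm0 := hm.pos.ne'
  have hn0 := hn.pos.ne'
  rw [cnt, cnt, cnt, Finset.sum_mul_sum, ← Finset.sum_product']
  symm
  have hsplit : ∀ k, k ∣ m * n → k.gcd m * k.gcd n = k := fun k hk => by
    rw [← Nat.Coprime.gcd_mul k h, Nat.gcd_eq_left hk]
  refine Finset.sum_bij' (fun u _ => (u.1.1 * u.2.1, u.1.2.1 * u.2.2.1, u.1.2.2 * u.2.2.2))
    (fun t _ => ((t.1.gcd m, t.2.1.gcd m, t.2.2.gcd m), (t.1.gcd n, t.2.1.gcd n, t.2.2.gcd n)))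
    ?_ ?_ ?_ ?_ ?_
  · rintro ⟨⟨g, x, y⟩, g', x', y'⟩ hu
    rw [Finset.mem_product, mem_triples hm0, mem_triples hn0] at hu
    obtain ⟨⟨h1, h2⟩, h3, h4⟩ := hu
    dsimp only at *
    rw [mem_triples (mul_ne_zero hm0 hn0)]
    dsimp only
    refine ⟨by rw [← h1, ← h3]; ring, ?_⟩
    have hx : x ∣ m := ⟨g * x * y ^ 2, by rw [← h1]; ring⟩
    have hy : y ∣ m := ⟨g * x ^ 2 * y, by rw [← h1]; ring⟩
    have hx' : x' ∣ n := ⟨g' * x' * y' ^ 2, by rw [← h3]; ring⟩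
    have hy' : y' ∣ n := ⟨g' * x' ^ 2 * y', by rw [← h3]; ring⟩
    exact Nat.Coprime.mul_left
      (Nat.Coprime.mul_right h2 (Nat.Coprime.coprime_dvd_left hx (Nat.Coprime.coprime_dvd_right hy' h)))
      (Nat.Coprime.mul_right
        (Nat.Coprime.coprime_dvd_left hx' (Nat.Coprime.coprime_dvd_right hy h.symm)) h4)
  · rintro ⟨g, x, y⟩ ht
    rw [mem_triples (mul_ne_zero hm0 hn0)] at ht
    obtain ⟨h1, h2⟩ := ht
    dsimp only at *
    have hg := hsplit g ⟨x ^ 2 * y ^ 2, by rw [← h1]; ring⟩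
    have hx := hsplit x ⟨g * x * y ^ 2, by rw [← h1]; ring⟩
    have hy := hsplit y ⟨g * x ^ 2 * y, by rw [← h1]; ring⟩
    have hAB : (g.gcd m * x.gcd m ^ 2 * y.gcd m ^ 2) * (g.gcd n * x.gcd n ^ 2 * y.gcd n ^ 2) =
        m * n := by
      rw [← h1]; conv_rhs => rw [← hg, ← hx, ← hy]
      ring
    have hA : (g.gcd m * x.gcd m ^ 2 * y.gcd m ^ 2) ∣ m := by
      refine Nat.Coprime.dvd_of_dvd_mul_right (n := n) ?_ (hAB ▸ dvd_mul_right _ _)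
      have : ∀ k : ℕ, (k.gcd m).Coprime n := fun k =>
        Nat.Coprime.coprime_dvd_left (Nat.gcd_dvd_right k m) h
      exact Nat.Coprime.mul_left (Nat.Coprime.mul_left (this g) ((this x).pow_left 2))
        ((this y).pow_left 2)
    have hB : (g.gcd n * x.gcd n ^ 2 * y.gcd n ^ 2) ∣ n := by
      refine Nat.Coprime.dvd_of_dvd_mul_left (m := m) ?_ (hAB ▸ dvd_mul_left _ _)
      have : ∀ k : ℕ, (k.gcd n).Coprime m := fun k =>
        Nat.Coprime.coprime_dvd_left (Nat.gcd_dvd_right k n) h.symm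
      exact Nat.Coprime.mul_left (Nat.Coprime.mul_left (this g) ((this x).pow_left 2))
        ((this y).pow_left 2)
    obtain ⟨a, ha⟩ := hA
    obtain ⟨b, hb⟩ := hB
    have hab : a * b = 1 := by
      apply Nat.eq_of_mul_eq_mul_left (Nat.pos_of_ne_zero (mul_ne_zero hm0 hn0))
      conv_rhs => rw [mul_one, ha, hb]
      rw [← hAB]; ring
    obtain ⟨rfl, rfl⟩ := mul_eq_one.1 hab
    rw [Finset.mem_product, mem_triples hm0, mem_triples hn0]
    dsimp only
    have hcop : ∀ k, (x.gcd k).Coprime (y.gcd k) := fun k =>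
      Nat.Coprime.coprime_dvd_left (Nat.gcd_dvd_left _ _)
        (Nat.Coprime.coprime_dvd_right (Nat.gcd_dvd_left _ _) h2)
    exact ⟨⟨by rw [mul_one] at ha; exact ha.symm, hcop m⟩,
      by rw [mul_one] at hb; exact hb.symm, hcop n⟩
  · rintro ⟨⟨g, x, y⟩, g', x', y'⟩ hu
    rw [Finset.mem_product, mem_triples hm0, mem_triples hn0] at hu
    obtain ⟨⟨h1, h2⟩, h3, h4⟩ := hu
    dsimp only at *
    have key : ∀ a b : ℕ, a ∣ m → b ∣ n → (a * b).gcd m = a ∧ (a * b).gcd n = b := by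
      intro a b ha hb
      constructor
      · rw [Nat.Coprime.gcd_mul_right_cancel a (Nat.Coprime.coprime_dvd_left hb h.symm),
          Nat.gcd_eq_left ha]
      · rw [Nat.Coprime.gcd_mul_left_cancel b (Nat.Coprime.coprime_dvd_left ha h),
          Nat.gcd_eq_left hb]
    obtain ⟨k1, k1'⟩ := key g g' ⟨x ^ 2 * y ^ 2, by rw [← h1]; ring⟩
      ⟨x' ^ 2 * y' ^ 2, by rw [← h3]; ring⟩
    obtain ⟨k2, k2'⟩ := key x x' ⟨g * x * y ^ 2, by rw [← h1]; ring⟩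
      ⟨g' * x' * y' ^ 2, by rw [← h3]; ring⟩
    obtain ⟨k3, k3'⟩ := key y y' ⟨g * x ^ 2 * y, by rw [← h1]; ring⟩
      ⟨g' * x' ^ 2 * y', by rw [← h3]; ring⟩
    rw [k1, k1', k2, k2', k3, k3']
  · rintro ⟨g, x, y⟩ ht
    rw [mem_triples (mul_ne_zero hm0 hn0)] at ht
    obtain ⟨h1, h2⟩ := ht
    dsimp only at *
    rw [hsplit g ⟨x ^ 2 * y ^ 2, by rw [← h1]; ring⟩,
      hsplit x ⟨g * x * y ^ 2, by rw [← h1]; ring⟩,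
      hsplit y ⟨g * x ^ 2 * y, by rw [← h1]; ring⟩]
  · rintro ⟨⟨g, x, y⟩, g', x', y'⟩ hu
    rw [Finset.mem_product] at hu
    obtain ⟨o1, o2, o3⟩ := odd_of_mem_triples hm hu.1
    obtain ⟨o1', o2', o3'⟩ := odd_of_mem_triples hn hu.2
    rw [mem_triples hm0, mem_triples hn0] at hu
    obtain ⟨⟨h1, h2⟩, h3, h4⟩ := hu
    dsimp only at *
    have hg : g ∣ m := ⟨x ^ 2 * y ^ 2, by rw [← h1]; ring⟩
    have hx : x ∣ m := ⟨g * x * y ^ 2, by rw [← h1]; ring⟩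
    have hy : y ∣ m := ⟨g * x ^ 2 * y, by rw [← h1]; ring⟩
    have hg' : g' ∣ n := ⟨x' ^ 2 * y' ^ 2, by rw [← h3]; ring⟩
    have hx' : x' ∣ n := ⟨g' * x' * y' ^ 2, by rw [← h3]; ring⟩
    have hy' : y' ∣ n := ⟨g' * x' ^ 2 * y', by rw [← h3]; ring⟩
    have key : ∀ {a b : ℕ}, a ∣ m → b ∣ n → a.Coprime b := fun ha hb =>
      Nat.Coprime.coprime_dvd_left ha (Nat.Coprime.coprime_dvd_right hb h)
    have key2 : ∀ {a b c d : ℕ}, a ∣ m → b ∣ m → c ∣ n → d ∣ n →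
        (a * b ^ e).Coprime (c * d ^ e) := fun ha hb hc hd =>
      Nat.Coprime.mul_left
        (Nat.Coprime.mul_right (key ha hc) ((key ha hd).pow_right e))
        (Nat.Coprime.mul_right ((key hb hc).pow_left e) ((key hb hd).pow e e))
    rw [show g * g' * (x * x') ^ e = (g * x ^ e) * (g' * x' ^ e) by ring,
      show g * g' * (y * y') ^ e = (g * y ^ e) * (g' * y' ^ e) by ring,
      psi_mul (o1.mul o2.pow) (o1'.mul o2'.pow) (key2 hg hx hg' hx'),
      psi_mul (o1.mul o3.pow) (o1'.mul o3'.pow) (key2 hg hy hg' hy')]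
    ring

/-- The contribution to `cnt e (p ^ r)` of the triples with `y = 1 ≠ x`. -/
noncomputable def cntAux (e p r : ℕ) : ℕ :=
  ∑ b ∈ Finset.range (r / 2),
    psi (p ^ (r - 2 * (b + 1) + e * (b + 1))) * psi (p ^ (r - 2 * (b + 1)))

/-- Raising a positive exponent by e multiplies ψ by pᵉ, so all terms but the first are pᵉ times
those for r. The condition e ≠ 0 keeps the exponent positive when g = 1. -/
theorem cntAux_add_two {e p : ℕ} (he : e ≠ 0) (hp : p.Prime) (hp2 : p ≠ 2) (r : ℕ) :
    cntAux e p (r + 2) = p ^ e * cntAux e p r + psi (p ^ (r + e)) * psi (p ^ r) := by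
  rw [cntAux, cntAux, show (r + 2) / 2 = r / 2 + 1 by omega, Finset.sum_range_succ', Finset.mul_sum]
  rw [show r + 2 - 2 * (0 + 1) = r by omega, zero_add, mul_one]
  congr 1
  refine Finset.sum_congr rfl fun b hb => ?_
  rw [Finset.mem_range] at hb
  have h1 : r + 2 - 2 * (b + 1 + 1) = r - 2 * (b + 1) := by omega
  have h2 : 0 < r - 2 * (b + 1) + e * (b + 1) :=
    Nat.add_pos_right _ (Nat.mul_pos (Nat.pos_of_ne_zero he) (Nat.succ_pos b))
  obtain ⟨k, hk⟩ := Nat.exists_eq_succ_of_ne_zero h2.ne'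
  rw [h1, mul_add e (b + 1) 1, ← add_assoc, hk, Nat.succ_eq_add_one, mul_one,
    show k + 1 + e = (k + e) + 1 by ring, psi_prime_pow hp hp2, psi_prime_pow hp hp2]
  ring

/-- Coprime powers of p cannot both differ from 1. The triples with x ≠ 1 and those with y ≠ 1
contribute equally, whence the factor 2. -/
theorem cnt_prime_pow (e : ℕ) {p : ℕ} (hp : p.Prime) (r : ℕ) :
    cnt e (p ^ r) = psi (p ^ r) ^ 2 + 2 * cntAux e p r := by
  have hpr : p ^ r ≠ 0 := (pow_pos hp.pos r).ne'
  have hinj := Nat.pow_right_injective hp.two_le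
  let A := (Finset.range (r / 2)).image fun b => (p ^ (r - 2 * (b + 1)), p ^ (b + 1), 1)
  let B := (Finset.range (r / 2)).image fun b => (p ^ (r - 2 * (b + 1)), 1, p ^ (b + 1))
  have hne : ∀ b : ℕ, p ^ (b + 1) ≠ 1 := fun b =>
    (Nat.one_lt_pow (Nat.succ_ne_zero b) hp.one_lt).ne'
  have htri : triples (p ^ r) = {(p ^ r, 1, 1)} ∪ (A ∪ B) := by
    ext ⟨g, x, y⟩
    rw [mem_triples hpr]
    simp only [A, B, Finset.mem_union, Finset.mem_singleton, Finset.mem_image, Finset.mem_range,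
      Prod.mk.injEq]
    constructor
    · rintro ⟨h1, h2⟩
      obtain ⟨c, -, rfl⟩ := (Nat.dvd_prime_pow hp).1
        (⟨x ^ 2 * y ^ 2, by rw [← h1]; ring⟩ : g ∣ p ^ r)
      obtain ⟨a, -, rfl⟩ := (Nat.dvd_prime_pow hp).1
        (⟨p ^ c * x * y ^ 2, by rw [← h1]; ring⟩ : x ∣ p ^ r)
      obtain ⟨b, -, rfl⟩ := (Nat.dvd_prime_pow hp).1
        (⟨p ^ c * (p ^ a) ^ 2 * y, by rw [← h1]; ring⟩ : y ∣ p ^ r)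
      have h3 : c + a * 2 + b * 2 = r := by
        apply hinj
        dsimp only
        rw [← h1]; ring
      rcases Nat.eq_zero_or_pos a with rfl | ha
      · rcases Nat.eq_zero_or_pos b with rfl | hb
        · left; simp [← h3]
        · right; right
          refine ⟨b - 1, by omega, ?_, by simp, ?_⟩ <;> congr 1 <;> omega
      · rcases Nat.eq_zero_or_pos b with rfl | hb
        · right; left
          refine ⟨a - 1, by omega, ?_, ?_, by simp⟩ <;> congr 1 <;> omega
        · have := Nat.Coprime.eq_one_of_dvd
            (Nat.Coprime.coprime_dvd_left (dvd_pow_self p ha.ne') h2) (dvd_pow_self p hb.ne')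
          exact absurd this hp.one_lt.ne'
    · have h3 : ∀ b, b < r / 2 → p ^ (r - 2 * (b + 1)) * (p ^ (b + 1)) ^ 2 = p ^ r := by
        intro b hb
        rw [← pow_mul, ← pow_add]; congr 1; omega
      rintro (⟨rfl, rfl, rfl⟩ | ⟨b, hb, rfl, rfl, rfl⟩ | ⟨b, hb, rfl, rfl, rfl⟩)
      · simp
      · exact ⟨by rw [one_pow, mul_one, h3 b hb], Nat.coprime_one_right _⟩
      · exact ⟨by rw [one_pow, mul_one, h3 b hb], Nat.coprime_one_left _⟩
  have hd1 : Disjoint A B := by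
    rw [Finset.disjoint_left]
    intro t hA hB
    obtain ⟨b, -, rfl⟩ := Finset.mem_image.1 hA
    obtain ⟨b', -, h⟩ := Finset.mem_image.1 hB
    simp only [Prod.mk.injEq] at h
    exact hne b h.2.1.symm
  have hd2 : Disjoint {(p ^ r, 1, 1)} (A ∪ B) := by
    rw [Finset.disjoint_singleton_left, Finset.mem_union]
    rintro (h | h)
    · obtain ⟨b, -, h⟩ := Finset.mem_image.1 h
      simp only [Prod.mk.injEq] at h
      exact hne b h.2.1
    · obtain ⟨b, -, h⟩ := Finset.mem_image.1 h
      simp only [Prod.mk.injEq] at h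
      exact hne b h.2.2
  rw [cnt, htri, Finset.sum_union hd2, Finset.sum_union hd1, Finset.sum_singleton,
    Finset.sum_image, Finset.sum_image, cntAux]
  · simp only [one_pow, mul_one, ← pow_mul, ← pow_add]
    rw [two_mul (Finset.sum _ _), sq]
    congr 2
    · exact Finset.sum_congr rfl fun b _ => by rw [mul_comm e]
    · exact Finset.sum_congr rfl fun b _ => by rw [mul_comm e, mul_comm]
  · intro b _ b' _ h
    simp only [Prod.mk.injEq] at h
    have := hinj h.2.2
    omega
  · intro b _ b' _ h
    simp only [Prod.mk.injEq] at h
    have := hinj h.2.1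
    omega

theorem cnt_one (e : ℕ) : cnt e 1 = 1 := by
  have := cnt_prime_pow e Nat.prime_three 0
  rw [pow_zero, psi_one] at this
  rw [this]; simp [cntAux]

theorem cnt_prime (e : ℕ) {p : ℕ} (hp : p.Prime) (hp2 : p ≠ 2) : cnt e p = (p + 1) ^ 2 := by
  have := cnt_prime_pow e hp 1
  have h2 := psi_prime_pow hp hp2 0
  rw [zero_add, pow_zero, one_mul] at h2
  rw [h2, pow_one] at this
  rw [this]; simp [cntAux]

theorem cnt_nine {e : ℕ} (he : e ≠ 0) : cnt e 9 = 144 + 8 * 3 ^ (e - 1) := by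
  obtain ⟨k, rfl⟩ := Nat.exists_eq_succ_of_ne_zero he
  have h := cnt_prime_pow (k + 1) Nat.prime_three 2
  rw [psi_prime_pow Nat.prime_three (by norm_num) 1] at h
  have h2 : cntAux (k + 1) 3 2 = 3 ^ k * 4 := by
    simp [cntAux, psi_prime_pow Nat.prime_three, psi_one]
  rw [h2] at h
  rw [Nat.succ_eq_add_one, show 9 = 3 ^ 2 by norm_num, h, Nat.add_sub_cancel]
  ring

/-! ### Multiplicativity and first values -/

theorem fRot_D4s_mul {m n : ℕ} (h : m.Coprime n) :
    fRot D4s (m * n) = fRot D4s m * fRot D4s n := by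
  by_cases hm : Odd m
  · by_cases hn : Odd n
    · rw [fRot_D4s hm, fRot_D4s hn, fRot_D4s (hm.mul hn), cnt_mul hm hn h]
    · rw [fRot_D4s_of_not_odd hn, fRot_D4s_of_not_odd (by rw [Nat.odd_mul]; tauto), mul_zero]
  · rw [fRot_D4s_of_not_odd hm, fRot_D4s_of_not_odd (by rw [Nat.odd_mul]; tauto), zero_mul]

theorem fRot_Z4_eq_of_odd {n : ℕ} (hn : Odd n) : fRot Z4 n = fRot D4s n := (fRot_Z4_aux hn).1.2

theorem fRot_Z4_two_mul_eq (n : ℕ) : fRot Z4 (2 * n) = 2 * fRot D4s n := by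
  by_cases hn : Odd n
  · exact (fRot_Z4_aux hn).2.2
  · obtain ⟨k, rfl⟩ := Nat.not_odd_iff_even.1 hn
    rw [fRot_D4s_of_not_odd hn, fRot_Z4_of_four_dvd ⟨k, by ring⟩]

theorem fCSL_Z4_eq_of_odd {n : ℕ} (hn : Odd n) : fCSL Z4 n = fCSL D4s n := by
  rw [fCSL_Z4_of_odd hn, fCSL_D4s hn]

theorem fCSL_Z4_two_mul_eq (n : ℕ) : fCSL Z4 (2 * n) = fCSL D4s n := by
  by_cases hn : Odd n
  · rw [fCSL_Z4_two_mul hn, fCSL_D4s hn]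
  · obtain ⟨k, rfl⟩ := Nat.not_odd_iff_even.1 hn
    rw [fCSL_D4s_of_not_odd hn, fCSL_Z4_of_four_dvd ⟨k, by ring⟩]

theorem fRot_Z4_one : fRot Z4 1 = 1 := by rw [fRot_Z4_of_odd odd_one, cnt_one]

/-- At most one of two coprime factors is even, and that factor alone carries the factor 2. -/
theorem fRot_Z4_mul {m n : ℕ} (h : m.Coprime n) : fRot Z4 (m * n) = fRot Z4 m * fRot Z4 n := by
  have key : ∀ {a n : ℕ}, (2 * a).Coprime n →
      fRot Z4 (2 * a * n) = fRot Z4 (2 * a) * fRot Z4 n := by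
    intro a n h
    have hn : Odd n := Nat.Coprime.odd_of_left (Nat.Coprime.coprime_dvd_left (dvd_mul_right 2 a) h)
    rw [mul_assoc, fRot_Z4_two_mul_eq, fRot_Z4_two_mul_eq, fRot_Z4_eq_of_odd hn,
      fRot_D4s_mul (Nat.Coprime.coprime_dvd_left (dvd_mul_left a 2) h), mul_assoc]
  rcases Nat.even_or_odd' m with ⟨a, rfl | hm⟩
  · exact key h
  rcases Nat.even_or_odd' n with ⟨b, rfl | hn⟩
  · rw [mul_comm, key h.symm, mul_comm]
  have hm' : Odd m := ⟨a, hm⟩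
  have hn' : Odd n := ⟨b, hn⟩
  rw [fRot_Z4_eq_of_odd hm', fRot_Z4_eq_of_odd hn', fRot_Z4_eq_of_odd (hm'.mul hn'),
    fRot_D4s_mul h]

theorem cnt_fifteen (e : ℕ) : cnt e 15 = 576 := by
  rw [show 15 = 3 * 5 by norm_num, cnt_mul (by decide) (by decide) (by decide),
    cnt_prime e Nat.prime_three (by norm_num), cnt_prime e Nat.prime_five (by norm_num)]
  norm_num

theorem fRot_Z4_values : (List.range' 1 17).map (fRot Z4) =
    [1, 2, 16, 0, 36, 32, 64, 0, 168, 72, 144, 0, 196, 128, 576, 0, 324] := by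
  have h2 := fRot_Z4_two_mul odd_one
  have h6 := fRot_Z4_two_mul (n := 3) (by decide)
  have h10 := fRot_Z4_two_mul (n := 5) (by decide)
  have h14 := fRot_Z4_two_mul (n := 7) (by decide)
  norm_num only at h2 h6 h10 h14
  have hcnt : ∀ p, p.Prime → p ≠ 2 → cnt 2 p = (p + 1) ^ 2 := fun p h h' => cnt_prime 2 h h'
  simp only [List.range', List.map_cons, List.map_nil, Nat.reduceAdd, h2, h6, h10, h14,
    fRot_Z4_of_four_dvd (n := 4) (by decide), fRot_Z4_of_four_dvd (n := 8) (by decide),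
    fRot_Z4_of_four_dvd (n := 12) (by decide), fRot_Z4_of_four_dvd (n := 16) (by decide),
    fRot_Z4_of_odd (n := 1) (by decide), fRot_Z4_of_odd (n := 3) (by decide),
    fRot_Z4_of_odd (n := 5) (by decide), fRot_Z4_of_odd (n := 7) (by decide),
    fRot_Z4_of_odd (n := 9) (by decide), fRot_Z4_of_odd (n := 11) (by decide),
    fRot_Z4_of_odd (n := 13) (by decide), fRot_Z4_of_odd (n := 15) (by decide),
    fRot_Z4_of_odd (n := 17) (by decide), cnt_one, cnt_nine two_ne_zero, cnt_fifteen,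
    hcnt 3 (by norm_num) (by norm_num), hcnt 5 (by norm_num) (by norm_num),
    hcnt 7 (by norm_num) (by norm_num), hcnt 11 (by norm_num) (by norm_num),
    hcnt 13 (by norm_num) (by norm_num), hcnt 17 (by norm_num) (by norm_num)]
  norm_num

theorem fCSL_Z4_values : (List.range' 1 17).map (fCSL Z4) =
    [1, 1, 16, 0, 36, 16, 64, 0, 152, 36, 144, 0, 196, 64, 576, 0, 324] := by
  have h2 := fCSL_Z4_two_mul odd_one
  have h6 := fCSL_Z4_two_mul (n := 3) (by decide)
  have h10 := fCSL_Z4_two_mul (n := 5) (by decide)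
  have h14 := fCSL_Z4_two_mul (n := 7) (by decide)
  norm_num only at h2 h6 h10 h14
  have hcnt : ∀ p, p.Prime → p ≠ 2 → cnt 1 p = (p + 1) ^ 2 := fun p h h' => cnt_prime 1 h h'
  simp only [List.range', List.map_cons, List.map_nil, Nat.reduceAdd, h2, h6, h10, h14,
    fCSL_Z4_of_four_dvd (n := 4) (by decide), fCSL_Z4_of_four_dvd (n := 8) (by decide),
    fCSL_Z4_of_four_dvd (n := 12) (by decide), fCSL_Z4_of_four_dvd (n := 16) (by decide),
    fCSL_Z4_of_odd (n := 1) (by decide), fCSL_Z4_of_odd (n := 3) (by decide),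
    fCSL_Z4_of_odd (n := 5) (by decide), fCSL_Z4_of_odd (n := 7) (by decide),
    fCSL_Z4_of_odd (n := 9) (by decide), fCSL_Z4_of_odd (n := 11) (by decide),
    fCSL_Z4_of_odd (n := 13) (by decide), fCSL_Z4_of_odd (n := 15) (by decide),
    fCSL_Z4_of_odd (n := 17) (by decide), cnt_one, cnt_nine one_ne_zero, cnt_fifteen,
    hcnt 3 (by norm_num) (by norm_num), hcnt 5 (by norm_num) (by norm_num),
    hcnt 7 (by norm_num) (by norm_num), hcnt 11 (by norm_num) (by norm_num),
    hcnt 13 (by norm_num) (by norm_num), hcnt 17 (by norm_num) (by norm_num)]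
  norm_num

/-! ### Growth bounds -/

/-- At p^(k+1) the value is p^k + p^(k+1), the sum of the two largest divisors. -/
theorem psi_le_sigma {n : ℕ} (hn : Odd n) : psi n ≤ ArithmeticFunction.sigma 1 n := by
  induction n using Nat.recOnPosPrimePosCoprime with
  | zero => exact absurd hn (by decide)
  | one => rw [psi_one]; simp
  | prime_pow p k hp hk =>
    obtain ⟨k, rfl⟩ := Nat.exists_eq_succ_of_ne_zero hk.ne'
    have hp2 : p ≠ 2 := by
      rintro rfl
      rw [Nat.odd_pow_iff (by omega)] at hn
      exact absurd hn (by decide)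
    rw [Nat.succ_eq_add_one, psi_prime_pow hp hp2, ArithmeticFunction.sigma_one_apply_prime_pow hp,
      Finset.sum_range_succ, Finset.sum_range_succ]
    have : p ^ k * (p + 1) = p ^ k + p ^ (k + 1) := by ring
    rw [this, add_assoc]
    exact Nat.le_add_left _ _
  | coprime a b ha hb hab iha ihb =>
    rw [Nat.odd_mul] at hn
    rw [psi_mul hn.1 hn.2 hab, ArithmeticFunction.isMultiplicative_sigma.map_mul_of_coprime hab]
    exact Nat.mul_le_mul (iha hn.1) (ihb hn.2)

/-- Bound the divisor sum of n/d termwise by (n/d)^(1+ε); the constant is ζ(1 + ε). -/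
theorem exists_psi_le {ε : ℝ} (hε : 0 < ε) :
    ∃ C : ℝ, 0 ≤ C ∧ ∀ n, Odd n → (psi n : ℝ) ≤ C * (n : ℝ) ^ (1 + ε) := by
  have hs : Summable fun d : ℕ => 1 / (d : ℝ) ^ (1 + ε) :=
    Real.summable_one_div_nat_rpow.2 (by linarith)
  refine ⟨∑' d : ℕ, 1 / (d : ℝ) ^ (1 + ε), tsum_nonneg fun d => by positivity, fun n hn => ?_⟩
  have hn0 : (0 : ℝ) < n := by exact_mod_cast hn.pos
  calc (psi n : ℝ) ≤ (∑ d ∈ n.divisors, d : ℕ) := by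
        exact_mod_cast (psi_le_sigma hn).trans_eq (ArithmeticFunction.sigma_one_apply n)
    _ = ∑ d ∈ n.divisors, ((n / d : ℕ) : ℝ) := by
        rw [Nat.cast_sum, Nat.sum_div_divisors n fun d => (d : ℝ)]
    _ ≤ ∑ d ∈ n.divisors, 1 / (d : ℝ) ^ (1 + ε) * (n : ℝ) ^ (1 + ε) := by
        refine Finset.sum_le_sum fun d hd => ?_
        have hd1 := Nat.dvd_of_mem_divisors hd
        have hd0 : (0 : ℝ) < d := by exact_mod_cast Nat.pos_of_mem_divisors hd
        have hdn : (1 : ℝ) ≤ n / d := by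
          rw [le_div_iff₀ hd0, one_mul]
          exact_mod_cast Nat.le_of_dvd hn.pos hd1
        rw [Nat.cast_div hd1 hd0.ne', one_div_mul_eq_div, ← Real.div_rpow hn0.le hd0.le]
        conv_lhs => rw [← Real.rpow_one ((n : ℝ) / d)]
        exact Real.rpow_le_rpow_of_exponent_le hdn (by linarith)
    _ = (∑ d ∈ n.divisors, 1 / (d : ℝ) ^ (1 + ε)) * (n : ℝ) ^ (1 + ε) := by
        rw [Finset.sum_mul]
    _ ≤ _ := by
        gcongr
        exact hs.sum_le_tsum _ fun d _ => by positivity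

/-- As g = n/(x²y²), the sum is at most ζ(2)²n. -/
theorem exists_sum_triples_le :
    ∃ D : ℝ, 0 ≤ D ∧ ∀ n, n ≠ 0 → ∑ t ∈ triples n, (t.1 : ℝ) ≤ D * n := by
  have hs : Summable fun d : ℕ => 1 / (d : ℝ) ^ 2 := Real.summable_one_div_nat_pow.2 one_lt_two
  have hZ : 0 ≤ ∑' d : ℕ, 1 / (d : ℝ) ^ 2 := tsum_nonneg fun d => by positivity
  refine ⟨(∑' d : ℕ, 1 / (d : ℝ) ^ 2) ^ 2, sq_nonneg _, fun n hn => ?_⟩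
  have h1 : ∀ t ∈ triples n, (t.1 : ℝ) = 1 / (t.2.1 : ℝ) ^ 2 * (1 / (t.2.2 : ℝ) ^ 2) * n ∧
      t.2 ∈ n.divisors ×ˢ n.divisors ∧ 0 < t.2.1 ^ 2 * t.2.2 ^ 2 := by
    intro t ht
    have ht' := (mem_triples hn).1 ht
    have hpos : t.2.1 ≠ 0 ∧ t.2.2 ≠ 0 := by
      constructor <;> intro h <;> apply hn <;> rw [← ht'.1, h] <;> simp
    refine ⟨?_, (Finset.mem_product.1 (Finset.mem_filter.1 ht).1).2, ?_⟩
    · have hx : (t.2.1 : ℝ) ≠ 0 := by exact_mod_cast hpos.1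
      have hy : (t.2.2 : ℝ) ≠ 0 := by exact_mod_cast hpos.2
      rw [← ht'.1]
      push_cast
      field_simp
    · have := Nat.pos_of_ne_zero hpos.1
      have := Nat.pos_of_ne_zero hpos.2
      positivity
  have hinj : Set.InjOn (Prod.snd : ℕ × ℕ × ℕ → ℕ × ℕ) (triples n) := by
    rintro ⟨g, u⟩ ht ⟨g', u'⟩ ht' h
    dsimp only at h
    subst h
    have e1 := ((mem_triples hn).1 ht).1
    have e2 := ((mem_triples hn).1 ht').1
    have e3 := (h1 _ ht).2.2
    dsimp only at e1 e2 e3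
    rw [← e2, mul_assoc, mul_assoc] at e1
    rw [Nat.eq_of_mul_eq_mul_right e3 e1]
  calc ∑ t ∈ triples n, (t.1 : ℝ)
      = (∑ t ∈ triples n, 1 / (t.2.1 : ℝ) ^ 2 * (1 / (t.2.2 : ℝ) ^ 2)) * n := by
        rw [Finset.sum_mul]; exact Finset.sum_congr rfl fun t ht => (h1 t ht).1
    _ = (∑ u ∈ (triples n).image Prod.snd, 1 / (u.1 : ℝ) ^ 2 * (1 / (u.2 : ℝ) ^ 2)) * n := by
        rw [Finset.sum_image hinj]
    _ ≤ (∑ u ∈ n.divisors ×ˢ n.divisors, 1 / (u.1 : ℝ) ^ 2 * (1 / (u.2 : ℝ) ^ 2)) * n := by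
        gcongr
        intro u hu
        obtain ⟨t, ht, rfl⟩ := Finset.mem_image.1 hu
        exact (h1 t ht).2.1
    _ = (∑ d ∈ n.divisors, 1 / (d : ℝ) ^ 2) ^ 2 * n := by
        rw [Finset.sum_product, sq, Finset.sum_mul_sum]
    _ ≤ _ := by
        gcongr
        exact hs.sum_le_tsum _ fun d _ => by positivity

/-- From (g x²)(g y²) = gn, each product of ψ-values is at most C²(gn)^(1+ε) ≤ C² n^(1+2ε) g, and
summing g costs one more factor n. The bound e ≤ 2 replaces xᵉ by x². -/
theorem exists_cnt_le {e : ℕ} (he : e ≤ 2) {ε : ℝ} (hε : 0 < ε) :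
    ∃ C : ℝ, ∀ n, Odd n → (cnt e n : ℝ) ≤ C * (n : ℝ) ^ (2 + 2 * ε) := by
  obtain ⟨C, hC, hpsi⟩ := exists_psi_le hε
  obtain ⟨D, hD, hsum⟩ := exists_sum_triples_le
  refine ⟨C ^ 2 * D, fun n hn => ?_⟩
  have hn0 : (0 : ℝ) < n := by exact_mod_cast hn.pos
  have hpow : ∀ {g x : ℕ}, Odd g → Odd x →
      (psi (g * x ^ e) : ℝ) ≤ C * ((g : ℝ) * (x : ℝ) ^ 2) ^ (1 + ε) := by
    intro g x hg hx
    refine (hpsi _ (hg.mul hx.pow)).trans ?_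
    have hx1 : (1 : ℝ) ≤ x := by exact_mod_cast hx.pos
    push_cast
    gcongr
  have hterm : ∀ t ∈ triples n, (psi (t.1 * t.2.1 ^ e) * psi (t.1 * t.2.2 ^ e) : ℝ) ≤
      C ^ 2 * (n : ℝ) ^ (1 + 2 * ε) * t.1 := by
    intro t ht
    obtain ⟨o1, o2, o3⟩ := odd_of_mem_triples hn ht
    have h1 := ((mem_triples hn.pos.ne').1 ht).1
    have hg0 : (0 : ℝ) < t.1 := by exact_mod_cast o1.pos
    have hgn : (t.1 : ℝ) ≤ n := by
      exact_mod_cast Nat.le_of_dvd hn.pos ⟨t.2.1 ^ 2 * t.2.2 ^ 2, by rw [← h1]; ring⟩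
    have hprod : ((t.1 : ℝ) * (t.2.1 : ℝ) ^ 2) * ((t.1 : ℝ) * (t.2.2 : ℝ) ^ 2) = t.1 * n := by
      rw [← h1]; push_cast; ring
    calc (psi (t.1 * t.2.1 ^ e) * psi (t.1 * t.2.2 ^ e) : ℝ)
        ≤ (C * ((t.1 : ℝ) * (t.2.1 : ℝ) ^ 2) ^ (1 + ε)) *
          (C * ((t.1 : ℝ) * (t.2.2 : ℝ) ^ 2) ^ (1 + ε)) := by
          gcongr
          · exact hpow o1 o2
          · exact hpow o1 o3
      _ = C ^ 2 * (t.1 * n : ℝ) ^ (1 + ε) := by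
          rw [← hprod, Real.mul_rpow (x := t.1 * (t.2.1 : ℝ) ^ 2) (by positivity) (by positivity)]
          ring
      _ = C ^ 2 * ((t.1 : ℝ) ^ ε * (n : ℝ) ^ (1 + ε)) * t.1 := by
          rw [Real.mul_rpow hg0.le hn0.le, Real.rpow_add hg0, Real.rpow_one]; ring
      _ ≤ C ^ 2 * ((n : ℝ) ^ ε * (n : ℝ) ^ (1 + ε)) * t.1 := by gcongr
      _ = _ := by rw [← Real.rpow_add hn0]; congr 3; ring
  calc (cnt e n : ℝ) = ∑ t ∈ triples n, (psi (t.1 * t.2.1 ^ e) * psi (t.1 * t.2.2 ^ e) : ℝ) := by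
        rw [cnt]; push_cast; rfl
    _ ≤ ∑ t ∈ triples n, C ^ 2 * (n : ℝ) ^ (1 + 2 * ε) * t.1 := Finset.sum_le_sum hterm
    _ = C ^ 2 * (n : ℝ) ^ (1 + 2 * ε) * ∑ t ∈ triples n, (t.1 : ℝ) := by rw [Finset.mul_sum]
    _ ≤ C ^ 2 * (n : ℝ) ^ (1 + 2 * ε) * (D * n) := by
        gcongr
        exact hsum n hn.pos.ne'
    _ = C ^ 2 * D * ((n : ℝ) ^ (1 + 2 * ε) * (n : ℝ) ^ (1 : ℝ)) := by rw [Real.rpow_one]; ring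
    _ = _ := by rw [← Real.rpow_add hn0]; congr 2; ring

/-! ### Dirichlet series and Euler products -/

/-- The sequence `cnt e` on odd numbers, extended by zero. -/
def IsOddCount (e : ℕ) (f : ℕ → ℕ) : Prop := ∀ n, f n = if Odd n then cnt e n else 0

theorem IsOddCount.lseriesSummable {e : ℕ} {f : ℕ → ℕ} (hf : IsOddCount e f) (he : e ≤ 2) {s : ℂ}
    (hs : 3 < s.re) : LSeriesSummable (fun n => (f n : ℂ)) s := by
  -- With this ε the bound has exponent 2 + (Re s - 3)/2, which is one less than a number between 3
  -- and Re s.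
  obtain ⟨C, hC⟩ := exists_cnt_le he (ε := (s.re - 3) / 4) (by linarith)
  have hC0 : 0 ≤ C := by
    have := hC 1 odd_one
    rw [Nat.cast_one, Real.one_rpow, mul_one] at this
    exact (Nat.cast_nonneg _).trans this
  refine LSeriesSummable_of_le_const_mul_rpow (x := 3 + (s.re - 3) / 2) (by linarith)
    ⟨C, fun n hn => ?_⟩
  rw [Complex.norm_natCast, hf n, show 3 + (s.re - 3) / 2 - 1 = 2 + 2 * ((s.re - 3) / 4) by ring]
  split_ifs with h
  · exact hC n h
  · rw [Nat.cast_zero]; positivity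

theorem natCast_pow_cpow (p r : ℕ) (s : ℂ) : ((p ^ r : ℕ) : ℂ) ^ s = ((p : ℂ) ^ s) ^ r := by
  induction r with
  | zero => simp
  | succ r ih =>
    rw [pow_succ, Nat.cast_mul, Complex.natCast_mul_natCast_cpow, ih, pow_succ]

/-- The generating function of `cnt e` along the powers of a prime. -/
theorem tsum_cnt_prime_pow {e p : ℕ} (he : e ≠ 0) (hp : p.Prime) (hp2 : p ≠ 2) {X : ℂ}
    (hX : ‖(p : ℂ) ^ 2 * X‖ < 1) (hsum : Summable fun r => (cnt e (p ^ r) : ℂ) * X ^ r) :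
    (∑' r, (cnt e (p ^ r) : ℂ) * X ^ r) * ((1 - p ^ 2 * X) * (1 - p ^ e * X ^ 2)) =
      ((1 - p ^ 2 * X) + (p + 1) ^ 2 * X) * (1 - p ^ e * X ^ 2) +
      2 * X ^ 2 * (p ^ (e - 1) * (p + 1) * (1 - p ^ 2 * X) + p ^ e * (p + 1) ^ 2 * X) := by
  obtain ⟨k, rfl⟩ := Nat.exists_eq_succ_of_ne_zero he
  rw [Nat.succ_eq_add_one, Nat.add_sub_cancel] at *
  have hne : 1 - (p : ℂ) ^ 2 * X ≠ 0 := by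
    intro h
    rw [← sub_eq_zero.1 h, norm_one] at hX
    exact lt_irrefl _ hX
  have hgeo := hasSum_geometric_of_norm_lt_one hX
  have hpsi : ∀ r, (psi (p ^ (r + 1)) : ℂ) = p ^ r * (p + 1) := fun r => by
    rw [psi_prime_pow hp hp2]; push_cast; rfl
  have hH : HasSum (fun r => (psi (p ^ r) : ℂ) ^ 2 * X ^ r)
      (1 + (p + 1) ^ 2 * X * (1 - p ^ 2 * X)⁻¹) := by
    -- The term at exponent zero is split off, as ψ follows the geometric law on positive powers of
    -- p only.
    rw [← hasSum_nat_add_iff' 1]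
    simp only [Finset.range_one, Finset.sum_singleton, pow_zero, psi_one, Nat.cast_one, one_pow,
      mul_one, add_sub_cancel_left]
    refine (hgeo.mul_left ((p + 1) ^ 2 * X)).congr_fun fun r => ?_
    rw [hpsi]; ring
  have hK : HasSum (fun r => (psi (p ^ (r + (k + 1))) * psi (p ^ r) : ℂ) * X ^ r)
      (p ^ k * (p + 1) + p ^ (k + 1) * (p + 1) ^ 2 * X * (1 - p ^ 2 * X)⁻¹) := by
    rw [← hasSum_nat_add_iff' 1]
    simp only [Finset.range_one, Finset.sum_singleton, pow_zero, psi_one, Nat.cast_one, zero_add,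
      mul_one, hpsi, add_sub_cancel_left]
    refine (hgeo.mul_left (p ^ (k + 1) * (p + 1) ^ 2 * X)).congr_fun fun r => ?_
    rw [show r + 1 + (k + 1) = (r + k + 1) + 1 by ring, hpsi]; ring
  have hcnt : ∀ r, (cnt (k + 1) (p ^ r) : ℂ) * X ^ r =
      (psi (p ^ r) : ℂ) ^ 2 * X ^ r + 2 * ((cntAux (k + 1) p r : ℂ) * X ^ r) := fun r => by
    rw [cnt_prime_pow _ hp]; push_cast; ring
  have hT : Summable fun r => (cntAux (k + 1) p r : ℂ) * X ^ r := by
    have := (hsum.sub hH.summable).mul_left (1 / 2)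
    refine this.congr fun r => ?_
    rw [hcnt]; ring
  have hT2 := hT.sum_add_tsum_nat_add 2
  have h0 : cntAux (k + 1) p 0 = 0 := by simp [cntAux]
  have h1 : cntAux (k + 1) p 1 = 0 := by simp [cntAux]
  -- Summed over r, the recursion reads T = X²(pᵉT + K), which determines T up to the factor 1 -
  -- pᵉX².
  have hstep : ∀ r, (cntAux (k + 1) p (r + 2) : ℂ) * X ^ (r + 2) =
      X ^ 2 * (p ^ (k + 1) * ((cntAux (k + 1) p r : ℂ) * X ^ r)) +
        X ^ 2 * ((psi (p ^ (r + (k + 1))) * psi (p ^ r) : ℂ) * X ^ r) := fun r => by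
    rw [cntAux_add_two he hp hp2]; push_cast; ring
  rw [Finset.sum_range_succ, Finset.sum_range_one, h0, h1, Nat.cast_zero, zero_mul, zero_mul,
    zero_add, zero_add, tsum_congr hstep,
    Summable.tsum_add ((hT.mul_left _).mul_left _) (hK.summable.mul_left _), tsum_mul_left,
    tsum_mul_left, tsum_mul_left, hK.tsum_eq] at hT2
  rw [tsum_congr hcnt, Summable.tsum_add hH.summable (hT.mul_left 2), tsum_mul_left, hH.tsum_eq]
  have hw : (1 - (p : ℂ) ^ 2 * X)⁻¹ * (1 - p ^ 2 * X) = 1 := inv_mul_cancel₀ hne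
  linear_combination (-2 * (1 - p ^ 2 * X)) * hT2 +
    ((p + 1) ^ 2 * X * (1 - p ^ (k + 1) * X ^ 2) + 2 * X ^ 3 * p ^ (k + 1) * (p + 1) ^ 2) * hw

theorem isOddCount_fRot : IsOddCount 2 (fRot D4s) := fun n => by
  split_ifs with h
  exacts [fRot_D4s h, fRot_D4s_of_not_odd h]

theorem isOddCount_fCSL : IsOddCount 1 (fCSL D4s) := fun n => by
  split_ifs with h
  exacts [fCSL_D4s h, fCSL_D4s_of_not_odd h]

theorem IsOddCount.mul {e : ℕ} {f : ℕ → ℕ} (hf : IsOddCount e f) {m n : ℕ} (h : m.Coprime n) :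
    f (m * n) = f m * f n := by
  rw [hf, hf, hf]
  by_cases hm : Odd m
  · by_cases hn : Odd n
    · rw [if_pos hm, if_pos hn, if_pos (hm.mul hn), cnt_mul hm hn h]
    · rw [if_neg hn, if_neg (by rw [Nat.odd_mul]; tauto), mul_zero]
  · rw [if_neg hm, if_neg (by rw [Nat.odd_mul]; tauto), zero_mul]

theorem term_mul (f : ℕ → ℕ) (s : ℂ) {m n : ℕ} (h : f (m * n) = f m * f n) :
    LSeries.term (fun n => (f n : ℂ)) s (m * n) =
      LSeries.term (fun n => (f n : ℂ)) s m * LSeries.term (fun n => (f n : ℂ)) s n := by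
  rcases eq_or_ne m 0 with rfl | hm
  · simp
  rcases eq_or_ne n 0 with rfl | hn
  · simp
  rw [LSeries.term_of_ne_zero (mul_ne_zero hm hn), LSeries.term_of_ne_zero hm,
    LSeries.term_of_ne_zero hn, h, Nat.cast_mul, Nat.cast_mul, Complex.natCast_mul_natCast_cpow,
    div_mul_div_comm]

/-- The general Euler product runs over all primes; the factor at 2 is 1 because f vanishes on
positive powers of two. -/
theorem IsOddCount.hasProd {e : ℕ} {f : ℕ → ℕ} (hf : IsOddCount e f) (he : e ≤ 2) {s : ℂ}
    (hs : 3 < s.re) : HasProd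
      (fun p : OddPrime => ∑' r, LSeries.term (fun n => (f n : ℂ)) s ((p : ℕ) ^ r))
      (LSeries (fun n => (f n : ℂ)) s) := by
  have hsum := hf.lseriesSummable he hs
  have h1 : f 1 = 1 := by rw [hf, if_pos odd_one, cnt_one]
  have hprod := EulerProduct.eulerProduct_hasProd (f := LSeries.term (fun n => (f n : ℂ)) s)
    (by rw [LSeries.term_of_ne_zero one_ne_zero, h1]; simp)
    (fun {m n} h => term_mul f s (hf.mul h)) hsum.norm (LSeries.term_zero _ _)
  let i : OddPrime → Nat.Primes := fun p => ⟨p.1, p.2.1⟩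
  have hi : Function.Injective i := fun p q h =>
    Subtype.ext (congrArg (fun x : Nat.Primes => (x : ℕ)) h)
  refine (hi.hasProd_iff fun p hp => ?_).2 hprod
  have hp2 : (p : ℕ) = 2 := by
    by_contra h
    exact hp ⟨⟨p.1, p.2, h⟩, rfl⟩
  rw [hp2, tsum_eq_single 0]
  · rw [pow_zero, LSeries.term_of_ne_zero one_ne_zero, h1]; simp
  · intro r hr
    rw [LSeries.term_of_ne_zero (pow_pos two_pos r).ne', hf, if_neg]
    · simp
    · rw [Nat.odd_pow_iff hr]; decide

theorem norm_sq_mul_cpow_lt_one {p : ℕ} (hp : p.Prime) {s : ℂ} (hs : 3 < s.re) :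
    ‖(p : ℂ) ^ 2 * (p : ℂ) ^ (-s)‖ < 1 := by
  have hp1 : (1 : ℝ) < p := by exact_mod_cast hp.one_lt
  rw [norm_mul, norm_pow, Complex.norm_natCast, Complex.norm_natCast_cpow_of_pos hp.pos,
    ← Real.rpow_natCast, ← Real.rpow_add (by linarith)]
  refine Real.rpow_lt_one_of_one_lt_of_neg hp1 ?_
  rw [Complex.neg_re]
  push_cast
  linarith

theorem IsOddCount.tsum_mul {e : ℕ} {f : ℕ → ℕ} (hf : IsOddCount e f) (he0 : e ≠ 0) (he : e ≤ 2)
    {s : ℂ} (hs : 3 < s.re) (p : OddPrime) {X : ℂ} (hX : (p : ℂ) ^ (-s) = X) :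
    (∑' r, LSeries.term (fun n => (f n : ℂ)) s ((p : ℕ) ^ r)) *
        ((1 - (p : ℂ) ^ 2 * X) * (1 - (p : ℂ) ^ e * X ^ 2)) =
      ((1 - (p : ℂ) ^ 2 * X) + (p + 1) ^ 2 * X) * (1 - (p : ℂ) ^ e * X ^ 2) +
      2 * X ^ 2 * ((p : ℂ) ^ (e - 1) * (p + 1) * (1 - (p : ℂ) ^ 2 * X) +
        (p : ℂ) ^ e * (p + 1) ^ 2 * X) := by
  obtain ⟨p, hp, hp2⟩ := p
  dsimp only at *
  have hterm : ∀ r, LSeries.term (fun n => (f n : ℂ)) s (p ^ r) = (cnt e (p ^ r) : ℂ) * X ^ r := by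
    intro r
    rw [LSeries.term_of_ne_zero (pow_pos hp.pos r).ne', hf, if_pos (hp.odd_of_ne_two hp2).pow,
      natCast_pow_cpow, ← hX, Complex.cpow_neg, inv_pow, div_eq_mul_inv]
  rw [tsum_congr hterm]
  refine tsum_cnt_prime_pow he0 hp hp2 (by rw [← hX]; exact norm_sq_mul_cpow_lt_one hp hs) ?_
  have h1 := (hf.lseriesSummable he hs).comp_injective (Nat.pow_right_injective hp.two_le)
  exact h1.congr hterm

theorem cpow_sub_eq {p : ℕ} (hp : p.Prime) (k : ℕ) (s : ℂ) :
    (p : ℂ) ^ ((k : ℂ) - s) = (p : ℂ) ^ k * (p : ℂ) ^ (-s) := by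
  have hp0 : (p : ℂ) ≠ 0 := by exact_mod_cast hp.ne_zero
  rw [sub_eq_add_neg, Complex.cpow_add _ _ hp0, Complex.cpow_natCast]

theorem cpow_mul_eq {p : ℕ} (k : ℕ) (s : ℂ) : (p : ℂ) ^ (-(k : ℂ) * s) = ((p : ℂ) ^ (-s)) ^ k := by
  rw [neg_mul, ← mul_neg, Complex.cpow_nat_mul]

theorem one_sub_ne_zero {z : ℂ} (h : ‖z‖ < 1) : 1 - z ≠ 0 := by
  intro h0
  rw [← sub_eq_zero.1 h0, norm_one] at h
  exact lt_irrefl _ h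

theorem factor_ne_zero {p : ℕ} (hp : p.Prime) {X : ℂ} (h : ‖(p : ℂ) ^ 2 * X‖ < 1) :
    1 - (p : ℂ) ^ 2 * X ≠ 0 ∧ 1 - (p : ℂ) * X ≠ 0 ∧ 1 + (p : ℂ) * X ≠ 0 ∧
      1 - (p : ℂ) * X ^ 2 ≠ 0 := by
  have hp1 : (1 : ℝ) ≤ p := by exact_mod_cast hp.one_le
  have h1 : ‖(p : ℂ) * X‖ < 1 := by
    refine lt_of_le_of_lt ?_ h
    rw [norm_mul, norm_mul, norm_pow, Complex.norm_natCast]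
    gcongr
    exact le_self_pow₀ hp1 two_ne_zero
  have h2 : ‖X‖ ≤ 1 := by
    refine le_trans ?_ h1.le
    rw [norm_mul, Complex.norm_natCast]
    exact le_mul_of_one_le_left (norm_nonneg _) hp1
  refine ⟨one_sub_ne_zero h, one_sub_ne_zero h1, ?_, one_sub_ne_zero ?_⟩
  · rw [← sub_neg_eq_add]
    exact one_sub_ne_zero (by rwa [norm_neg])
  · rw [sq, ← mul_assoc, norm_mul]
    exact mul_lt_one_of_nonneg_of_lt_one_left (norm_nonneg _) h1 h2

theorem hasProd_fRot {s : ℂ} (hs : 3 < s.re) :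
    HasProd (rotFactor s) (dirichlet (fRot D4s) s) := by
  rw [dirichlet]
  convert isOddCount_fRot.hasProd le_rfl hs using 1
  funext p
  have h := isOddCount_fRot.tsum_mul two_ne_zero le_rfl hs p rfl
  obtain ⟨h1, h2, h3, -⟩ := factor_ne_zero p.2.1 (norm_sq_mul_cpow_lt_one p.2.1 hs)
  have e1 := cpow_sub_eq p.2.1 1 s
  have e2 := cpow_sub_eq p.2.1 2 s
  push_cast at e1 e2
  rw [rotFactor, e1, e2]
  generalize (p : ℂ) ^ (-s) = X at *
  rw [pow_one, div_eq_iff (mul_ne_zero h2 h1)]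
  have h4 : (1 : ℂ) + p * X ≠ 0 := h3
  -- For e = 2 the denominator 1 - p²X² contains 1 + pX, which cancels against the numerator.
  apply mul_right_cancel₀ h4
  linear_combination -h

theorem hasProd_fCSL {s : ℂ} (hs : 3 < s.re) :
    HasProd (cslFactor s) (dirichlet (fCSL D4s) s) := by
  rw [dirichlet]
  convert isOddCount_fCSL.hasProd one_le_two hs using 1
  funext p
  have h := isOddCount_fCSL.tsum_mul one_ne_zero one_le_two hs p rfl
  obtain ⟨h1, -, -, h4⟩ := factor_ne_zero p.2.1 (norm_sq_mul_cpow_lt_one p.2.1 hs)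
  have hp0 : (p : ℂ) ≠ 0 := by exact_mod_cast p.2.1.ne_zero
  have e1 := cpow_sub_eq p.2.1 1 s
  have e2 := cpow_sub_eq p.2.1 2 s
  have e3 := cpow_mul_eq (p := p) 2 s
  have e4 : (p : ℂ) ^ (1 - 2 * s) = p * ((p : ℂ) ^ (-s)) ^ 2 := by
    rw [sub_eq_add_neg, Complex.cpow_add _ _ hp0, Complex.cpow_one, ← e3]; push_cast; ring_nf
  have e5 : (p : ℂ) ^ (1 - 3 * s) = p * ((p : ℂ) ^ (-s)) ^ 3 := by
    rw [sub_eq_add_neg, Complex.cpow_add _ _ hp0, Complex.cpow_one, ← cpow_mul_eq]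
    push_cast; ring_nf
  push_cast at e1 e2 e3
  rw [cslFactor, e1, e2, e3, e4, e5]
  generalize (p : ℂ) ^ (-s) = X at *
  rw [div_eq_iff (mul_ne_zero h1 h4)]
  linear_combination -h

/-- Adding a multiple of an odd-supported sequence at the even numbers. -/
theorem lseries_double {f g : ℕ → ℕ} {w : ℕ} (hodd : ∀ n, Odd n → f n = g n)
    (heven : ∀ n, f (2 * n) = w * g n) (hg : ∀ n, ¬Odd n → g n = 0) {s : ℂ}
    (hs : LSeriesSummable (fun n => (g n : ℂ)) s) :
    LSeriesSummable (fun n => (f n : ℂ)) s ∧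
      dirichlet f s = (1 + w * 2 ^ (-s)) * dirichlet g s := by
  have hi : Function.Injective fun n : ℕ => 2 * n := mul_right_injective₀ two_ne_zero
  -- The even-indexed part of the series is w·2^(-s) times the series of g, by substituting 2n for
  -- n.
  let b : ℕ → ℂ := fun n => if Odd n then 0 else LSeries.term (fun n => (f n : ℂ)) s n
  have hb : HasSum b (w * 2 ^ (-s) * dirichlet g s) := by
    rw [← hi.hasSum_iff]
    · refine ((hs.hasSum).mul_left (w * 2 ^ (-s) : ℂ)).congr_fun fun n => ?_
      have hn : ¬Odd (2 * n) := by simp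
      change (if Odd (2 * n) then 0 else _) = _
      rw [if_neg hn]
      rcases eq_or_ne n 0 with rfl | hn0
      · simp
      · rw [LSeries.term_of_ne_zero (mul_ne_zero two_ne_zero hn0), LSeries.term_of_ne_zero hn0, heven, Nat.cast_mul,
          Nat.cast_mul, Complex.natCast_mul_natCast_cpow, Complex.cpow_neg]
        push_cast
        field_simp
    · intro n hn
      refine if_pos ?_
      by_contra h
      obtain ⟨k, rfl⟩ := Nat.not_odd_iff_even.1 h
      exact hn ⟨k, by dsimp only; ring⟩
  have hsum : HasSum (LSeries.term (fun n => (f n : ℂ)) s)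
      (dirichlet g s + w * 2 ^ (-s) * dirichlet g s) := by
    refine (hs.hasSum.add hb).congr_fun fun n => ?_
    by_cases hn : Odd n
    · have : b n = 0 := if_pos hn
      rw [this, add_zero, LSeries.term_of_ne_zero hn.pos.ne', LSeries.term_of_ne_zero hn.pos.ne',
        hodd n hn]
    · have : b n = _ := if_neg hn
      rw [this]
      rcases eq_or_ne n 0 with rfl | hn0
      · simp
      · have h0 : LSeries.term (fun n => (g n : ℂ)) s n = 0 := by
          rw [LSeries.term_of_ne_zero hn0, hg n hn]; simp
        rw [h0, zero_add]
  refine ⟨hsum.summable, ?_⟩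
  rw [dirichlet, LSeries, hsum.tsum_eq]
  ring

/-- Two classes of doubled index give w = 2, and 2·2^(-s) = 2^(1-s). -/
theorem dirichlet_fRot {s : ℂ} (hs : 3 < s.re) :
    LSeriesSummable (fun n => (fRot Z4 n : ℂ)) s ∧
      LSeriesSummable (fun n => (fRot D4s n : ℂ)) s ∧
      dirichlet (fRot Z4) s = (1 + 2 ^ (1 - s)) * dirichlet (fRot D4s) s ∧
      HasProd (rotFactor s) (dirichlet (fRot D4s) s) := by
  have h := isOddCount_fRot.lseriesSummable le_rfl hs
  obtain ⟨h1, h2⟩ := lseries_double (fun _ => fRot_Z4_eq_of_odd) fRot_Z4_two_mul_eq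
    (fun _ => fRot_D4s_of_not_odd) h
  have h3 := cpow_sub_eq Nat.prime_two 1 s
  push_cast at h3
  refine ⟨h1, h, ?_, hasProd_fRot hs⟩
  rw [h2, h3, pow_one]
  push_cast
  rfl

/-- The two classes of doubled index share their CSL, so here w = 1. -/
theorem dirichlet_fCSL {s : ℂ} (hs : 3 < s.re) :
    LSeriesSummable (fun n => (fCSL Z4 n : ℂ)) s ∧
      LSeriesSummable (fun n => (fCSL D4s n : ℂ)) s ∧
      dirichlet (fCSL Z4) s = (1 + 2 ^ (-s)) * dirichlet (fCSL D4s) s ∧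
      HasProd (cslFactor s) (dirichlet (fCSL D4s) s) := by
  have h := isOddCount_fCSL.lseriesSummable one_le_two hs
  obtain ⟨h1, h2⟩ := lseries_double (w := 1) (fun _ => fCSL_Z4_eq_of_odd)
    (fun n => by rw [one_mul, fCSL_Z4_two_mul_eq]) (fun _ => fCSL_D4s_of_not_odd) h
  refine ⟨h1, h, ?_, hasProd_fCSL hs⟩
  rw [h2, Nat.cast_one, one_mul]

end CoincidenceLattice

open CoincidenceLattice in
theorem mainTheorem4 :
    -- the two lattices, their point groups and their coincidence isometries
    (Z4 ≤ D4s ∧ Z4.relIndex D4s = 2) ∧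
    (pointGroup Z4 ≤ pointGroup D4s ∧ (pointGroup Z4).relIndex (pointGroup D4s) = 3 ∧
      {Q | Q ∈ pointGroup Z4 ∧ IsRotation Q}.ncard = 192 ∧
      {Q | Q ∈ pointGroup D4s ∧ IsRotation Q}.ncard = 576) ∧
    (OC Z4 = OC D4s) ∧
    -- splitting of the symmetry classes of coincidence rotations
    (∀ R ∈ SOC D4s, Odd (coincIndex D4s R) ∧
      ∃ R₁ ∈ symClass D4s R, ∃ R₂ ∈ symClass D4s R, ∃ R₃ ∈ symClass D4s R,
        symClass D4s R = symClass Z4 R₁ ∪ symClass Z4 R₂ ∪ symClass Z4 R₃ ∧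
        Disjoint (symClass Z4 R₁) (symClass Z4 R₂) ∧
        Disjoint (symClass Z4 R₁) (symClass Z4 R₃) ∧
        Disjoint (symClass Z4 R₂) (symClass Z4 R₃) ∧
        (∀ R' ∈ symClass Z4 R₁, coincIndex Z4 R' = coincIndex D4s R) ∧
        (∀ R' ∈ symClass Z4 R₂, coincIndex Z4 R' = 2 * coincIndex D4s R) ∧
        (∀ R' ∈ symClass Z4 R₃, coincIndex Z4 R' = 2 * coincIndex D4s R)) ∧
    -- splitting of the coincidence site lattices
    (∀ Λ ∈ CSLs D4s, Odd (Λ.relIndex D4s) ∧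
      ∃ Λ₁ Λ₂ : AddSubgroup E4,
        {Λ' | ∃ R ∈ OC D4s, csl D4s R = Λ ∧ csl Z4 R = Λ'} = {Λ₁, Λ₂} ∧
        Λ₁.relIndex Z4 = Λ.relIndex D4s ∧ Λ₂.relIndex Z4 = 2 * Λ.relIndex D4s) ∧
    (∀ R ∈ OC D4s, ∀ R' ∈ OC D4s, csl Z4 R = csl Z4 R' → csl D4s R = csl D4s R') ∧
    -- the numbers of coincidence rotations
    (∀ n : ℕ, (rotationsOfIndex Z4 n).Finite ∧
      (rotationsOfIndex Z4 n).ncard = 192 * fRot Z4 n) ∧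
    (∀ n : ℕ, (rotationsOfIndex D4s n).Finite ∧
      (rotationsOfIndex D4s n).ncard = 576 * fRot D4s n) ∧
    (fRot Z4 1 = 1 ∧ ∀ m n : ℕ, m.Coprime n → fRot Z4 (m * n) = fRot Z4 m * fRot Z4 n) ∧
    (∀ s : ℂ, 3 < s.re →
      LSeriesSummable (fun n => (fRot Z4 n : ℂ)) s ∧
      LSeriesSummable (fun n => (fRot D4s n : ℂ)) s ∧
      dirichlet (fRot Z4) s = (1 + 2 ^ (1 - s)) * dirichlet (fRot D4s) s ∧
      HasProd (rotFactor s) (dirichlet (fRot D4s) s)) ∧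
    ((List.range' 1 17).map (fRot Z4) =
      [1, 2, 16, 0, 36, 32, 64, 0, 168, 72, 144, 0, 196, 128, 576, 0, 324]) ∧
    -- the numbers of coincidence site lattices
    (∀ n : ℕ, (CSLsOfIndex Z4 n).Finite ∧ (CSLsOfIndex D4s n).Finite) ∧
    (∀ s : ℂ, 3 < s.re →
      LSeriesSummable (fun n => (fCSL Z4 n : ℂ)) s ∧
      LSeriesSummable (fun n => (fCSL D4s n : ℂ)) s ∧
      dirichlet (fCSL Z4) s = (1 + 2 ^ (-s)) * dirichlet (fCSL D4s) s ∧
      HasProd (cslFactor s) (dirichlet (fCSL D4s) s)) ∧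
    ((List.range' 1 17).map (fCSL Z4) =
      [1, 1, 16, 0, 36, 16, 64, 0, 152, 36, 144, 0, 196, 64, 576, 0, 324]) ∧
    -- the spectrum
    (coincSpectrum Z4 = {n | ∃ l m : ℕ, (l = 0 ∨ l = 1) ∧ Odd m ∧ n = 2 ^ l * m}) :=
  ⟨⟨Z4_le_D4s, relIndex_Z4_D4s⟩,
    ⟨pointGroup_Z4_le, relIndex_pointGroup, ncard_rotations_Z4, ncard_rotations_D4s⟩,
    OC_Z4_eq, fun _ => splitting_symClass, fun _ => splitting_csl,
    fun _ hR _ hR' => csl_D4s_eq_of_csl_Z4_eq hR hR',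
    fun n => ncard_rotationsOfIndex (by norm_num) ncard_rotations_Z4 (finite_rotationImages_Z4 n),
    fun n => ncard_rotationsOfIndex (by norm_num) ncard_rotations_D4s (finite_rotationImages_D4s n),
    ⟨fRot_Z4_one, fun _ _ => fRot_Z4_mul⟩, fun _ => dirichlet_fRot, fRot_Z4_values,
    fun n => ⟨finite_CSLsOfIndex_Z4 n, finite_CSLsOfIndex_D4s n⟩, fun _ => dirichlet_fCSL,
    fCSL_Z4_values, coincSpectrum_Z4⟩
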